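/- **Boosted RNN with bounded bit size.** *Language models.* Let $\Sigma=\{0,\dots,N-1\}$. A language model $q$ assigns to every string $s\in\Sigma^*$ a probability distribution $q(\cdot\mid s)$ on $\Sigma$; it induces $\bar q(x)=\prod_{i=1}^n q(x_i\mid x_1\cdots x_{i-1})$ on $\Sigma^n$. Fix an arbitrary training distribution $\bar p$ on $\Sigma^n$. The next-token loss is $L(q)=-\mathbb E_{x\sim\bar p}\big[\frac1n\sum_{i=1}^n\ln q(x_i\mid x_1\cdots x_{i-1})\big]$. A next-$k$-token distinguisher is $d:[n]\times\Sigma^n\to\{0,1\}$ such that $d_i(x)$ depends only on $x_{:i+k}:=x_1\cdots x_{\min(i+k-1,n)}$. Its advantage is $$a(d,\bar p,\bar q)=\mathbb E_{y\sim\bar p}\Big[\tfrac1n\sum_{i=1}^n\big(\mathbb E_{x\sim\bar q}[d_i(x)\mid x_1\cdots x_{i-1}=y_1\cdots y_{i-1}]-d_i(y)\big)\Big].$$ *RNNs.* An RNN $Q$ is a finite directed graph with $|Q|$ nodes, an input node, an output node, initial node values, an RNN-time $\mathcal T_Q\ge1$, a set $H_Q$ of hidden nodes (not containing the input node), and for every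 non-input node $v$ a transition function $f_v$ of the values of its in-neighbours; for $v\in H_Q$ these lie in $H_Q$ or are the input node. A transition function is a finite composition of the elementary functions $\max(0,w^\top x)$, $\prod_i x_i$ (the empty product is the constant $1$) and $1/w^\top x$, with real weights $w$. The RNN reads a string token by token: the token is written to the input node and held there for $\mathcal T_Q$ time steps, and in each step all other nodes are simultaneously updated to $f_v$ of the current node values, rounded down to a multiple of $2^{-F}$, where $F$ is the number of fractional bits. The output on a string is the value of the output node after the string has been read. The hidden nodes must be sufficient: after any string has been read, resetting all nodes outside $H_Q$ to their initial values does not change the output on any nonempty continuation. $Q$ has bit size $b=1+I+F$, with $I$ integer and $F$ fractional bits, if in all runs (including those resumed from the hidden node values after any string, with the other nodes reset) no denominator vanishes and every node value is of the form $\pm(r_I+r_F)$ with an integer $0\le r_I\le 2^{I}$ and $r_F\in[0,1)$ a multiple of $2^{-F}$. $Q$ implements $q$ if its output on $s\cdot y$ is $q(y\mid s)$ for all $s\in\Sigma^*$, $y\in\Sigma$; an RNN $D$ implements $d$ if its output on $x_{:i+k}$ is $d_i(x)$ for all $i\in[n]$, $x\in\Sigma^n$. *Lemma.* There is a function $C:\mathbb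 N\to\mathbb N$ such that the following holds. Let $0<\alpha,\ell\le1$, let $k\ge1$ and let $b=1+b_I+b_F$, $b_D=1+b_{D,I}+b_{D,F}$ be natural numbers. Let $q$ be a language model implemented by an RNN $Q$ of bit size $b$ ($b_I$ integer and $b_F$ fractional bits), with all next-token probabilities at least $\ell$. Let $d$ be a next-$k$-token distinguisher with advantage $a(d,\bar p,\bar q)=\alpha$, implemented by an RNN $D$ of bit size $b_D$ ($b_{D,I}$ integer and $b_{D,F}$ fractional bits). Assume $$b_I\ge b_{D,I}+k\log_2|\Sigma|+\log_2(k\mathcal T_D)+1,\qquad b_F\ge b_{D,F},\qquad 2^{-b_F}\le\frac{\alpha^2\ell^{k+1}}{1088k^2}.$$ Then there is a language model $q'$ implemented by an RNN $Q'$ with $$|Q'|=|Q|+|H_Q|+|D|+|H_D|+7k+25,\quad |H_{Q'}|=|H_Q|+|H_D|+6k+17,\quad \mathcal T_{Q'}=(|\Sigma|^k+1)\,k\,(\max\{\mathcal T_Q,\mathcal T_D\}+4),$$ of bit size $b+\log_2\mathcal T_Q$, with $b_I+\log_2\mathcal T_Q$ integer bits and $b_F$ fractional bits, such that all next-token probabilities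 of $q'$ are at least $\ell/4$ and $$L(q')-L(q)\le-\frac{\alpha^2}{8k}.$$ Moreover, if each transition function of $Q$ and of $D$ is composed of at most $m$ elementary functions, then each transition function of $Q'$ is composed of at most $C(m)$ of them. -/

import Mathlib

/-! ### Recurrent neural networks -/

/-- Transition functions: compositions of the three elementary functions
ReLU `max (0, w ⬝ x)`, product `∏ xᵢ` and reciprocal `1 / (w ⬝ x)`, applied to the node values.
The empty product is the constant `1`, which provides the bias terms. -/
inductive TransFn (V : Type) : Type where
  | var (v : V) : TransFn V
  | relu {m : ℕ} (w : Fin m → ℝ) (e : Fin m → TransFn V) : TransFn V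
  | prod {m : ℕ} (e : Fin m → TransFn V) : TransFn V
  | recip {m : ℕ} (w : Fin m → ℝ) (e : Fin m → TransFn V) : TransFn V

/-- The value of a transition function at given node values. -/
noncomputable def TransFn.eval {V : Type} (S : V → ℝ) : TransFn V → ℝ
  | .var v => S v
  | .relu w e => max 0 (∑ i, w i * (e i).eval S)
  | .prod e => ∏ i, (e i).eval S
  | .recip w e => 1 / ∑ i, w i * (e i).eval S

/-- All denominators that occur in the evaluation are nonzero. -/
def TransFn.Defined {V : Type} (S : V → ℝ) : TransFn V → Prop
  | .var _ => True
  | .relu _ e => ∀ i, (e i).Defined S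
  | .prod e => ∀ i, (e i).Defined S
  | .recip w e => (∀ i, (e i).Defined S) ∧ ∑ i, w i * (e i).eval S ≠ 0

/-- The nodes that a transition function reads. -/
def TransFn.vars {V : Type} : TransFn V → Set V
  | .var v => {v}
  | .relu _ e => ⋃ i, (e i).vars
  | .prod e => ⋃ i, (e i).vars
  | .recip _ e => ⋃ i, (e i).vars

/-- The number of elementary functions that a transition function is composed of. -/
def TransFn.ops {V : Type} : TransFn V → ℕ
  | .var _ => 0
  | .relu _ e => 1 + ∑ i, (e i).ops
  | .prod e => 1 + ∑ i, (e i).ops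
  | .recip _ e => 1 + ∑ i, (e i).ops

/-- A recurrent neural network. Its graph has an edge from `u` to `v` when `u ∈ (f v).vars`.
The input node `inp` is set externally, so the entry `f inp` is never used. The hidden nodes `hid`
are updated from the input node and the hidden nodes alone. -/
structure RNN where
  V : Type
  [fintypeV : Fintype V]
  [decEqV : DecidableEq V]
  inp : V
  out : V
  f : V → TransFn V
  init : V → ℝ
  time : ℕ
  time_pos : 0 < time
  hid : Finset V
  inp_notMem_hid : inp ∉ hid
  hid_closed : ∀ h ∈ hid, ∀ u ∈ (f h).vars, u = inp ∨ u ∈ hid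

attribute [instance] RNN.fintypeV RNN.decEqV

/-- Rounding down to `F` fractional bits. -/
noncomputable def quantize (F : ℕ) (x : ℝ) : ℝ := (⌊x * 2 ^ F⌋ : ℝ) / 2 ^ F

/-- `r = ± (r_I + r_F)`, where `r_I ≤ 2 ^ I` is a natural number and `r_F ∈ [0, 1)` is a multiple
of `2 ^ (-F)`: the number `r` is stored with a sign, `I` integer bits and `F` fractional bits. -/
def FixedPoint (I : ℝ) (F : ℕ) (r : ℝ) : Prop :=
  (⌊|r|⌋ : ℝ) ≤ (2 : ℝ) ^ I ∧ ∃ z : ℤ, r = z / 2 ^ F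

namespace RNN

/-- The size: the number of nodes, including the input node. -/
def size (Q : RNN) : ℕ := Fintype.card Q.V

/-- Write the next input to the input node. -/
def feed (Q : RNN) (x : ℝ) (S : Q.V → ℝ) : Q.V → ℝ := Function.update S Q.inp x

/-- One time step: all nodes except the input node are updated simultaneously, and every newly
computed value is quantized to `F` fractional bits. -/
noncomputable def step (Q : RNN) (F : ℕ) (S : Q.V → ℝ) : Q.V → ℝ :=
  fun v => if v = Q.inp then S v else quantize F ((Q.f v).eval S)

/-- Read a token and hold it on the input node for `Q.time` time steps. -/
noncomputable def process (Q : RNN) {N : ℕ} (F : ℕ) (S : Q.V → ℝ) (x : Fin N) : Q.V → ℝ :=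
  (Q.step F)^[Q.time] (Q.feed (x.val : ℝ) S)

/-- Read a string, starting from the node values `S`. -/
noncomputable def runFrom (Q : RNN) {N : ℕ} (F : ℕ) (S : Q.V → ℝ) (s : List (Fin N)) : Q.V → ℝ :=
  s.foldl (Q.process F) S

/-- The RNN function: the value of the output node after a string has been read. -/
noncomputable def output (Q : RNN) {N : ℕ} (F : ℕ) (s : List (Fin N)) : ℝ :=
  Q.runFrom F Q.init s Q.out

/-- The hidden nodes have their values after the string `s` has been read, and all other nodes
have their initial values. -/
noncomputable def restart (Q : RNN) {N : ℕ} (F : ℕ) (s : List (Fin N)) : Q.V → ℝ :=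
  fun v => if v ∈ Q.hid then Q.runFrom F Q.init s v else Q.init v

/-- The hidden node values and the remaining input suffice to compute the later outputs: the
network that keeps its hidden node values and resets all other nodes computes them. -/
def HiddenSuffices (Q : RNN) (N F : ℕ) : Prop :=
  ∀ s u : List (Fin N), u ≠ [] → Q.runFrom F (Q.restart F s) u Q.out = Q.output F (s ++ u)

/-- The node values at `j` time steps after the token `x` has been read, in the run that has
resumed from the hidden node values of the string `s` and has read the string `u` since.
(With `s = []` this is the ordinary run from the initial values.) -/
noncomputable def config (Q : RNN) {N : ℕ} (F : ℕ) (s u : List (Fin N)) (x : Fin N) (j : ℕ) :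
    Q.V → ℝ :=
  (Q.step F)^[j] (Q.feed (x.val : ℝ) (Q.runFrom F (Q.restart F s) u))

/-- The network runs over an alphabet of `N` tokens with bit size `b = 1 + I + F`: when every
computed value is quantized to `F` fractional bits, no denominator vanishes and all nodes can be
stored with `I` integer bits at all times (so that integer parts never overflow). -/
def HasBitSize (Q : RNN) (N : ℕ) (b I : ℝ) (F : ℕ) : Prop :=
  b = 1 + I + F ∧
  ∀ (s u : List (Fin N)) (x : Fin N),
    (∀ j ≤ Q.time, ∀ v, FixedPoint I F (Q.config F s u x j v)) ∧
    (∀ j < Q.time, ∀ v, v ≠ Q.inp → (Q.f v).Defined (Q.config F s u x j))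

/-- Each transition function is composed of at most `m` elementary functions. -/
def OpsLE (Q : RNN) (m : ℕ) : Prop := ∀ v, v ≠ Q.inp → (Q.f v).ops ≤ m

end RNN

/-! ### Language models and distinguishers -/

/-- A language model over the alphabet `Fin N`: `prob s y` is the probability that `y` is the next
token after the prefix `s`. -/
structure LangModel (N : ℕ) where
  prob : List (Fin N) → Fin N → ℝ
  nonneg : ∀ s y, 0 ≤ prob s y
  sum_one : ∀ s, ∑ y, prob s y = 1

/-- A distribution over texts of length `n`. -/
structure TextDist (n N : ℕ) where
  prob : (Fin n → Fin N) → ℝ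
  nonneg : ∀ x, 0 ≤ prob x
  sum_one : ∑ x, prob x = 1

/-- The first `m` tokens of a text (the whole text if `m ≥ n`). -/
def textPrefix {n N : ℕ} (x : Fin n → Fin N) (m : ℕ) : List (Fin N) := (List.ofFn x).take m

/-- The probability that a language model assigns to a text. -/
noncomputable def LangModel.textProb {N n : ℕ} (q : LangModel N) (x : Fin n → Fin N) : ℝ :=
  ∏ i : Fin n, q.prob (textPrefix x i) (x i)

/-- The next-token loss with respect to the training distribution `p`. -/
noncomputable def nextTokenLoss {n N : ℕ} (p : TextDist n N) (q : LangModel N) : ℝ :=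
  -∑ x, p.prob x * ((1 / (n : ℝ)) * ∑ i : Fin n, Real.log (q.prob (textPrefix x i) (x i)))

/-- A next-`k`-token distinguisher. The verdict at `i : Fin n` depends on the `i` tokens of the
prefix and on the window of the `k` tokens that follow it (cut off at the end of the text). -/
structure Distinguisher (n N k : ℕ) where
  d : Fin n → (Fin n → Fin N) → ℝ
  binary : ∀ i x, d i x = 0 ∨ d i x = 1
  window : ∀ i x y, (∀ j : Fin n, j.val < i.val + k → x j = y j) → d i x = d i y

/-- The conditional expectation of `g` under the text distribution of `q`, given that the first `i`
tokens are those of `y`. -/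
noncomputable def LangModel.condExp {N n : ℕ} (q : LangModel N) (g : (Fin n → Fin N) → ℝ)
    (i : ℕ) (y : Fin n → Fin N) : ℝ :=
  (∑ x with ∀ j : Fin n, j.val < i → x j = y j, q.textProb x * g x) /
    ∑ x with ∀ j : Fin n, j.val < i → x j = y j, q.textProb x

/-- The advantage of a distinguisher between the training distribution and a language model. -/
noncomputable def advantage {n N k : ℕ} (d : Distinguisher n N k) (p : TextDist n N)
    (q : LangModel N) : ℝ :=
  ∑ y, p.prob y * ((1 / (n : ℝ)) * ∑ i : Fin n, (q.condExp (d.d i) i y - d.d i y))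

/-- After reading `s` and then `y`, the network outputs the probability of `y` after `s`. -/
def RNN.ImplementsLM (Q : RNN) {N : ℕ} (F : ℕ) (q : LangModel N) : Prop :=
  ∀ s y, Q.output F (s ++ [y]) = q.prob s y

/-- After reading the prefix and the window, the network outputs the verdict. -/
def RNN.ImplementsDistinguisher (D : RNN) {n N k : ℕ} (F : ℕ) (d : Distinguisher n N k) : Prop :=
  ∀ (i : Fin n) (x : Fin n → Fin N), D.output F (textPrefix x (i + k)) = d.d i x

/-! ### Building transition functions -/

/-! The boosted model tilts the law of the next tokens. Cut the text into blocks of length `k` that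
start at the positions `b ≡ -o` modulo `k`, and let `V` be the verdict of `D` at the end of the
block. For a prefix `s` inside the block let `M(s)` be the expectation of `1 - κV` under `q` given
`s`. The model `q(y|s) M(sy) / M(s)` gains `log M(sy) - log M(s)` over `q` at each token. Over a
block this telescopes to `log (1 - κV) - log (1 - κ E[V])`, with the expectation taken at the start
of the block (`blockGain_sum`), and this is at least `κ(E[V] - V) - κ²` (`blockGain_ge`). Each
position starts a block for exactly one of the `k` offsets `o`, so some offset gains at least `n(κα
- κ²)/k` in expectation (`exists_offset`). For `κ = α/2` the loss falls by `α²/(4k)`, twice what is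
needed; the slack pays for rounding and for a text too long to be counted.

The network computes `M` by brute force. While it holds one input token it enumerates the `N^k`
windows, read as numbers `W` in base `N` whose lowest digit is the first token. For each window,
copies of `Q` and `D` are reset to the hidden values stored for the prefix and run over the digits;
the weight of the window is the product of the probabilities given by `Q`, times `1 - κV` at the
token where the verdict is due. The sum of the weights is `M(s)`, and the sum over the windows that
start with `y` is `q(y|s) M(sy)`. One extra pass, `W = N^k`, advances the stored hidden values by
the actual input token. The output is a difference of two rounded cumulative shares (first token `≤
y` and `< y`), so that the outputs sum to exactly one in spite of rounding (`sum_outval`). Windows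
have weight at least `ℓ^k/2`, so rounding lowers the ideal probabilities at most by a factor `1 - δ`
(`ideal_le_outval`).

Three devices make this fit into the given bits. Counters are stored in units of `2^(-F)`, which
extends their range by the fractional bits. The values of `D`, which has fewer fractional bits, are
scaled by a power of two, so that the network rounds them exactly as `D` does
(`quantize_div_two_pow`). A ReLU cannot return negative values, but simulated nodes may be negative;
since there are finitely many fixed-point states, no value lies in some interval `(-ε, 0)`
(`RNN.exists_gap`), and across this gap a reciprocal can recover the sign (`eval_signedLin`).
Correctness is an invariant of the register contents (`Inv`), indexed by the clock and preserved by
every time step. -/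

namespace TransFn

variable {V V' : Type}

/-- The constant `1`. -/
def one : TransFn V := .prod (m := 0) Fin.elim0

/-- The constant `0`. -/
def zero : TransFn V := .relu (m := 0) Fin.elim0 Fin.elim0

@[simp] lemma eval_one (S : V → ℝ) : (one : TransFn V).eval S = 1 := by simp [one, eval]
@[simp] lemma eval_zero (S : V → ℝ) : (zero : TransFn V).eval S = 0 := by simp [zero, eval]
@[simp] lemma defined_one (S : V → ℝ) : (one : TransFn V).Defined S := by simp [one, Defined]
@[simp] lemma defined_zero (S : V → ℝ) : (zero : TransFn V).Defined S := by simp [zero, Defined]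
@[simp] lemma vars_one : (one : TransFn V).vars = ∅ := by simp [one, vars]
@[simp] lemma vars_zero : (zero : TransFn V).vars = ∅ := by simp [zero, vars]
@[simp] lemma ops_one : (one : TransFn V).ops = 1 := by simp [one, ops]
@[simp] lemma ops_zero : (zero : TransFn V).ops = 1 := by simp [zero, ops]

/-- The product of two terms. -/
def mul (e f : TransFn V) : TransFn V := .prod ![e, f]

@[simp] lemma eval_mul (S : V → ℝ) (e f : TransFn V) :
    (mul e f).eval S = e.eval S * f.eval S := by
  simp [mul, eval, Fin.prod_univ_succ]
@[simp] lemma defined_mul (S : V → ℝ) (e f : TransFn V) :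
    (mul e f).Defined S ↔ e.Defined S ∧ f.Defined S := by
  simp [mul, Defined, Fin.forall_fin_succ]
@[simp] lemma vars_mul (e f : TransFn V) : (mul e f).vars = e.vars ∪ f.vars := by
  ext; simp [mul, vars, Fin.exists_fin_succ]
@[simp] lemma ops_mul (e f : TransFn V) : (mul e f).ops = 1 + (e.ops + f.ops) := by
  simp [mul, ops, Fin.sum_univ_succ]

/-- The positive part of `x e + y f`. -/
def lin (x : ℝ) (e : TransFn V) (y : ℝ) (f : TransFn V) : TransFn V := .relu ![x, y] ![e, f]

@[simp] lemma eval_lin (S : V → ℝ) (x y : ℝ) (e f : TransFn V) :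
    (lin x e y f).eval S = max 0 (x * e.eval S + y * f.eval S) := by
  simp [lin, eval, Fin.sum_univ_succ]
@[simp] lemma defined_lin (S : V → ℝ) (x y : ℝ) (e f : TransFn V) :
    (lin x e y f).Defined S ↔ e.Defined S ∧ f.Defined S := by
  simp [lin, Defined, Fin.forall_fin_succ]
@[simp] lemma vars_lin (x y : ℝ) (e f : TransFn V) : (lin x e y f).vars = e.vars ∪ f.vars := by
  ext; simp [lin, vars, Fin.exists_fin_succ]
@[simp] lemma ops_lin (x y : ℝ) (e f : TransFn V) :
    (lin x e y f).ops = 1 + (e.ops + f.ops) := by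
  simp [lin, ops, Fin.sum_univ_succ]

/-- The reciprocal of `e + f`. -/
def recipAdd (e f : TransFn V) : TransFn V := .recip ![1, 1] ![e, f]

@[simp] lemma eval_recipAdd (S : V → ℝ) (e f : TransFn V) :
    (recipAdd e f).eval S = 1 / (e.eval S + f.eval S) := by
  simp [recipAdd, eval, Fin.sum_univ_succ]
@[simp] lemma defined_recipAdd (S : V → ℝ) (e f : TransFn V) :
    (recipAdd e f).Defined S ↔ (e.Defined S ∧ f.Defined S) ∧ e.eval S + f.eval S ≠ 0 := by
  simp [recipAdd, Defined, Fin.forall_fin_succ, Fin.sum_univ_succ]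
@[simp] lemma ops_recipAdd (e f : TransFn V) : (recipAdd e f).ops = 1 + (e.ops + f.ops) := by
  simp [recipAdd, ops, Fin.sum_univ_succ]

@[simp] lemma eval_var (S : V → ℝ) (v : V) : (var v).eval S = S v := rfl
@[simp] lemma defined_var (S : V → ℝ) (v : V) : (var v).Defined S := trivial
@[simp] lemma vars_var (v : V) : (var v).vars = {v} := rfl
@[simp] lemma ops_var (v : V) : (var v).ops = 0 := rfl

/-- The complement of a gate. -/
def notG (g : TransFn V) : TransFn V := lin 1 one (-1) g

/-- `e` or `f`, depending on the gate `g`. -/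
def sel (g e f : TransFn V) : TransFn V := lin 1 (mul g e) 1 (mul (notG g) f)

/-- The test `e ≤ f` for integer values. -/
def leG (e f : TransFn V) : TransFn V := lin 1 (lin 1 (lin 1 f 1 one) (-1) e) (-1) (lin 1 f (-1) e)

/-- The test `e = f` for integer values. -/
def eqG (e f : TransFn V) : TransFn V :=
  lin 1 one (-1) (lin 1 (lin 1 e (-1) f) 1 (lin 1 f (-1) e))

/-- A constant natural number. -/
def nat (n : ℕ) : TransFn V := lin n one 0 one

/-- The natural number stored by a node whose value is a multiple of `u⁻¹`. -/
def dec (u : ℝ) (v : V) : TransFn V := lin u (var v) 0 one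

lemma eval_nat (S : V → ℝ) (n : ℕ) : (nat n).eval S = n := by simp [nat]

lemma eval_notG {S : V → ℝ} {g : TransFn V} {p : Prop} [Decidable p]
    (hg : g.eval S = if p then 1 else 0) : (notG g).eval S = if ¬ p then 1 else 0 := by
  by_cases p <;> simp_all [notG]

lemma eval_andG {S : V → ℝ} {g h : TransFn V} {p r : Prop} [Decidable p] [Decidable r]
    (hg : g.eval S = if p then 1 else 0) (hh : h.eval S = if r then 1 else 0) :
    (mul g h).eval S = if p ∧ r then 1 else 0 := by
  by_cases p <;> by_cases r <;> simp_all

lemma eval_sel {S : V → ℝ} {g e f : TransFn V} {p : Prop} [Decidable p] {x y : ℝ}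
    (hg : g.eval S = if p then 1 else 0) (he : e.eval S = x) (hf : f.eval S = y) (hx : 0 ≤ x)
    (hy : 0 ≤ y) : (sel g e f).eval S = if p then x else y := by
  by_cases p <;> simp_all [sel, notG]

/-- On integers `max 0 (n + 1 - m) - max 0 (n - m)` is the indicator of `m ≤ n`. -/
lemma eval_leG {S : V → ℝ} {e f : TransFn V} {m n : ℕ} (he : e.eval S = m) (hf : f.eval S = n) :
    (leG e f).eval S = if m ≤ n then 1 else 0 := by
  have hn : (0 : ℝ) ≤ n := Nat.cast_nonneg n
  simp only [leG, eval_lin, he, hf, eval_one]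
  split_ifs with h
  · have : (m : ℝ) ≤ n := by exact_mod_cast h
    rw [max_eq_right (by linarith : (0 : ℝ) ≤ 1 * n + 1 * 1),
      max_eq_right (by linarith : (0 : ℝ) ≤ 1 * n + -1 * m),
      max_eq_right (by linarith : (0 : ℝ) ≤ 1 * (1 * n + 1 * 1) + -1 * m)]
    rw [max_eq_right] <;> linarith
  · have : (n : ℝ) + 1 ≤ m := by exact_mod_cast (by omega : n + 1 ≤ m)
    rw [max_eq_right (by linarith : (0 : ℝ) ≤ 1 * n + 1 * 1),
      max_eq_left (by linarith : 1 * (n : ℝ) + -1 * m ≤ 0),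
      max_eq_left (by linarith : 1 * (1 * (n : ℝ) + 1 * 1) + -1 * m ≤ 0)]
    simp

/-- The gate is the positive part of `1 - |m - n|`: the two inner positive parts add up to `|m -
n|`. -/
lemma eval_eqG {S : V → ℝ} {e f : TransFn V} {m n : ℕ} (he : e.eval S = m) (hf : f.eval S = n) :
    (eqG e f).eval S = if m = n then 1 else 0 := by
  simp only [eqG, eval_lin, he, hf, eval_one]
  rcases lt_trichotomy m n with h | h | h
  · have : (m : ℝ) + 1 ≤ n := by exact_mod_cast h
    rw [if_neg (by omega), max_eq_left (by linarith : 1 * (m : ℝ) + -1 * n ≤ 0),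
      max_eq_right (by linarith : 0 ≤ 1 * (n : ℝ) + -1 * m),
      max_eq_right (by linarith : 0 ≤ 1 * (0 : ℝ) + 1 * (1 * (n : ℝ) + -1 * m)), max_eq_left]
    linarith
  · subst h; simp
  · have : (n : ℝ) + 1 ≤ m := by exact_mod_cast h
    rw [if_neg (by omega), max_eq_right (by linarith : 0 ≤ 1 * (m : ℝ) + -1 * n),
      max_eq_left (by linarith : 1 * (n : ℝ) + -1 * m ≤ 0),
      max_eq_right (by linarith : 0 ≤ 1 * (1 * (m : ℝ) + -1 * n) + 1 * (0 : ℝ)), max_eq_left]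
    linarith

lemma eval_dec {S : V → ℝ} {u : ℝ} {v : V} {n : ℕ} (hu : 0 < u) (h : S v = n / u) :
    (dec u v).eval S = n := by
  have : u * (n / u) = n := by field_simp
  simp [dec, h, this]

/-! ### Signed linear combinations -/

/-- A linear combination with either sign, provided that its value is not in `(-ε, 0)`: the product
of its absolute value and its sign. -/
noncomputable def signedLin (ε : ℝ) {m : ℕ} (w : Fin m → ℝ) (e : Fin m → TransFn V) : TransFn V :=
  mul
    (.recip ![1, -(2 / ε), 2 / ε]
      ![one, .relu (fun i => -w i) e, lin 1 (.relu (fun i => -w i) e) (-ε) one])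
    (lin 1 (.relu w e) 1 (.relu (fun i => -w i) e))

/-- The denominator of `signedLin` is a piecewise linear sign function: it falls from `1` to `-1` as
`L` goes from `0` to `-ε` and is constant elsewhere. Its zero `-ε/2` lies in the gap, and `±1` is
its own reciprocal. -/
lemma sign_denominator {ε L : ℝ} (hε : 0 < ε) (hL : 0 ≤ L ∨ L ≤ -ε) :
    1 + (-(2 / ε) * max 0 (-L) + 2 / ε * max 0 (max 0 (-L) + -ε)) = if 0 ≤ L then 1 else -1 := by
  rcases hL with h | h
  · rw [if_pos h, max_eq_left (by linarith : -L ≤ 0), max_eq_left (by linarith)]; simp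
  · rw [if_neg (by linarith), max_eq_right (by linarith : 0 ≤ -L), max_eq_right (by linarith)]
    field_simp; ring

lemma eval_signedLin {S : V → ℝ} {ε : ℝ} {m : ℕ} {w : Fin m → ℝ} {e : Fin m → TransFn V} {L : ℝ}
    (hε : 0 < ε) (hL : ∑ i, w i * (e i).eval S = L) (h : 0 ≤ L ∨ L ≤ -ε) :
    (signedLin ε w e).eval S = L := by
  have hn : ∑ i, -w i * (e i).eval S = -L := by simp [← hL]
  have key := sign_denominator hε h
  simp only [signedLin, eval_mul, eval, Fin.sum_univ_three, eval_lin, hL, hn, Matrix.cons_val_zero,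
    Matrix.cons_val_one, Matrix.cons_val, eval_one, one_mul, mul_one]
  rw [add_assoc, key]
  rcases h with h | h
  · rw [if_pos h, max_eq_left (by linarith : -L ≤ 0), max_eq_right h, max_eq_right (by linarith)]
    ring
  · rw [if_neg (by linarith), max_eq_right (by linarith : 0 ≤ -L), max_eq_left (by linarith : L ≤ 0),
      max_eq_right (by linarith)]
    ring

lemma defined_signedLin {S : V → ℝ} {ε : ℝ} {m : ℕ} {w : Fin m → ℝ} {e : Fin m → TransFn V} {L : ℝ}
    (hε : 0 < ε) (hL : ∑ i, w i * (e i).eval S = L) (h : 0 ≤ L ∨ L ≤ -ε)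
    (hd : ∀ i, (e i).Defined S) : (signedLin ε w e).Defined S := by
  have hn : ∑ i, -w i * (e i).eval S = -L := by simp [← hL]
  have key := sign_denominator hε h
  simp only [signedLin, defined_mul, Defined, Fin.forall_fin_succ, Fin.sum_univ_three]
  simp only [eval, eval_lin, hn, Matrix.cons_val_zero,
    Matrix.cons_val_one, Matrix.cons_val, eval_one, one_mul, mul_one, defined_lin, Defined,
    Matrix.cons_val_succ, defined_one]
  refine ⟨⟨⟨trivial, hd, ⟨hd, trivial⟩, fun i => i.elim0⟩, ?_⟩, hd, hd⟩
  rw [add_assoc, key]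
  split_ifs <;> norm_num

lemma vars_signedLin (ε : ℝ) {m : ℕ} (w : Fin m → ℝ) (e : Fin m → TransFn V) :
    (signedLin ε w e).vars = ⋃ i, (e i).vars := by
  ext; simp [signedLin, vars, Fin.exists_fin_succ]

lemma ops_signedLin (ε : ℝ) {m : ℕ} (w : Fin m → ℝ) (e : Fin m → TransFn V) :
    (signedLin ε w e).ops = 10 + 4 * ∑ i, (e i).ops := by
  simp [signedLin, ops, Fin.sum_univ_succ]; ring

/-! ### Simulating a transition function on other nodes -/

/-- The factor by which a node value is scaled. -/
def scaleOf (c : V → ℝ) : TransFn V → ℝ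
  | .var v => c v
  | _ => 1

/-- The transition function that reads `c v * S (ρ v)` instead of the value of `v`, up to the factor
`scaleOf c`. When the gate `g` is off, all denominators are replaced by `1`. -/
def sim (ρ : V → V') (c : V → ℝ) (g : TransFn V') : TransFn V → TransFn V'
  | .var v => .var (ρ v)
  | .relu w e => .relu (fun i => w i * scaleOf c (e i)) (fun i => sim ρ c g (e i))
  | .prod e => mul (lin (∏ i, scaleOf c (e i)) one 0 one) (.prod (fun i => sim ρ c g (e i)))
  | .recip w e => .recip ![1, -1, 1, -1]
      ![mul g (.relu (fun i => w i * scaleOf c (e i)) (fun i => sim ρ c g (e i))),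
        mul g (.relu (fun i => -(w i * scaleOf c (e i))) (fun i => sim ρ c g (e i))), one, g]

lemma scaleOf_pos {c : V → ℝ} (hc : ∀ v, 0 < c v) (e : TransFn V) : 0 < scaleOf c e := by
  cases e <;> simp [scaleOf, hc]

lemma max_sub_max_neg (x : ℝ) : max 0 x - max 0 (-x) = x := by
  rcases le_total 0 x with h | h
  · rw [max_eq_right h, max_eq_left (by linarith)]; ring
  · rw [max_eq_left h, max_eq_right (by linarith)]; ring

lemma scaleOf_relu (c : V → ℝ) {m : ℕ} (w : Fin m → ℝ) (e : Fin m → TransFn V) :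
    scaleOf c (.relu w e) = 1 := rfl
lemma scaleOf_prod (c : V → ℝ) {m : ℕ} (e : Fin m → TransFn V) : scaleOf c (.prod e) = 1 := rfl
lemma scaleOf_recip (c : V → ℝ) {m : ℕ} (w : Fin m → ℝ) (e : Fin m → TransFn V) :
    scaleOf c (.recip w e) = 1 := rfl

variable {ρ : V → V'} {c : V → ℝ} {g : TransFn V'} {S : V' → ℝ}

/-- The scale of a node is absorbed by the elementary function that reads it: into the weights of a
ReLU or reciprocal, into an extra constant factor of a product. Only a bare node keeps a factor. -/
lemma eval_sim (hc : ∀ v, 0 < c v) (hg : g.eval S = 1) (e : TransFn V) :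
    scaleOf c e * (sim ρ c g e).eval S = e.eval (fun v => c v * S (ρ v)) := by
  induction e with
  | var v => rfl
  | relu w e ih => simp [sim, eval, scaleOf_relu, ← ih, mul_assoc]
  | prod e ih =>
    simp only [sim, eval_mul, eval, scaleOf_prod, ← ih, Finset.prod_mul_distrib, eval_lin, eval_one]
    rw [max_eq_right (by simpa using Finset.prod_nonneg fun i _ => (scaleOf_pos hc (e i)).le)]
    ring
  | recip w e ih =>
    have h (i) : w i * scaleOf c (e i) * (sim ρ c g (e i)).eval S =
      w i * (e i).eval (fun v => c v * S (ρ v)) := by rw [← ih]; ring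
    simp only [sim, eval, scaleOf_recip, Fin.sum_univ_four, Matrix.cons_val_zero, Matrix.cons_val_one,
      Matrix.cons_val, eval_mul, hg, eval_one, neg_mul, Finset.sum_neg_distrib, h]
    have := max_sub_max_neg (∑ i, w i * (e i).eval (fun v => c v * S (ρ v)))
    rw [one_mul]
    congr 1
    linarith

lemma defined_sim (hc : ∀ v, 0 < c v) (hg : g.eval S = 1) (hgd : g.Defined S) (e : TransFn V)
    (h : e.Defined (fun v => c v * S (ρ v))) : (sim ρ c g e).Defined S := by
  induction e with
  | var v => trivial
  | relu w e ih => exact fun i => ih i (h i)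
  | prod e ih => exact (defined_mul ..).2 ⟨by simp, fun i => ih i (h i)⟩
  | recip w e ih =>
    have h' (i) : w i * scaleOf c (e i) * (sim ρ c g (e i)).eval S =
      w i * (e i).eval (fun v => c v * S (ρ v)) := by rw [← eval_sim hc hg]; ring
    have h1 := fun i => ih i (h.1 i)
    refine ⟨?_, ?_⟩
    · simp [Fin.forall_fin_succ, Defined, hgd, h1]
    · simp only [eval, Fin.sum_univ_four, Matrix.cons_val_zero, Matrix.cons_val_one,
        Matrix.cons_val, eval_mul, hg, eval_one, neg_mul, Finset.sum_neg_distrib, h']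
      have := max_sub_max_neg (∑ i, w i * (e i).eval (fun v => c v * S (ρ v)))
      intro h0
      exact h.2 (by linarith)

/-- A gated denominator is `g L + 1 - g`, with `L` written as a difference of positive parts.
Without the gate it could vanish at times when the token register does not yet hold the token to be
read. -/
lemma defined_sim_of_off (hg : g.eval S = 0) (hgd : g.Defined S) (e : TransFn V) :
    (sim ρ c g e).Defined S := by
  induction e with
  | var v => trivial
  | relu w e ih => exact fun i => ih i
  | prod e ih => exact (defined_mul ..).2 ⟨by simp, fun i => ih i⟩
  | recip w e ih =>
    refine ⟨?_, ?_⟩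
    · simp [Fin.forall_fin_succ, Defined, hgd, ih]
    · simp [eval, Fin.sum_univ_four, hg]

lemma vars_sim_subset (e : TransFn V) : (sim ρ c g e).vars ⊆ ρ '' e.vars ∪ g.vars := by
  induction e with
  | var v => simp [sim]
  | relu w e ih =>
    simp only [sim, vars]
    exact Set.iUnion_subset fun i => (ih i).trans
      (Set.union_subset_union_left _ (Set.image_mono (Set.subset_iUnion (fun i => (e i).vars) i)))
  | prod e ih =>
    simp only [sim, vars, vars_mul, vars_lin, vars_one, Set.empty_union]
    exact Set.iUnion_subset fun i => (ih i).trans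
      (Set.union_subset_union_left _ (Set.image_mono (Set.subset_iUnion (fun i => (e i).vars) i)))
  | recip w e ih =>
    have key : (⋃ i, (sim ρ c g (e i)).vars) ⊆ ρ '' (⋃ i, (e i).vars) ∪ g.vars :=
      Set.iUnion_subset fun i => (ih i).trans
      (Set.union_subset_union_left _ (Set.image_mono (Set.subset_iUnion (fun i => (e i).vars) i)))
    intro x hx
    simp only [sim, vars, Set.mem_iUnion, Fin.exists_fin_succ, vars_mul, Matrix.cons_val_zero,
      Matrix.cons_val_succ, Set.mem_union, vars_one] at hx
    have : x ∈ g.vars ∨ x ∈ ⋃ i, (sim ρ c g (e i)).vars := by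
      simp only [Set.mem_iUnion]; simp at hx; tauto
    rcases this with h | h
    · exact Or.inr h
    · exact key h

lemma sum_three_pow_sub_one_le {m : ℕ} (n : Fin m → ℕ) :
    ∑ i, (3 ^ n i - 1) ≤ 3 ^ (∑ i, n i) - 1 := by
  induction m with
  | zero => simp
  | succ m ih =>
    rw [Fin.sum_univ_succ, Fin.sum_univ_succ, pow_add]
    refine (Nat.add_le_add_left (ih _) _).trans ?_
    obtain ⟨a, ha⟩ : ∃ a, 3 ^ n 0 = a + 1 := Nat.exists_eq_add_of_le' (Nat.one_le_pow _ _ (by norm_num))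
    obtain ⟨b, hb⟩ : ∃ b, 3 ^ (∑ i : Fin m, n i.succ) = b + 1 :=
      Nat.exists_eq_add_of_le' (Nat.one_le_pow _ _ (by norm_num))
    rw [ha, hb]
    have : (a + 1) * (b + 1) - 1 = a * b + a + b := by
      rw [show (a + 1) * (b + 1) = a * b + a + b + 1 by ring]; rfl
    rw [this]
    simp only [Nat.add_sub_cancel]
    nlinarith

/-- A reciprocal contains its arguments twice, once in each sign part, so the size can double at
every level. The bound `3 ^ ops - 1` leaves room for this and is superadditive over the arguments.
-/
lemma ops_sim_le (e : TransFn V) :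
    (sim ρ c g e).ops ≤ (6 + 3 * g.ops) * (3 ^ e.ops - 1) := by
  have key {m : ℕ} (e : Fin m → TransFn V)
      (ih : ∀ i, (sim ρ c g (e i)).ops ≤ (6 + 3 * g.ops) * (3 ^ (e i).ops - 1)) :
      ∑ i, (sim ρ c g (e i)).ops ≤ (6 + 3 * g.ops) * (3 ^ (∑ i, (e i).ops) - 1) := by
    refine (Finset.sum_le_sum fun i _ => ih i).trans ?_
    rw [← Finset.mul_sum]
    exact Nat.mul_le_mul_left _ (sum_three_pow_sub_one_le _)
  have arith (x y z : ℕ) (hx : x ≤ (6 + 3 * g.ops) * (3 ^ y - 1)) (hz : z ≤ 6 + 3 * g.ops + 2 * x) :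
      z ≤ (6 + 3 * g.ops) * (3 ^ (1 + y) - 1) := by
    obtain ⟨a, ha⟩ : ∃ a, 3 ^ y = a + 1 := Nat.exists_eq_add_of_le' (Nat.one_le_pow _ _ (by norm_num))
    rw [pow_add, ha]
    rw [ha] at hx
    have : 3 ^ 1 * (a + 1) - 1 = 3 * a + 2 := by omega
    rw [this]
    simp only [Nat.add_sub_cancel] at hx
    nlinarith [Nat.zero_le (g.ops * a)]
  induction e with
  | var v => simp [sim]
  | relu w e ih =>
    refine arith _ _ _ (key e ih) ?_
    simp only [sim, ops]; omega
  | prod e ih =>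
    refine arith _ _ _ (key e ih) ?_
    simp only [sim, ops, ops_mul, ops_lin, ops_one]; omega
  | recip w e ih =>
    refine arith _ _ _ (key e ih) ?_
    simp only [sim, ops, Fin.sum_univ_four, Matrix.cons_val_zero, Matrix.cons_val_one,
      Matrix.cons_val, ops_mul, ops_one]; omega

end TransFn

/-! ### Rounding -/

/-- Multiples of `2 ^ (-F)`. -/
def OnGrid (F : ℕ) (x : ℝ) : Prop := ∃ z : ℤ, x = z / 2 ^ F

lemma onGrid_quantize (F : ℕ) (x : ℝ) : OnGrid F (quantize F x) := ⟨_, rfl⟩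

lemma quantize_of_onGrid {F : ℕ} {x : ℝ} (h : OnGrid F x) : quantize F x = x := by
  obtain ⟨z, rfl⟩ := h
  rw [quantize, div_mul_cancel₀ _ (by positivity), Int.floor_intCast]

lemma quantize_le (F : ℕ) (x : ℝ) : quantize F x ≤ x := by
  rw [quantize, div_le_iff₀ (by positivity)]; exact Int.floor_le _

lemma sub_lt_quantize (F : ℕ) (x : ℝ) : x - 1 / 2 ^ F < quantize F x := by
  rw [quantize, lt_div_iff₀ (by positivity), sub_mul, div_mul_cancel₀ _ (by positivity)]
  exact Int.sub_one_lt_floor _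

lemma quantize_mono (F : ℕ) {x y : ℝ} (h : x ≤ y) : quantize F x ≤ quantize F y := by
  unfold quantize; gcongr

lemma quantize_zero (F : ℕ) : quantize F 0 = 0 := by simp [quantize]

lemma quantize_nonneg (F : ℕ) {x : ℝ} (h : 0 ≤ x) : 0 ≤ quantize F x :=
  quantize_zero F ▸ quantize_mono F h

/-- This makes exact simulation of a network with `G` fractional bits possible in a network with `G
+ s` of them: store all values divided by `2 ^ s`. -/
lemma quantize_div_two_pow (G s : ℕ) (x : ℝ) :
    quantize (G + s) (x / 2 ^ s) = quantize G x / 2 ^ s := by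
  rw [quantize, quantize, pow_add, div_div]
  congr 3
  field_simp

lemma OnGrid.add {F : ℕ} {x y : ℝ} (hx : OnGrid F x) (hy : OnGrid F y) : OnGrid F (x + y) := by
  obtain ⟨a, rfl⟩ := hx; obtain ⟨b, rfl⟩ := hy
  exact ⟨a + b, by push_cast; ring⟩

lemma OnGrid.sub {F : ℕ} {x y : ℝ} (hx : OnGrid F x) (hy : OnGrid F y) : OnGrid F (x - y) := by
  obtain ⟨a, rfl⟩ := hx; obtain ⟨b, rfl⟩ := hy
  exact ⟨a - b, by push_cast; ring⟩

lemma onGrid_natCast (F n : ℕ) : OnGrid F n := ⟨n * 2 ^ F, by push_cast; field_simp⟩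

lemma onGrid_zero (F : ℕ) : OnGrid F 0 := ⟨0, by simp⟩

lemma onGrid_one (F : ℕ) : OnGrid F 1 := by simpa using onGrid_natCast F 1

lemma onGrid_natCast_div (F n : ℕ) : OnGrid F ((n : ℝ) / 2 ^ F) := ⟨n, by simp⟩

lemma OnGrid.div_two_pow {G : ℕ} {x : ℝ} (h : OnGrid G x) (s : ℕ) :
    OnGrid (G + s) (x / 2 ^ s) := by
  obtain ⟨z, rfl⟩ := h
  exact ⟨z, by rw [pow_add, div_div]⟩

lemma OnGrid.max_zero {F : ℕ} {x : ℝ} (h : OnGrid F x) : OnGrid F (max 0 x) := by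
  rcases le_total 0 x with h' | h'
  · rwa [max_eq_right h']
  · rw [max_eq_left h']; exact onGrid_zero F

/-- Multiples of `2 ^ (-F)` do not lie in `(-2 ^ (-F), 0)`. -/
lemma OnGrid.nonneg_or_le {F : ℕ} {x : ℝ} (h : OnGrid F x) : 0 ≤ x ∨ x ≤ -(1 / 2 ^ F) := by
  obtain ⟨z, rfl⟩ := h
  rcases le_or_gt 0 z with hz | hz
  · left; positivity
  · right
    rw [← neg_div]
    gcongr
    exact_mod_cast (by omega : z ≤ -1)

lemma OnGrid.le_of_pos {F : ℕ} {x : ℝ} (h : OnGrid F x) (hx : 0 < x) : 1 / 2 ^ F ≤ x := by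
  obtain ⟨z, rfl⟩ := h
  have hz : 0 < z := by
    by_contra hz
    have : (z : ℝ) ≤ 0 := by exact_mod_cast not_lt.1 hz
    exact absurd hx (not_lt.2 (div_nonpos_of_nonpos_of_nonneg this (by positivity)))
  gcongr
  exact_mod_cast hz

lemma FixedPoint.onGrid {I : ℝ} {F : ℕ} {x : ℝ} (h : FixedPoint I F x) : OnGrid F x := h.2

lemma fixedPoint_of_abs_le {I : ℝ} {F : ℕ} {x : ℝ} (h : |x| ≤ (2 : ℝ) ^ I) (hx : OnGrid F x) :
    FixedPoint I F x := ⟨(Int.floor_le _).trans h, hx⟩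

/-! ### Gated cells -/

namespace TransFn

variable {V V' : Type}

lemma eval_congr {S S' : V → ℝ} (e : TransFn V) (h : ∀ u ∈ e.vars, S u = S' u) :
    e.eval S = e.eval S' := by
  induction e with
  | var v => exact h v rfl
  | relu w e ih =>
    simp only [eval, fun i => ih i fun u hu => h u (Set.mem_iUnion.2 ⟨i, hu⟩)]
  | prod e ih =>
    simp only [eval, fun i => ih i fun u hu => h u (Set.mem_iUnion.2 ⟨i, hu⟩)]
  | recip w e ih =>
    simp only [eval, fun i => ih i fun u hu => h u (Set.mem_iUnion.2 ⟨i, hu⟩)]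

lemma defined_congr {S S' : V → ℝ} (e : TransFn V) (h : ∀ u ∈ e.vars, S u = S' u)
    (hd : e.Defined S) : e.Defined S' := by
  induction e with
  | var v => trivial
  | relu w e ih => exact fun i => ih i (fun u hu => h u (Set.mem_iUnion.2 ⟨_, hu⟩)) (hd i)
  | prod e ih => exact fun i => ih i (fun u hu => h u (Set.mem_iUnion.2 ⟨_, hu⟩)) (hd i)
  | recip w e ih =>
    refine ⟨fun i => ih i (fun u hu => h u (Set.mem_iUnion.2 ⟨_, hu⟩)) (hd.1 i), ?_⟩
    have h' (i) : (e i).eval S = (e i).eval S' :=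
      eval_congr (e i) fun u hu => h u (Set.mem_iUnion.2 ⟨i, hu⟩)
    simpa only [h'] using hd.2

/-- A node that is reset to `rw * rt` when `reset` is on, set to `u` times a simulated transition
function when `run` is on, and keeps its value when both are off. -/
noncomputable def cell (ε : ℝ) (ρ : V → V') (c : V → ℝ) (u : ℝ) (f : TransFn V)
    (run reset : TransFn V') (rw : ℝ) (rt : TransFn V') (self : V') : TransFn V' :=
  signedLin ε ![u * scaleOf c f, rw, 1, -1, -1]
    ![mul run (sim ρ c run f), mul reset rt, var self, mul run (var self), mul reset (var self)]

section cell

variable {ε u rw : ℝ} {ρ : V → V'} {c : V → ℝ} {f : TransFn V} {run reset rt : TransFn V'}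
  {self : V'} {S : V' → ℝ} {p p' : Prop} [Decidable p] [Decidable p']

/-- The combination is `self + run * (new - self) + reset * (rt' - self)` with `rt' = rw * rt`, and
the two gates are never on together. -/
lemma cell_sum (hc : ∀ v, 0 < c v) (hrun : run.eval S = if p then 1 else 0)
    (hreset : reset.eval S = if p' then 1 else 0) (hpp : ¬ (p ∧ p')) :
    ∑ i, (![u * scaleOf c f, rw, 1, -1, -1] : Fin 5 → ℝ) i *
      ((![mul run (sim ρ c run f), mul reset rt, var self, mul run (var self),
        mul reset (var self)] : Fin 5 → TransFn V') i).eval S =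
      if p' then rw * rt.eval S else
        if p then u * f.eval (fun v => c v * S (ρ v)) else S self := by
  simp only [Fin.sum_univ_five, Matrix.cons_val_zero, Matrix.cons_val_one, Matrix.cons_val,
    eval_mul, eval_var, hrun, hreset]
  by_cases hp : p
  · have hp' : ¬ p' := fun h => hpp ⟨hp, h⟩
    rw [← eval_sim (g := run) hc (by simp [hrun, hp]) f]
    simp only [hp, hp', if_true, if_false]; ring
  · by_cases hp' : p' <;> simp only [hp, hp', if_true, if_false] <;> ring

lemma eval_cell (hε : 0 < ε) (hc : ∀ v, 0 < c v) (hrun : run.eval S = if p then 1 else 0)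
    (hreset : reset.eval S = if p' then 1 else 0) (hpp : ¬ (p ∧ p')) {L : ℝ}
    (hL : L = if p' then rw * rt.eval S else
        if p then u * f.eval (fun v => c v * S (ρ v)) else S self)
    (hgap : 0 ≤ L ∨ L ≤ -ε) :
    (cell ε ρ c u f run reset rw rt self).eval S = L :=
  eval_signedLin hε ((cell_sum hc hrun hreset hpp).trans hL.symm) hgap

lemma defined_cell (hε : 0 < ε) (hc : ∀ v, 0 < c v) (hrun : run.eval S = if p then 1 else 0)
    (hreset : reset.eval S = if p' then 1 else 0) (hpp : ¬ (p ∧ p')) {L : ℝ}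
    (hL : L = if p' then rw * rt.eval S else
        if p then u * f.eval (fun v => c v * S (ρ v)) else S self)
    (hgap : 0 ≤ L ∨ L ≤ -ε) (hdrun : run.Defined S) (hdreset : reset.Defined S)
    (hdrt : rt.Defined S) (hdf : p → f.Defined (fun v => c v * S (ρ v))) :
    (cell ε ρ c u f run reset rw rt self).Defined S := by
  refine defined_signedLin hε ((cell_sum hc hrun hreset hpp).trans hL.symm) hgap ?_
  have : (sim ρ c run f).Defined S := by
    by_cases hp : p
    · exact defined_sim hc (by simp [hrun, hp]) hdrun f (hdf hp)
    · exact defined_sim_of_off (by simp [hrun, hp]) hdrun f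
  simp [Fin.forall_fin_succ, hdrun, hdreset, hdrt, this]

lemma vars_cell_subset : (cell ε ρ c u f run reset rw rt self).vars ⊆
    ρ '' f.vars ∪ (run.vars ∪ reset.vars ∪ rt.vars ∪ {self}) := by
  intro x hx
  simp only [cell, vars_signedLin, Set.mem_iUnion, Fin.exists_fin_succ, Matrix.cons_val_zero,
    Matrix.cons_val_succ, vars_mul, vars_var, Set.mem_union, Set.mem_singleton_iff,
    IsEmpty.exists_iff, or_false] at hx
  have h1 : x ∈ (sim ρ c run f).vars → x ∈ ρ '' f.vars ∪ run.vars := fun h => vars_sim_subset f h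
  simp only [Set.mem_union, Set.mem_singleton_iff] at h1 ⊢
  tauto

lemma ops_cell_le {M m : ℕ} (hf : f.ops ≤ m) (hrun : run.ops ≤ M) (hreset : reset.ops ≤ M)
    (hrt : rt.ops ≤ M) :
    (cell ε ρ c u f run reset rw rt self).ops ≤ 26 + 20 * M + 4 * ((6 + 3 * M) * 3 ^ m) := by
  have h1 : (sim ρ c run f).ops ≤ (6 + 3 * M) * 3 ^ m :=
    (ops_sim_le f).trans (Nat.mul_le_mul (by omega)
      ((Nat.sub_le _ _).trans (Nat.pow_le_pow_right (by norm_num) hf)))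
  simp only [cell, ops_signedLin, Fin.sum_univ_five, Matrix.cons_val_zero, Matrix.cons_val_one,
    Matrix.cons_val, ops_mul, ops_var]
  omega

end cell

end TransFn

/-! ### Simulating a network -/

namespace RNN

open TransFn

variable (R : RNN) {V' : Type}

lemma step_inp (F : ℕ) (S : R.V → ℝ) : R.step F S R.inp = S R.inp := if_pos rfl

lemma step_of_ne (F : ℕ) (S : R.V → ℝ) {v : R.V} (h : v ≠ R.inp) :
    R.step F S v = quantize F ((R.f v).eval S) := if_neg h

/-- The node of the simulating network that stores the value of `v`. -/
def loc (tok : V') (cp : R.V → V') (v : R.V) : V' := if v = R.inp then tok else cp v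

/-- The input node is stored unscaled, all other nodes are scaled by `2 ^ (-s)`. -/
def scale (s : ℕ) (v : R.V) : ℝ := if v = R.inp then 1 else 2 ^ s

lemma scale_pos (s : ℕ) (v : R.V) : 0 < R.scale s v := by
  unfold scale; split_ifs <;> positivity

/-- The transition function of a node that simulates the node `v`. On a reset it is set to the value
of the storage node if `v` is hidden, and to the initial value otherwise. -/
noncomputable def copyCell (s : ℕ) (ε : ℝ) (tok : V') (cp : R.V → V') (st : R.hid → V')
    (run reset : TransFn V') (v : R.V) : TransFn V' :=
  if v = R.inp then .zero else
    cell ε (R.loc tok cp) (R.scale s) (2 ^ s)⁻¹ (R.f v) run reset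
      (if v ∈ R.hid then 1 else R.init v / 2 ^ s)
      (if h : v ∈ R.hid then .var (st ⟨v, h⟩) else .one) (cp v)

/-- The next values of the copied nodes (the copy of the input node is unused). -/
noncomputable def copyNext (G : ℕ) (H C : R.V → ℝ) (x : ℝ) (run reset : Prop) [Decidable run]
    [Decidable reset] (v : R.V) : ℝ :=
  if v = R.inp then 0 else
    if reset then (if v ∈ R.hid then H v else R.init v) else
      if run then R.step G (R.feed x C) v else C v

/-- No denominator vanishes, and no value lies in `(-ε, 0)`. -/
def StepOk (ε : ℝ) (S : R.V → ℝ) (v : R.V) : Prop :=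
  (R.f v).Defined S ∧ (0 ≤ (R.f v).eval S ∨ (R.f v).eval S ≤ -ε)

/-- The storage cell of a hidden node. -/
noncomputable def hidCell (s : ℕ) (ε : ℝ) (tok : V') (st : R.hid → V') (run : TransFn V')
    (v : R.hid) : TransFn V' :=
  cell ε (fun u => if h : u ∈ R.hid then st ⟨u, h⟩ else tok) (R.scale s) (2 ^ s)⁻¹ (R.f v) run
    .zero 0 .one (st v)

/-- The next values of the storage cells. -/
noncomputable def hidNext (G : ℕ) (H : R.V → ℝ) (x : ℝ) (run : Prop) [Decidable run] (v : R.V) : ℝ :=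
  if run then R.step G (R.feed x H) v else H v

section simulation

variable {R} {G s : ℕ} {ε x : ℝ} {tok : V'} {cp : R.V → V'} {st : R.hid → V'}
  {run reset : TransFn V'} {S : V' → ℝ} {H C : R.V → ℝ} {p p' : Prop} [Decidable p] [Decidable p']

lemma loc_eq_feed (htok : S tok = x) (hcp : ∀ v, S (cp v) = C v / 2 ^ s) :
    (fun v => R.scale s v * S (R.loc tok cp v)) = R.feed x C := by
  ext v
  unfold scale loc feed Function.update
  by_cases h : v = R.inp
  · subst h; simp [htok]
  · simp only [h, if_false, hcp, dite_false]; field_simp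

/-- The value of a copied node before rounding. -/
lemma copyCell_spec (hε : 0 < ε) (hεF : ε ≤ 1 / 2 ^ (G + s))
    (htok : S tok = x) (hcp : ∀ v, S (cp v) = C v / 2 ^ s)
    (hst : ∀ h : R.hid, S (st h) = H h / 2 ^ s)
    (hrun : run.eval S = if p then 1 else 0) (hreset : reset.eval S = if p' then 1 else 0)
    (hdrun : run.Defined S) (hdreset : reset.Defined S) (hpp : ¬ (p ∧ p'))
    (hC : ∀ v, OnGrid G (C v)) (hH : ∀ v ∈ R.hid, OnGrid G (H v))
    (hinit : ∀ v, v ≠ R.inp → OnGrid G (R.init v))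
    (hok : p → ∀ v, v ≠ R.inp → R.StepOk (ε * 2 ^ s) (R.feed x C) v) (v : R.V) :
    quantize (G + s) ((R.copyCell s ε tok cp st run reset v).eval S) =
      R.copyNext G H C x p p' v / 2 ^ s ∧
    (R.copyCell s ε tok cp st run reset v).Defined S := by
  unfold copyCell copyNext
  by_cases hv : v = R.inp
  · simp [hv, quantize_zero]
  simp only [hv, if_false]
  have hs : (0 : ℝ) < 2 ^ s := by positivity
  -- Held and reset values avoid the gap because they are grid points. Only a freshly computed
  -- value, before its rounding, needs `hok`.
  have gap {y : ℝ} (hy : OnGrid G y) : 0 ≤ y / 2 ^ s ∨ y / 2 ^ s ≤ -ε := by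
    rcases (hy.div_two_pow s).nonneg_or_le with h | h
    · exact Or.inl h
    · exact Or.inr (by linarith)
  set L : ℝ := if p' then (if v ∈ R.hid then H v else R.init v) / 2 ^ s else
    if p then (2 ^ s)⁻¹ * (R.f v).eval (R.feed x C) else C v / 2 ^ s with hLdef
  have hL : L = if p' then (if v ∈ R.hid then 1 else R.init v / 2 ^ s) *
      (if h : v ∈ R.hid then TransFn.var (st ⟨v, h⟩) else .one).eval S else
        if p then (2 ^ s)⁻¹ * (R.f v).eval (fun v => R.scale s v * S (R.loc tok cp v))
        else S (cp v) := by
    rw [loc_eq_feed htok hcp, hcp, hLdef]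
    by_cases h : v ∈ R.hid <;> simp [h, hst]
  have hgap : 0 ≤ L ∨ L ≤ -ε := by
    by_cases h' : p'
    · simp only [hLdef, h', if_true]
      by_cases h : v ∈ R.hid
      · simpa [h] using gap (hH v h)
      · simpa [h] using gap (hinit v hv)
    · by_cases hp : p
      · simp only [hLdef, h', hp, if_true, if_false]
        rcases (hok hp v hv).2 with h | h
        · exact Or.inl (by positivity)
        · refine Or.inr ?_
          rw [inv_mul_le_iff₀ hs]; linarith
      · simpa only [hLdef, h', hp, if_false] using gap (hC v)
  constructor
  · rw [eval_cell hε (R.scale_pos s) hrun hreset hpp hL hgap, hLdef]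
    by_cases h' : p'
    · simp only [h', if_true]
      refine quantize_of_onGrid (OnGrid.div_two_pow ?_ s)
      by_cases h : v ∈ R.hid
      · simpa [h] using hH v h
      · simpa [h] using hinit v hv
    · by_cases hp : p
      · simp only [h', hp, if_true, if_false]
        rw [← div_eq_inv_mul, quantize_div_two_pow, step_of_ne _ _ _ hv]
      · simpa only [h', hp, if_false] using quantize_of_onGrid ((hC v).div_two_pow s)
  · refine defined_cell hε (R.scale_pos s) hrun hreset hpp hL hgap hdrun hdreset ?_ ?_
    · split_ifs <;> simp
    · rw [loc_eq_feed htok hcp]; exact fun hp => (hok hp v hv).1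

/-- The value of a storage cell before rounding. -/
lemma hidCell_spec (hε : 0 < ε) (hεF : ε ≤ 1 / 2 ^ (G + s))
    (htok : S tok = x) (hst : ∀ h : R.hid, S (st h) = H h / 2 ^ s)
    (hrun : run.eval S = if p then 1 else 0) (hdrun : run.Defined S)
    (hH : ∀ v ∈ R.hid, OnGrid G (H v))
    (hok : p → ∀ v ∈ R.hid, R.StepOk (ε * 2 ^ s) (R.feed x H) v) (v : R.hid) :
    quantize (G + s) ((R.hidCell s ε tok st run v).eval S) = R.hidNext G H x p v / 2 ^ s ∧
    (R.hidCell s ε tok st run v).Defined S := by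
  unfold hidCell hidNext
  have hs : (0 : ℝ) < 2 ^ s := by positivity
  have hv : (v : R.V) ≠ R.inp := fun h => R.inp_notMem_hid (h ▸ v.2)
  -- A hidden node reads only hidden nodes and the input, so the storage cells alone can be
  -- advanced, without a copy of the rest of the network.
  have hvars : ∀ u ∈ (R.f v).vars, (fun u => R.scale s u *
      S (if h : u ∈ R.hid then st ⟨u, h⟩ else tok)) u = R.feed x H u := by
    intro u hu
    unfold scale feed Function.update
    rcases R.hid_closed v v.2 u hu with rfl | h
    · simp [R.inp_notMem_hid, htok]
    · have hu' : u ≠ R.inp := fun h' => R.inp_notMem_hid (h' ▸ h)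
      simp only [hu', h, if_false, hst, dite_true, dite_false]; field_simp
  set L : ℝ := if p then (2 ^ s)⁻¹ * (R.f v).eval (R.feed x H) else H v / 2 ^ s with hLdef
  have hL : L = if False then 0 * TransFn.one.eval S else if p then (2 ^ s)⁻¹ *
      (R.f v).eval (fun u => R.scale s u * S (if h : u ∈ R.hid then st ⟨u, h⟩ else tok))
        else S (st v) := by
    rw [eval_congr _ hvars, hst, hLdef, if_neg not_false]
  have hgap : 0 ≤ L ∨ L ≤ -ε := by
    by_cases hp : p
    · simp only [hLdef, hp, if_true]
      rcases (hok hp v v.2).2 with h | h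
      · exact Or.inl (by positivity)
      · refine Or.inr ?_
        rw [inv_mul_le_iff₀ hs]; linarith
    · simp only [hLdef, hp, if_false]
      rcases ((hH v v.2).div_two_pow s).nonneg_or_le with h | h
      · exact Or.inl h
      · exact Or.inr (by linarith)
  have hz : (TransFn.zero : TransFn V').eval S = if False then 1 else 0 := by simp
  constructor
  · rw [eval_cell hε (R.scale_pos s) hrun hz (by simp) hL hgap, hLdef]
    by_cases hp : p
    · simp only [hp, if_true]
      rw [← div_eq_inv_mul, quantize_div_two_pow, step_of_ne _ _ _ hv]
    · simpa only [hp, if_false] using quantize_of_onGrid ((hH v v.2).div_two_pow s)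
  · refine defined_cell hε (R.scale_pos s) hrun hz (by simp) hL hgap hdrun (by simp) (by simp) ?_
    exact fun hp => defined_congr _ (fun u hu => (hvars u hu).symm) (hok hp v v.2).1

end simulation

end RNN

/-! ### The boosted network -/

namespace TransFn

variable {V : Type}

/-- The sum of two natural numbers. -/
def addG (e f : TransFn V) : TransFn V := lin 1 e 1 f

/-- The truncated difference of two natural numbers. -/
def subG (e f : TransFn V) : TransFn V := lin 1 e (-1) f

/-- Division by `u`. -/
noncomputable def divG (u : ℝ) (e : TransFn V) : TransFn V := lin (1 / u) e 0 one

lemma eval_addG {S : V → ℝ} {e f : TransFn V} {m n : ℕ} (he : e.eval S = m) (hf : f.eval S = n) :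
    (addG e f).eval S = (m + n : ℕ) := by
  simp only [addG, eval_lin, he, hf]; push_cast
  rw [max_eq_right (by positivity)]; ring

lemma cast_tsub (m n : ℕ) : ((m - n : ℕ) : ℝ) = max 0 ((m : ℝ) - n) := by
  rcases le_total n m with h | h
  · rw [max_eq_right (by simpa using h), Nat.cast_sub h]
  · rw [max_eq_left (by simpa using h), Nat.sub_eq_zero_of_le h, Nat.cast_zero]

lemma eval_subG {S : V → ℝ} {e f : TransFn V} {m n : ℕ} (he : e.eval S = m) (hf : f.eval S = n) :
    (subG e f).eval S = (m - n : ℕ) := by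
  simp only [subG, eval_lin, he, hf, cast_tsub]; congr 1; ring

lemma eval_divG {S : V → ℝ} {e : TransFn V} {n : ℕ} {u : ℝ} (hu : 0 ≤ u) (he : e.eval S = n) :
    (divG u e).eval S = n / u := by
  simp only [divG, eval_lin, he, eval_one]
  rw [max_eq_right (by positivity)]; ring

lemma eval_selN {S : V → ℝ} {g e f : TransFn V} {p : Prop} [Decidable p] {m n : ℕ}
    (hg : g.eval S = if p then 1 else 0) (he : e.eval S = m) (hf : f.eval S = n) :
    (sel g e f).eval S = ((if p then m else n : ℕ) : ℝ) := by
  rw [eval_sel hg he hf (Nat.cast_nonneg _) (Nat.cast_nonneg _)]; split_ifs <;> rfl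

end TransFn

open TransFn

/-- The hidden registers: the clock (`a` steps, `i` tokens, `W` windows), the unread part `U` of the
window and its quotient `V`, the current token, the first token of the window, the number `J` of
tokens left in the block, the number `R` of tokens left in the text, and the boosting flag `g`. -/
inductive HReg
  | a | i | W | U | V | tok | fd | J | R | g
  deriving DecidableEq

instance : Fintype HReg :=
  ⟨{.a, .i, .W, .U, .V, .tok, .fd, .J, .R, .g}, fun x => by cases x <;> decide⟩

/-- The other registers: the input node, the weight of the current window, the accumulated weights
(all windows, windows starting with at most the input token, with less), their quotients,
and the output. -/
inductive VReg
  | inp | P | Sa | Sle | Slt | hi | lo | out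
  deriving DecidableEq

instance : Fintype VReg :=
  ⟨{.inp, .P, .Sa, .Sle, .Slt, .hi, .lo, .out}, fun x => by cases x <;> decide⟩

/-- The parameters of the boosted network. -/
structure Boost where
  Q : RNN
  D : RNN
  N : ℕ
  k : ℕ
  G : ℕ
  s : ℕ
  κ : ℝ
  ε : ℝ
  J0 : ℕ
  R0 : ℕ
  g0 : ℕ
  dec : ℕ

namespace Boost

variable (B : Boost)

abbrev F : ℕ := B.G + B.s
abbrev T : ℕ := max B.Q.time B.D.time
-- The steps for one token of a window: two to decode it, `T` to run both networks, one to update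
-- the weight, one to move on.
abbrev tau : ℕ := B.T + 4
-- The `Fin` summands here and in `VNode` are idle nodes of value `0`; they bring the node counts to
-- the prescribed numbers.
abbrev HNode : Type := HReg ⊕ Fin (6 * B.k + 7) ⊕ B.Q.hid ⊕ B.D.hid
abbrev VNode : Type := VReg ⊕ Fin B.k ⊕ B.Q.V ⊕ B.D.V
abbrev Node : Type := B.HNode ⊕ B.VNode
abbrev hr (x : HReg) : B.Node := .inl (.inl x)
abbrev vr (x : VReg) : B.Node := .inr (.inl x)
abbrev stQ (v : B.Q.hid) : B.Node := .inl (.inr (.inr (.inl v)))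
abbrev stD (v : B.D.hid) : B.Node := .inl (.inr (.inr (.inr v)))
abbrev cpQ (v : B.Q.V) : B.Node := .inr (.inr (.inr (.inl v)))
abbrev cpD (v : B.D.V) : B.Node := .inr (.inr (.inr (.inr v)))

/-- The number stored by a register in units of `2 ^ (-F)`. -/
noncomputable abbrev cnt (x : HReg) : TransFn B.Node := TransFn.dec (2 ^ B.F) (B.hr x)
abbrev raw (x : HReg) : TransFn B.Node := .var (B.hr x)
abbrev vis (x : VReg) : TransFn B.Node := .var (B.vr x)
noncomputable abbrev isA (n : ℕ) : TransFn B.Node := eqG (B.cnt .a) (nat n)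
noncomputable abbrev isI (n : ℕ) : TransFn B.Node := eqG (B.cnt .i) (nat n)
noncomputable abbrev isW (n : ℕ) : TransFn B.Node := eqG (B.cnt .W) (nat n)
noncomputable abbrev isJ1 : TransFn B.Node := eqG (B.cnt .J) (nat 1)
noncomputable abbrev endW : TransFn B.Node := mul (B.isA (B.tau - 1)) (B.isI (B.k - 1))
noncomputable abbrev endT : TransFn B.Node := mul B.endW (B.isW (B.N ^ B.k))
noncomputable abbrev startW : TransFn B.Node := mul (B.isI 0) (B.isA 0)
noncomputable abbrev startT : TransFn B.Node := mul (B.isW 0) B.startW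
noncomputable abbrev runG (t : ℕ) : TransFn B.Node :=
  mul (leG (nat 2) (B.cnt .a)) (leG (B.cnt .a) (nat (t + 1)))
-- Storage runs in the first token slot of the extra pass `W = N ^ k` only, and reads the input node
-- instead of a window digit.
noncomputable abbrev runHG (t : ℕ) : TransFn B.Node :=
  mul (mul (B.isW (B.N ^ B.k)) (B.isI 0)) (B.runG t)

/-- The integer quotient of `U` by `N` costs nothing: `U` is stored in units of `2 ^ (-F)`, so the
rounding of the node `V` takes the floor. Then `U - N * V` is the lowest digit, and replacing `U` by
`V` moves to the next one. -/
noncomputable def hregFn : HReg → TransFn B.Node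
  | .a => divG (2 ^ B.F) (sel (B.isA (B.tau - 1)) (nat 0) (addG (B.cnt .a) (nat 1)))
  | .i => divG (2 ^ B.F) (sel (B.isA (B.tau - 1))
      (sel (B.isI (B.k - 1)) (nat 0) (addG (B.cnt .i) (nat 1))) (B.cnt .i))
  | .W => divG (2 ^ B.F) (sel B.endW
      (sel (B.isW (B.N ^ B.k)) (nat 0) (addG (B.cnt .W) (nat 1))) (B.cnt .W))
  | .U => divG (2 ^ B.F) (sel (B.isA (B.tau - 1))
      (sel (B.isI (B.k - 1)) (sel (B.isW (B.N ^ B.k)) (nat 0) (addG (B.cnt .W) (nat 1))) (B.cnt .V))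
      (B.cnt .U))
  | .V => divG (2 ^ B.F) (divG B.N (B.cnt .U))
  | .tok => lin 1 (B.cnt .U) (-B.N) (B.cnt .V)
  | .fd => sel (B.isI 0) (B.raw .tok) (B.raw .fd)
  | .J => divG (2 ^ B.F)
      (sel B.endT (sel B.isJ1 (nat B.k) (subG (B.cnt .J) (nat 1))) (B.cnt .J))
  | .R => divG (2 ^ B.F) (sel B.endT (subG (B.cnt .R) (nat B.dec)) (B.cnt .R))
  | .g => sel B.endT (sel B.isJ1 (nat 1) (B.raw .g)) (B.raw .g)

noncomputable def outQ : TransFn B.Node :=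
  lin (B.Q.scale 0 B.Q.out) (.var (B.Q.loc (B.hr .tok) B.cpQ B.Q.out)) 0 one

/-- The output of the distinguisher, clipped to `[0, 1]`. -/
noncomputable def outD : TransFn B.Node :=
  lin 1 (lin (B.D.scale B.s B.D.out) (.var (B.D.loc (B.hr .tok) B.cpD B.D.out)) 0 one)
    (-1) (lin (B.D.scale B.s B.D.out) (.var (B.D.loc (B.hr .tok) B.cpD B.D.out)) (-1) one)

/-- The test whether the verdict is due. -/
noncomputable def dueG : TransFn B.Node :=
  mul (eqG (B.raw .g) (nat 1))
    -- With truncated subtraction `J - (J - R)` is `min J R`: the verdict is due at the end of the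
    -- block or of the text, whichever comes first.
    (eqG (addG (B.cnt .i) (nat 1)) (subG (B.cnt .J) (subG (B.cnt .J) (B.cnt .R))))

/-- The second summand of the denominator is `1` at `Sa = 0` and vanishes at positive multiples of
`2 ^ (-F)`, so the division is always defined and is correct once `Sa` is positive. -/
noncomputable def quot (x : VReg) : TransFn B.Node :=
  mul (B.vis x) (recipAdd (B.vis .Sa) (lin 1 one (-2 ^ B.F) (B.vis .Sa)))

/-- The sums grow at the last step of each window, but not in the extra pass. There they are
constant, so the quotients and then the output settle within two steps. -/
noncomputable def vregFn : VReg → TransFn B.Node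
  | .inp => zero
  | .P => sel B.startW one (sel (B.isA (B.T + 2))
      (mul (B.vis .P) (mul B.outQ (lin 1 one (-B.κ) (mul B.dueG B.outD)))) (B.vis .P))
  | .Sa => sel B.startT zero (lin 1 (B.vis .Sa) 1 (mul (mul B.endW (notG (B.isW (B.N ^ B.k))))
      (B.vis .P)))
  | .Sle => sel B.startT zero (lin 1 (B.vis .Sle) 1
      (mul (mul (mul B.endW (notG (B.isW (B.N ^ B.k)))) (leG (B.raw .fd) (B.vis .inp))) (B.vis .P)))
  | .Slt => sel B.startT zero (lin 1 (B.vis .Slt) 1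
      (mul (mul (mul B.endW (notG (B.isW (B.N ^ B.k))))
        (leG (addG (B.raw .fd) (nat 1)) (B.vis .inp))) (B.vis .P)))
  | .hi => B.quot .Sle
  | .lo => B.quot .Slt
  | .out => lin 1 (B.vis .hi) (-1) (B.vis .lo)

noncomputable def fn : B.Node → TransFn B.Node
  | .inl (.inl x) => B.hregFn x
  | .inl (.inr (.inl _)) => zero
  | .inl (.inr (.inr (.inl v))) =>
      B.Q.hidCell 0 B.ε (B.vr .inp) B.stQ (B.runHG B.Q.time) v
  | .inl (.inr (.inr (.inr v))) =>
      B.D.hidCell B.s B.ε (B.vr .inp) B.stD (B.runHG B.D.time) v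
  | .inr (.inl x) => B.vregFn x
  | .inr (.inr (.inl _)) => zero
  | .inr (.inr (.inr (.inl v))) =>
      B.Q.copyCell 0 B.ε (B.hr .tok) B.cpQ B.stQ (B.runG B.Q.time) B.startW v
  | .inr (.inr (.inr (.inr v))) =>
      B.D.copyCell B.s B.ε (B.hr .tok) B.cpD B.stD (B.runG B.D.time) B.startW v

/-- The contents of the registers and of the simulated networks. -/
structure Regs where
  a : ℕ
  i : ℕ
  W : ℕ
  U : ℕ
  V : ℕ
  tok : ℕ
  fd : ℕ
  J : ℕ
  R : ℕ
  g : ℕ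
  P : ℝ
  Sa : ℝ
  Sle : ℝ
  Slt : ℝ
  hi : ℝ
  lo : ℝ
  out : ℝ
  HQ : B.Q.V → ℝ
  CQ : B.Q.V → ℝ
  HD : B.D.V → ℝ
  CD : B.D.V → ℝ

variable {B}

namespace Regs

noncomputable def hval (r : B.Regs) : HReg → ℝ
  | .a => r.a / 2 ^ B.F
  | .i => r.i / 2 ^ B.F
  | .W => r.W / 2 ^ B.F
  | .U => r.U / 2 ^ B.F
  | .V => r.V / 2 ^ B.F
  | .tok => r.tok
  | .fd => r.fd
  | .J => r.J / 2 ^ B.F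
  | .R => r.R / 2 ^ B.F
  | .g => r.g

def vval (r : B.Regs) (x : ℝ) : VReg → ℝ
  | .inp => x
  | .P => r.P
  | .Sa => r.Sa
  | .Sle => r.Sle
  | .Slt => r.Slt
  | .hi => r.hi
  | .lo => r.lo
  | .out => r.out

/-- The node values that store given register contents, with `x` on the input node. -/
noncomputable def state (r : B.Regs) (x : ℝ) : B.Node → ℝ
  | .inl (.inl h) => r.hval h
  | .inl (.inr (.inl _)) => 0
  | .inl (.inr (.inr (.inl v))) => r.HQ v
  | .inl (.inr (.inr (.inr v))) => r.HD v / 2 ^ B.s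
  | .inr (.inl h) => r.vval x h
  | .inr (.inr (.inl _)) => 0
  | .inr (.inr (.inr (.inl v))) => r.CQ v
  | .inr (.inr (.inr (.inr v))) => r.CD v / 2 ^ B.s

end Regs

/-- The initial register contents. -/
noncomputable def regs0 (B : Boost) : B.Regs where
  a := 0
  i := 0
  W := 0
  U := 0
  V := 0
  tok := 0
  fd := 0
  J := B.J0
  R := B.R0
  g := B.g0
  P := 0
  Sa := 0
  Sle := 0
  Slt := 0
  hi := 0
  lo := 0
  out := 0
  HQ := B.Q.init
  CQ := fun v => if v = B.Q.inp then 0 else B.Q.init v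
  HD := B.D.init
  CD := fun v => if v = B.D.inp then 0 else B.D.init v

lemma vars_hregFn (x : HReg) : (B.hregFn x).vars ⊆ Set.range Sum.inl := by
  cases x <;> simp [hregFn, Set.insert_subset_iff, divG, sel, eqG, nat, notG, addG, subG,
    TransFn.dec]

lemma vars_runHG (t : ℕ) : (B.runHG t).vars ⊆ Set.range Sum.inl := by
  simp [Set.insert_subset_iff, eqG, nat, leG, TransFn.dec]

/-- The boosted network. -/
noncomputable def net (B : Boost) (hN : 0 < B.N) (hk : 0 < B.k) : RNN where
  V := B.Node
  decEqV := @instDecidableEqSum _ _ (inferInstanceAs (DecidableEq B.HNode))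
    (inferInstanceAs (DecidableEq B.VNode))
  inp := B.vr .inp
  out := B.vr .out
  f := B.fn
  init := B.regs0.state 0
  time := (B.N ^ B.k + 1) * B.k * B.tau
  time_pos := by positivity
  hid := Finset.univ.map Function.Embedding.inl
  inp_notMem_hid := by simp
  hid_closed := by
    intro h hh u hu
    obtain ⟨h, -, rfl⟩ := Finset.mem_map.1 hh
    suffices u = B.vr .inp ∨ u ∈ Set.range Sum.inl by
      rcases this with h | ⟨x, rfl⟩
      · exact Or.inl h
      · right; simp
    rcases h with x | x | v | v
    · exact Or.inr (vars_hregFn x hu)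
    · simp [fn] at hu
    · rcases vars_cell_subset hu with ⟨w, hw, rfl⟩ | hu
      · simp only; split_ifs <;> simp
      · simp only [vars_zero, vars_one, Set.union_empty] at hu
        rcases hu with hu | rfl
        · exact Or.inr (vars_runHG _ hu)
        · simp
    · rcases vars_cell_subset hu with ⟨w, hw, rfl⟩ | hu
      · simp only; split_ifs <;> simp
      · simp only [vars_zero, vars_one, Set.union_empty] at hu
        rcases hu with hu | rfl
        · exact Or.inr (vars_runHG _ hu)
        · simp

lemma size_net (hN : 0 < B.N) (hk : 0 < B.k) : (B.net hN hk).size =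
    B.Q.size + B.Q.hid.card + B.D.size + B.D.hid.card + 7 * B.k + 25 := by
  have h1 : Fintype.card HReg = 10 := rfl
  have h2 : Fintype.card VReg = 8 := rfl
  change Fintype.card ((HReg ⊕ Fin (6 * B.k + 7) ⊕ B.Q.hid ⊕ B.D.hid) ⊕
    (VReg ⊕ Fin B.k ⊕ B.Q.V ⊕ B.D.V)) = _
  simp only [RNN.size, Fintype.card_sum, h1, h2, Fintype.card_fin, Fintype.card_coe]
  ring

lemma card_hid_net (hN : 0 < B.N) (hk : 0 < B.k) : (B.net hN hk).hid.card =
    B.Q.hid.card + B.D.hid.card + 6 * B.k + 17 := by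
  have h1 : Fintype.card HReg = 10 := rfl
  simp only [net, Finset.card_map, Finset.card_univ, Fintype.card_sum, h1, Fintype.card_fin,
    Fintype.card_coe]
  ring

lemma ops_runG_le (t : ℕ) : (B.runG t).ops ≤ 40 := by
  simp [nat, leG, TransFn.dec]

lemma ops_runHG_le (t : ℕ) : (B.runHG t).ops ≤ 100 := by
  simp [eqG, nat, leG, TransFn.dec]

lemma ops_startW_le : B.startW.ops ≤ 100 := by
  simp [eqG, nat, TransFn.dec]

/-- The gates have a bounded number of operations whatever the parameters; with the bound `100` for
them, `ops_cell_le` gives the constant `2026 = 26 + 20 * 100`. -/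
lemma opsLE_net (hN : 0 < B.N) (hk : 0 < B.k) {m : ℕ} (hQ : B.Q.OpsLE m) (hD : B.D.OpsLE m) :
    (B.net hN hk).OpsLE (2026 + 4 * ((6 + 3 * 100) * 3 ^ m)) := by
  have hc {R : RNN} (hR : R.OpsLE m) (s : ℕ) (cp : R.V → B.Node) (st : R.hid → B.Node) (t : ℕ)
      (v : R.V) : (R.copyCell s B.ε (B.hr .tok) cp st (B.runG t) B.startW v).ops ≤
        2026 + 4 * ((6 + 3 * 100) * 3 ^ m) := by
    unfold RNN.copyCell
    split_ifs with h1 h2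
    · simp; omega
    · exact ops_cell_le (hR v h1) ((ops_runG_le t).trans (by norm_num)) ops_startW_le (by simp)
    · exact ops_cell_le (hR v h1) ((ops_runG_le t).trans (by norm_num)) ops_startW_le (by simp)
  have hh {R : RNN} (hR : R.OpsLE m) (s : ℕ) (st : R.hid → B.Node) (t : ℕ)
      (v : R.hid) : (R.hidCell s B.ε (B.vr .inp) st (B.runHG t) v).ops ≤
        2026 + 4 * ((6 + 3 * 100) * 3 ^ m) :=
    ops_cell_le (hR v fun h => R.inp_notMem_hid (h ▸ v.2)) (ops_runHG_le t) (by simp) (by simp)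
  intro v _
  change B.Node at v
  rcases v with (x | x | v | v) | (x | x | v | v)
  · show (B.hregFn x).ops ≤ _
    cases x <;> simp [hregFn, divG, sel, eqG, nat, notG, addG, subG, TransFn.dec] <;> omega
  · show (zero : TransFn B.Node).ops ≤ _
    simp; omega
  · exact hh hQ _ _ _ _
  · exact hh hD _ _ _ _
  · show (B.vregFn x).ops ≤ _
    cases x <;> simp [vregFn, quot, outQ, outD, dueG, sel, eqG, leG, nat, notG, addG, subG,
      TransFn.dec] <;> omega
  · show (zero : TransFn B.Node).ops ≤ _
    simp; omega
  · exact hc hQ _ _ _ _ _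
  · exact hc hD _ _ _ _ _

end Boost

/-! ### One time step of the boosted network, in terms of register contents -/

namespace Boost

variable {B : Boost}

/-- A number clipped to `[0, 1]`. -/
noncomputable def clip (x : ℝ) : ℝ := max 0 (max 0 x - max 0 (x - 1))

namespace Regs

/-- The factor by which the weight of a window is multiplied after a token. -/
noncomputable def factor (r : B.Regs) : ℝ :=
  max 0 (1 - B.κ * (if r.g = 1 ∧ r.i + 1 = r.J - (r.J - r.R) then
    clip (B.D.feed r.tok r.CD B.D.out) else 0))

/-- The register contents after one time step. -/
noncomputable def next (r : B.Regs) (y : ℕ) : B.Regs where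
  a := if r.a = B.tau - 1 then 0 else r.a + 1
  i := if r.a = B.tau - 1 then (if r.i = B.k - 1 then 0 else r.i + 1) else r.i
  W := if r.a = B.tau - 1 ∧ r.i = B.k - 1 then (if r.W = B.N ^ B.k then 0 else r.W + 1) else r.W
  U := if r.a = B.tau - 1 then (if r.i = B.k - 1 then (if r.W = B.N ^ B.k then 0 else r.W + 1)
    else r.V) else r.U
  V := r.U / B.N
  tok := r.U - B.N * r.V
  fd := if r.i = 0 then r.tok else r.fd
  J := if (r.a = B.tau - 1 ∧ r.i = B.k - 1) ∧ r.W = B.N ^ B.k then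
    (if r.J = 1 then B.k else r.J - 1) else r.J
  R := if (r.a = B.tau - 1 ∧ r.i = B.k - 1) ∧ r.W = B.N ^ B.k then r.R - B.dec else r.R
  g := if (r.a = B.tau - 1 ∧ r.i = B.k - 1) ∧ r.W = B.N ^ B.k then
    (if r.J = 1 then 1 else r.g) else r.g
  P := if r.i = 0 ∧ r.a = 0 then 1 else if r.a = B.T + 2 then
    quantize B.F (r.P * (max 0 (B.Q.feed r.tok r.CQ B.Q.out) * r.factor)) else r.P
  Sa := if r.W = 0 ∧ r.i = 0 ∧ r.a = 0 then 0 else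
    r.Sa + if (r.a = B.tau - 1 ∧ r.i = B.k - 1) ∧ ¬ r.W = B.N ^ B.k then r.P else 0
  Sle := if r.W = 0 ∧ r.i = 0 ∧ r.a = 0 then 0 else
    r.Sle + if ((r.a = B.tau - 1 ∧ r.i = B.k - 1) ∧ ¬ r.W = B.N ^ B.k) ∧ r.fd ≤ y then r.P else 0
  Slt := if r.W = 0 ∧ r.i = 0 ∧ r.a = 0 then 0 else
    r.Slt + if ((r.a = B.tau - 1 ∧ r.i = B.k - 1) ∧ ¬ r.W = B.N ^ B.k) ∧ r.fd + 1 ≤ y then r.P else 0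
  hi := quantize B.F (r.Sle * (1 / (r.Sa + max 0 (1 - 2 ^ B.F * r.Sa))))
  lo := quantize B.F (r.Slt * (1 / (r.Sa + max 0 (1 - 2 ^ B.F * r.Sa))))
  out := max 0 (r.hi - r.lo)
  HQ := B.Q.hidNext B.F r.HQ y ((r.W = B.N ^ B.k ∧ r.i = 0) ∧ 2 ≤ r.a ∧ r.a ≤ B.Q.time + 1)
  CQ := B.Q.copyNext B.F r.HQ r.CQ r.tok (2 ≤ r.a ∧ r.a ≤ B.Q.time + 1) (r.i = 0 ∧ r.a = 0)
  HD := B.D.hidNext B.G r.HD y ((r.W = B.N ^ B.k ∧ r.i = 0) ∧ 2 ≤ r.a ∧ r.a ≤ B.D.time + 1)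
  CD := B.D.copyNext B.G r.HD r.CD r.tok (2 ≤ r.a ∧ r.a ≤ B.D.time + 1) (r.i = 0 ∧ r.a = 0)

/-- The conditions under which a simulated network runs correctly. -/
structure SimOk (R : RNN) (G s : ℕ) (ε : ℝ) (H C : R.V → ℝ) (x y : ℝ) (run runH : Prop) :
    Prop where
  copy : ∀ v, OnGrid G (C v)
  hid : ∀ v ∈ R.hid, OnGrid G (H v)
  init : ∀ v, v ≠ R.inp → OnGrid G (R.init v)
  runs : run → ∀ v, v ≠ R.inp → R.StepOk (ε * 2 ^ s) (R.feed x C) v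
  runsH : runH → ∀ v ∈ R.hid, R.StepOk (ε * 2 ^ s) (R.feed y H) v

/-- The conditions under which the network computes the next register contents. -/
structure Ok (r : B.Regs) (y : ℕ) : Prop where
  hε : 0 < B.ε
  hεF : B.ε ≤ 1 / 2 ^ B.F
  P : OnGrid B.F r.P ∧ 0 ≤ r.P
  Sa : OnGrid B.F r.Sa ∧ 0 ≤ r.Sa
  Sle : OnGrid B.F r.Sle ∧ 0 ≤ r.Sle
  Slt : OnGrid B.F r.Slt ∧ 0 ≤ r.Slt
  hi : OnGrid B.F r.hi
  lo : OnGrid B.F r.lo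
  simQ : SimOk B.Q B.F 0 B.ε r.HQ r.CQ r.tok y (2 ≤ r.a ∧ r.a ≤ B.Q.time + 1)
    ((r.W = B.N ^ B.k ∧ r.i = 0) ∧ 2 ≤ r.a ∧ r.a ≤ B.Q.time + 1)
  simD : SimOk B.D B.G B.s B.ε r.HD r.CD r.tok y (2 ≤ r.a ∧ r.a ≤ B.D.time + 1)
    ((r.W = B.N ^ B.k ∧ r.i = 0) ∧ 2 ≤ r.a ∧ r.a ≤ B.D.time + 1)

section eval

variable (r : B.Regs) (x : ℝ)

lemma two_pow_F_pos : (0 : ℝ) < 2 ^ B.F := by positivity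

lemma eval_a : (B.cnt .a).eval (r.state x) = r.a := eval_dec two_pow_F_pos rfl
lemma eval_i : (B.cnt .i).eval (r.state x) = r.i := eval_dec two_pow_F_pos rfl
lemma eval_W : (B.cnt .W).eval (r.state x) = r.W := eval_dec two_pow_F_pos rfl
lemma eval_U : (B.cnt .U).eval (r.state x) = r.U := eval_dec two_pow_F_pos rfl
lemma eval_V : (B.cnt .V).eval (r.state x) = r.V := eval_dec two_pow_F_pos rfl
lemma eval_J : (B.cnt .J).eval (r.state x) = r.J := eval_dec two_pow_F_pos rfl
lemma eval_R : (B.cnt .R).eval (r.state x) = r.R := eval_dec two_pow_F_pos rfl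
lemma eval_tok : (B.raw .tok).eval (r.state x) = r.tok := rfl
lemma eval_fd : (B.raw .fd).eval (r.state x) = r.fd := rfl
lemma eval_g : (B.raw .g).eval (r.state x) = r.g := rfl

lemma eval_isA (n : ℕ) : (B.isA n).eval (r.state x) = if r.a = n then 1 else 0 :=
  eval_eqG (eval_a r x) (eval_nat _ _)
lemma eval_isI (n : ℕ) : (B.isI n).eval (r.state x) = if r.i = n then 1 else 0 :=
  eval_eqG (eval_i r x) (eval_nat _ _)
lemma eval_isW (n : ℕ) : (B.isW n).eval (r.state x) = if r.W = n then 1 else 0 :=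
  eval_eqG (eval_W r x) (eval_nat _ _)
lemma eval_isJ1 : B.isJ1.eval (r.state x) = if r.J = 1 then 1 else 0 :=
  eval_eqG (eval_J r x) (eval_nat _ _)
lemma eval_endW : B.endW.eval (r.state x) =
    if r.a = B.tau - 1 ∧ r.i = B.k - 1 then 1 else 0 :=
  eval_andG (eval_isA r x _) (eval_isI r x _)
lemma eval_endT : B.endT.eval (r.state x) =
    if (r.a = B.tau - 1 ∧ r.i = B.k - 1) ∧ r.W = B.N ^ B.k then 1 else 0 :=
  eval_andG (eval_endW r x) (eval_isW r x _)
lemma eval_startW : B.startW.eval (r.state x) = if r.i = 0 ∧ r.a = 0 then 1 else 0 :=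
  eval_andG (eval_isI r x _) (eval_isA r x _)
lemma eval_startT : B.startT.eval (r.state x) = if r.W = 0 ∧ r.i = 0 ∧ r.a = 0 then 1 else 0 :=
  eval_andG (eval_isW r x _) (eval_startW r x)
lemma eval_runG (t : ℕ) : (B.runG t).eval (r.state x) =
    if 2 ≤ r.a ∧ r.a ≤ t + 1 then 1 else 0 :=
  eval_andG (eval_leG (eval_nat _ _) (eval_a r x)) (eval_leG (eval_a r x) (eval_nat _ _))
lemma eval_runHG (t : ℕ) : (B.runHG t).eval (r.state x) =
    if (r.W = B.N ^ B.k ∧ r.i = 0) ∧ 2 ≤ r.a ∧ r.a ≤ t + 1 then 1 else 0 :=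
  eval_andG (eval_andG (eval_isW r x _) (eval_isI r x _)) (eval_runG r x t)

lemma eval_outQ : B.outQ.eval (r.state x) = max 0 (B.Q.feed r.tok r.CQ B.Q.out) := by
  have := congrFun (RNN.loc_eq_feed (R := B.Q) (s := 0) (S := r.state x) (tok := B.hr .tok)
    (x := r.tok) (cp := B.cpQ) (C := r.CQ) rfl (fun v => by simp [state])) B.Q.out
  simp only [outQ, eval_lin, eval_var, eval_one]
  rw [← this]; simp

lemma eval_outD : B.outD.eval (r.state x) = clip (B.D.feed r.tok r.CD B.D.out) := by
  have := congrFun (RNN.loc_eq_feed (R := B.D) (s := B.s) (S := r.state x) (tok := B.hr .tok)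
    (x := r.tok) (cp := B.cpD) (C := r.CD) rfl (fun v => rfl)) B.D.out
  simp only [outD, eval_lin, eval_var, eval_one, clip]
  rw [← this]; simp [sub_eq_add_neg]

lemma eval_dueG : B.dueG.eval (r.state x) =
    if r.g = 1 ∧ r.i + 1 = r.J - (r.J - r.R) then 1 else 0 :=
  eval_andG (eval_eqG (eval_g r x) (eval_nat _ _)) (eval_eqG
    (eval_addG (eval_i r x) (eval_nat _ _))
    (eval_subG (eval_J r x) (eval_subG (eval_J r x) (eval_R r x))))

lemma eval_factor : (lin 1 one (-B.κ) (mul B.dueG B.outD)).eval (r.state x) = r.factor := by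
  simp only [eval_lin, eval_mul, eval_dueG, eval_outD, eval_one, factor]
  congr 1
  split_ifs <;> ring

lemma quantize_coded (n : ℕ) : quantize B.F (n / 2 ^ B.F) = n / 2 ^ B.F :=
  quantize_of_onGrid (onGrid_natCast_div _ _)

lemma quantize_natCast (F n : ℕ) : quantize F n = n := quantize_of_onGrid (onGrid_natCast F n)

lemma step_hreg (hN : 0 < B.N) (h : HReg) (y : ℕ) :
    quantize B.F ((B.hregFn h).eval (r.state x)) = (r.next y).hval h := by
  cases h
  case a =>
    simp only [hregFn, hval]
    rw [eval_divG two_pow_F_pos.le (eval_selN (eval_isA r x _) (eval_nat _ _)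
      (eval_addG (eval_a r x) (eval_nat _ _))), quantize_coded]
    rfl
  case i =>
    simp only [hregFn, hval]
    rw [eval_divG two_pow_F_pos.le (eval_selN (eval_isA r x _) (eval_selN (eval_isI r x _)
      (eval_nat _ _) (eval_addG (eval_i r x) (eval_nat _ _))) (eval_i r x)), quantize_coded]
    rfl
  case W =>
    simp only [hregFn, hval]
    rw [eval_divG two_pow_F_pos.le (eval_selN (eval_endW r x) (eval_selN (eval_isW r x _)
      (eval_nat _ _) (eval_addG (eval_W r x) (eval_nat _ _))) (eval_W r x)), quantize_coded]
    rfl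
  case U =>
    simp only [hregFn, hval]
    rw [eval_divG two_pow_F_pos.le (eval_selN (eval_isA r x _) (eval_selN (eval_isI r x _)
      (eval_selN (eval_isW r x _) (eval_nat _ _) (eval_addG (eval_W r x) (eval_nat _ _)))
      (eval_V r x)) (eval_U r x)), quantize_coded]
    rfl
  case V =>
    simp only [hregFn, hval]
    have h1 := eval_divG (u := B.N) (Nat.cast_nonneg _) (eval_U r x)
    have : (divG (2 ^ B.F) (divG B.N (B.cnt .U))).eval (r.state x) = r.U / B.N / 2 ^ B.F := by
      rw [divG, eval_lin, h1, eval_one, max_eq_right (by positivity)]; ring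
    -- Rounding down to a multiple of `2 ^ (-F)` is here the integer division by `N`.
    rw [this, quantize, div_mul_cancel₀ _ two_pow_F_pos.ne', ← natCast_floor_eq_intCast_floor
      (by positivity), Nat.floor_div_eq_div]
    rfl
  case tok =>
    simp only [hregFn, hval, eval_lin, eval_U, eval_V]
    rw [show 1 * (r.U : ℝ) + -B.N * r.V = r.U - (B.N * r.V : ℕ) by push_cast; ring, ← cast_tsub,
      quantize_natCast]
    rfl
  case fd =>
    simp only [hregFn, hval]
    rw [eval_selN (eval_isI r x _) (eval_tok r x) (eval_fd r x), quantize_natCast]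
    rfl
  case J =>
    simp only [hregFn, hval]
    rw [eval_divG two_pow_F_pos.le (eval_selN (eval_endT r x) (eval_selN (eval_isJ1 r x)
      (eval_nat _ _) (eval_subG (eval_J r x) (eval_nat _ _))) (eval_J r x)), quantize_coded]
    rfl
  case R =>
    simp only [hregFn, hval]
    rw [eval_divG two_pow_F_pos.le (eval_selN (eval_endT r x) (eval_subG (eval_R r x)
      (eval_nat _ _)) (eval_R r x)), quantize_coded]
    rfl
  case g =>
    simp only [hregFn, hval]
    rw [eval_selN (eval_endT r x) (eval_selN (eval_isJ1 r x)
      (eval_nat _ _) (eval_g r x)) (eval_g r x), quantize_natCast]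
    rfl

lemma step_vreg (y : ℕ) (h : r.Ok y) (v : VReg) (hv : v ≠ .inp) :
    quantize B.F ((B.vregFn v).eval (r.state y)) = (r.next y).vval x v := by
  have hacc := eval_andG (eval_endW r y) (eval_notG (eval_isW r y (B.N ^ B.k)))
  have hinp : (B.vis .inp).eval (r.state y) = y := rfl
  have hP : (B.vis .P).eval (r.state y) = r.P := rfl
  have hSa : (B.vis .Sa).eval (r.state y) = r.Sa := rfl
  have acc {S : ℝ} {p : Prop} [Decidable p] (hS : OnGrid B.F S ∧ 0 ≤ S) {g e : TransFn B.Node}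
      (he : e.eval (r.state y) = S)
      (hg : g.eval (r.state y) = if p then 1 else 0) :
      quantize B.F ((sel B.startT zero (lin 1 e 1 (mul g (B.vis .P)))).eval (r.state y)) =
        if r.W = 0 ∧ r.i = 0 ∧ r.a = 0 then 0 else S + if p then r.P else 0 := by
    have h1 : (0 : ℝ) ≤ if p then r.P else 0 := by split_ifs; exacts [h.P.2, le_rfl]
    have h2 : OnGrid B.F (if p then r.P else 0) := by split_ifs; exacts [h.P.1, onGrid_zero _]
    have : (lin 1 e 1 (mul g (B.vis .P))).eval (r.state y) = S + if p then r.P else 0 := by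
      simp only [eval_lin, eval_mul, hg, hP, he]
      rw [max_eq_right] <;> [skip; skip]
      · split_ifs <;> ring
      · have := hS.2
        have := h.P.2
        split_ifs <;> nlinarith
    rw [eval_sel (eval_startT r y) (eval_zero _) this le_rfl (add_nonneg hS.2 h1)]
    split_ifs
    · exact quantize_zero _
    · exact quantize_of_onGrid (hS.1.add (by simpa [*] using h2))
    · exact quantize_of_onGrid (hS.1.add (by simpa [*] using h2))
  cases v
  case inp => exact absurd rfl hv
  case P =>
    have hf : 0 ≤ r.factor := le_max_left _ _
    have h1 : (mul (B.vis .P) (mul B.outQ (lin 1 one (-B.κ) (mul B.dueG B.outD)))).eval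
        (r.state y) = r.P * (max 0 (B.Q.feed r.tok r.CQ B.Q.out) * r.factor) := by
      rw [eval_mul, eval_mul, eval_factor, eval_outQ, hP]
    have h0 : 0 ≤ r.P * (max 0 (B.Q.feed r.tok r.CQ B.Q.out) * r.factor) :=
      mul_nonneg h.P.2 (mul_nonneg (le_max_left _ _) hf)
    have h2 := eval_sel (eval_isA r y (B.T + 2)) h1 hP h0 h.P.2
    have h3 : 0 ≤ if r.a = B.T + 2 then
        r.P * (max 0 (B.Q.feed r.tok r.CQ B.Q.out) * r.factor) else r.P := by
      split_ifs; exacts [h0, h.P.2]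
    rw [vregFn, eval_sel (eval_startW r y) (eval_one _) h2 zero_le_one h3]
    simp only [vval, next]
    split_ifs
    · exact quantize_of_onGrid (onGrid_one _)
    · rfl
    · exact quantize_of_onGrid h.P.1
  case Sa => exact acc h.Sa rfl hacc
  case Sle => exact acc h.Sle rfl (eval_andG hacc (eval_leG (eval_fd r y) hinp))
  case Slt =>
    exact acc h.Slt rfl (eval_andG hacc (eval_leG (eval_addG (eval_fd r y) (eval_nat _ 1)) hinp))
  case hi =>
    simp only [vregFn, quot, eval_mul, eval_recipAdd, eval_lin, hSa, eval_one, vval, next]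
    rw [show (B.vis .Sle).eval (r.state y) = r.Sle from rfl]
    congr 5; ring
  case lo =>
    simp only [vregFn, quot, eval_mul, eval_recipAdd, eval_lin, hSa, eval_one, vval, next]
    rw [show (B.vis .Slt).eval (r.state y) = r.Slt from rfl]
    congr 5; ring
  case out =>
    simp only [vregFn, eval_lin, vval, next]
    rw [show (B.vis .hi).eval (r.state y) = r.hi from rfl,
      show (B.vis .lo).eval (r.state y) = r.lo from rfl, one_mul, neg_one_mul, ← sub_eq_add_neg]
    exact quantize_of_onGrid (h.hi.sub h.lo).max_zero

lemma defined_hregFn (S : B.Node → ℝ) (h : HReg) : (B.hregFn h).Defined S := by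
  cases h <;> simp [hregFn, divG, sel, eqG, nat, notG, addG, subG, TransFn.dec]

lemma defined_vregFn (y : ℕ) (h : r.Ok y) (v : VReg) : (B.vregFn v).Defined (r.state y) := by
  have hq (e : VReg) : (B.quot e).Defined (r.state y) := by
    have hSa : r.state y (B.vr .Sa) = r.Sa := rfl
    simp only [quot, defined_mul, defined_recipAdd, defined_lin, defined_var, defined_one, eval_lin,
      eval_var, eval_one, hSa, true_and]
    rcases h.Sa.2.eq_or_lt with h0 | h0
    · simp [← h0]
    · have := le_max_left 0 (1 * 1 + -2 ^ B.F * r.Sa)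
      positivity
  cases v
  case hi => exact hq _
  case lo => exact hq _
  all_goals simp [vregFn, sel, eqG, leG, nat, notG, addG, subG, TransFn.dec, outQ, outD, dueG]

end eval

variable {r : B.Regs} {y : ℕ}

/-- One time step of the network computes the next register contents. -/
lemma step_state (hN : 0 < B.N) (hk : 0 < B.k) (h : r.Ok y) :
    (B.net hN hk).step B.F (r.state y) = (r.next y).state y ∧
      ∀ v, v ≠ (B.net hN hk).inp → ((B.net hN hk).f v).Defined (r.state y) := by
  have hrun (t) : (B.runG t).Defined (r.state y) := by simp [nat, leG, TransFn.dec]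
  have hrunH (t) : (B.runHG t).Defined (r.state y) := by simp [eqG, nat, leG, TransFn.dec]
  have hstart : B.startW.Defined (r.state y) := by simp [eqG, nat, TransFn.dec]
  have hpp (t : ℕ) : ¬ ((2 ≤ r.a ∧ r.a ≤ t + 1) ∧ (r.i = 0 ∧ r.a = 0)) := by omega
  have cQ := RNN.copyCell_spec (R := B.Q) (s := 0) (cp := B.cpQ) (st := B.stQ) (tok := B.hr .tok)
    (S := r.state y) (x := r.tok) (H := r.HQ) (C := r.CQ) h.hε h.hεF rfl
    (fun v => by simp [state]) (fun v => by simp [state]) (eval_runG r y B.Q.time)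
    (eval_startW r y) (hrun _) hstart (hpp _) h.simQ.copy h.simQ.hid h.simQ.init h.simQ.runs
  have cD := RNN.copyCell_spec (R := B.D) (s := B.s) (cp := B.cpD) (st := B.stD) (tok := B.hr .tok)
    (S := r.state y) (x := r.tok) (H := r.HD) (C := r.CD) h.hε h.hεF rfl
    (fun v => rfl) (fun v => rfl) (eval_runG r y B.D.time)
    (eval_startW r y) (hrun _) hstart (hpp _) h.simD.copy h.simD.hid h.simD.init h.simD.runs
  have sQ := RNN.hidCell_spec (R := B.Q) (s := 0) (st := B.stQ) (tok := B.vr .inp)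
    (S := r.state y) (x := y) (H := r.HQ) h.hε h.hεF rfl (fun v => by simp [state])
    (eval_runHG r y B.Q.time) (hrunH _) h.simQ.hid h.simQ.runsH
  have sD := RNN.hidCell_spec (R := B.D) (s := B.s) (st := B.stD) (tok := B.vr .inp)
    (S := r.state y) (x := y) (H := r.HD) h.hε h.hεF rfl (fun v => rfl)
    (eval_runHG r y B.D.time) (hrunH _) h.simD.hid h.simD.runsH
  constructor
  · ext v
    by_cases hv : v = (B.net hN hk).inp
    · subst hv; exact RNN.step_inp _ _ _
    refine (RNN.step_of_ne _ _ _ hv).trans ?_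
    change B.Node at v
    rcases v with (v | v | v | v) | (v | v | v | v)
    · exact step_hreg r y hN v y
    · exact (congrArg _ (eval_zero _)).trans (quantize_zero _)
    · exact (sQ v).1.trans (by simp [state, next])
    · exact (sD v).1
    · exact step_vreg r y y h v (fun hv' => hv (hv' ▸ rfl))
    · exact (congrArg _ (eval_zero _)).trans (quantize_zero _)
    · exact (cQ v).1.trans (by simp [state, next])
    · exact (cD v).1
  · intro v _
    change B.Node at v
    rcases v with (v | v | v | v) | (v | v | v | v)
    · exact defined_hregFn _ v
    · exact defined_zero _
    · exact (sQ v).2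
    · exact (sD v).2
    · exact defined_vregFn r y h v
    · exact defined_zero _
    · exact (cQ v).2
    · exact (cD v).2

lemma feed_state (hN : 0 < B.N) (hk : 0 < B.k) (r : B.Regs) (x y : ℝ) :
    (B.net hN hk).feed y (r.state x) = r.state y := by
  ext v
  by_cases hv : v = (B.net hN hk).inp
  · subst hv; exact Function.update_self ..
  · refine (Function.update_of_ne hv ..).trans ?_
    change B.Node at v
    rcases v with (v | v | v | v) | (v | v | v | v) <;> try rfl
    cases v <;> first | rfl | exact absurd rfl hv

end Regs

end Boost

/-! ### Runs of a simulated network -/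

namespace RNN

variable (R : RNN) {N : ℕ} (F : ℕ)

lemma restart_nil : R.restart F ([] : List (Fin N)) = R.init := by
  ext v; simp [restart, runFrom]

lemma runFrom_append (S : R.V → ℝ) (u : List (Fin N)) (x : Fin N) :
    R.runFrom F S (u ++ [x]) = R.process F (R.runFrom F S u) x := by
  simp [runFrom]

lemma feed_of_ne (x : ℝ) (S : R.V → ℝ) {v : R.V} (h : v ≠ R.inp) : R.feed x S v = S v :=
  Function.update_of_ne h _ _

lemma feed_inp (x : ℝ) (S : R.V → ℝ) : R.feed x S R.inp = x := Function.update_self _ _ _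

variable (s u : List (Fin N)) (x : Fin N)

lemma config_succ (j : ℕ) : R.config F s u x (j + 1) = R.step F (R.config F s u x j) :=
  Function.iterate_succ_apply' _ _ _

lemma config_inp (j : ℕ) : R.config F s u x j R.inp = x.val := by
  induction j with
  | zero => exact R.feed_inp _ _
  | succ j ih => rw [config_succ, step_inp, ih]

lemma config_zero {v : R.V} (h : v ≠ R.inp) :
    R.config F s u x 0 v = R.runFrom F (R.restart F s) u v := R.feed_of_ne _ _ h

lemma config_time : R.config F s u x R.time = R.runFrom F (R.restart F s) (u ++ [x]) :=
  (R.runFrom_append F _ u x).symm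

lemma feed_eq_config {C : R.V → ℝ} {j : ℕ} (h : ∀ v, v ≠ R.inp → C v = R.config F s u x j v) :
    R.feed x.val C = R.config F s u x j := by
  ext v
  by_cases hv : v = R.inp
  · subst hv; rw [feed_inp, config_inp]
  · rw [feed_of_ne _ _ _ hv, h v hv]

end RNN

namespace Boost

/-- The token with number `m` modulo `N`. -/
def digit {N : ℕ} (hN : 0 < N) (m : ℕ) : Fin N := ⟨m % N, Nat.mod_lt _ hN⟩

/-- The last `i` digits of `W`, the lowest first. -/
def digits {N : ℕ} (hN : 0 < N) (i W : ℕ) : List (Fin N) :=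
  (List.range i).map fun j => digit hN (W / N ^ j)

lemma digits_succ {N : ℕ} (hN : 0 < N) (i W : ℕ) :
    digits hN (i + 1) W = digits hN i W ++ [digit hN (W / N ^ i)] := by
  simp [digits, List.range_succ]

lemma digits_zero {N : ℕ} (hN : 0 < N) (W : ℕ) : digits hN 0 W = [] := rfl

/-- The contents of the storage nodes and of the copy of a simulated network, when the prefix `s`
has been read before the input token `y`, and the clock is at step `a` of the token `i` of the
window `W`. -/
structure SimInv (R : RNN) (I : ℝ) (G : ℕ) {N : ℕ} (hN : 0 < N) (k : ℕ) (s : List (Fin N))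
    (y : Fin N) (W i a : ℕ) (H C : R.V → ℝ) : Prop where
  -- Storage waits at time `0` of reading `y` during all windows, runs in the first slot of the
  -- extra pass, and then stays at its final time.
  hid : ∀ v ∈ R.hid, H v = R.config G [] s y
    (if W = N ^ k then (if i = 0 then min (a - 2) R.time else R.time) else 0) v
  fixed : ∀ v, FixedPoint I G (C v)
  -- The copy follows the run resumed from the hidden values of `s`. It starts at step `2`, when the
  -- token is decoded, and holds its result afterwards. At the first step of a window it is stale
  -- and about to be reset.
  copy : ¬ (i = 0 ∧ a = 0) → ∀ v, v ≠ R.inp →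
    C v = R.config G s (digits hN i W) (digit hN (W / N ^ i)) (min (a - 2) R.time) v

namespace SimInv

variable {R : RNN} {I b ε : ℝ} {G N k T sc x W i a : ℕ} {hN : 0 < N} {s : List (Fin N)} {y : Fin N}
  {H C : R.V → ℝ}

lemma fixedPoint_zero : FixedPoint I G 0 := ⟨by simp; positivity, 0, by simp⟩

lemma fixedPoint_config (hR : R.HasBitSize N b I G) (s u : List (Fin N)) (x : Fin N) {j : ℕ}
    (hj : j ≤ R.time) (v : R.V) : FixedPoint I G (R.config G s u x j v) := (hR.2 s u x).1 j hj v

lemma hid_index_le : (if W = N ^ k then (if i = 0 then min (a - 2) R.time else R.time) else 0) ≤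
    R.time := by
  split_ifs <;> simp

lemma fixedPoint_hid (hR : R.HasBitSize N b I G) (h : SimInv R I G hN k s y W i a H C) (v : R.V)
    (hv : v ∈ R.hid) : FixedPoint I G (H v) := by
  rw [h.hid v hv]; exact fixedPoint_config hR _ _ _ hid_index_le v

lemma ne_inp_of_mem_hid {v : R.V} (hv : v ∈ R.hid) : v ≠ R.inp := fun h => R.inp_notMem_hid (h ▸ hv)

lemma fixedPoint_init (hR : R.HasBitSize N b I G) (hN : 0 < N) {v : R.V} (hv : v ≠ R.inp) :
    FixedPoint I G (R.init v) := by
  have := fixedPoint_config hR [] [] ⟨0, hN⟩ (Nat.zero_le _) v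
  rwa [R.config_zero _ _ _ _ hv, RNN.restart_nil] at this

lemma feed_hid_eval (h : SimInv R I G hN k s y W i a H C) {v : R.V} (hv : v ∈ R.hid) :
    ∀ u ∈ (R.f v).vars, R.feed y.val H u = R.config G [] s y
      (if W = N ^ k then (if i = 0 then min (a - 2) R.time else R.time) else 0) u := by
  intro u hu
  rcases R.hid_closed v hv u hu with rfl | hu
  · rw [RNN.feed_inp, RNN.config_inp]
  · rw [RNN.feed_of_ne _ _ _ (ne_inp_of_mem_hid hu), h.hid u hu]

/-- The simulated network runs correctly. -/
lemma simOk (hR : R.HasBitSize N b I G)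
    (hgap : ∀ S : R.V → ℝ, (∀ v, FixedPoint I G (S v)) → ∀ v,
      0 ≤ (R.f v).eval S ∨ (R.f v).eval S ≤ -(ε * 2 ^ sc))
    (h : SimInv R I G hN k s y W i a H C) (hx : 2 ≤ a → x = W / N ^ i % N) :
    Regs.SimOk R G sc ε H C x y (2 ≤ a ∧ a ≤ R.time + 1)
      ((W = N ^ k ∧ i = 0) ∧ 2 ≤ a ∧ a ≤ R.time + 1) where
  copy v := (h.fixed v).onGrid
  hid v hv := (h.fixedPoint_hid hR v hv).onGrid
  init v hv := (fixedPoint_init hR hN hv).onGrid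
  runs := by
    rintro ⟨h1, h2⟩ v hv
    have hc := R.feed_eq_config G s _ _ (h.copy (by omega))
    have hxd : ((digit hN (W / N ^ i)).val : ℝ) = x := by rw [hx h1]; rfl
    rw [hxd] at hc
    refine ⟨?_, hgap _ (fun v => ?_) v⟩ <;> rw [hc]
    · exact (hR.2 _ _ _).2 _ (by omega) v hv
    · exact fixedPoint_config hR _ _ _ (min_le_right _ _) v
  runsH := by
    rintro ⟨⟨hW, hi⟩, h1, h2⟩ v hv
    have hj := hid_index_le (R := R) (N := N) (k := k) (W := W) (i := i) (a := a)
    have hvars := h.feed_hid_eval hv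
    have he := TransFn.eval_congr _ hvars
    refine ⟨TransFn.defined_congr _ (fun u hu => (hvars u hu).symm) ?_, ?_⟩
    · exact (hR.2 _ _ _).2 _ (by simp only [hW, hi, if_true]; omega) v (ne_inp_of_mem_hid hv)
    · rw [he]; exact hgap _ (fun v => fixedPoint_config hR _ _ _ hj v) v

lemma hidNext_eq (h : SimInv R I G hN k s y W i a H C) {v : R.V} (hv : v ∈ R.hid) :
    R.hidNext G H y ((W = N ^ k ∧ i = 0) ∧ 2 ≤ a ∧ a ≤ R.time + 1) v =
      R.config G [] s y
        (if W = N ^ k then (if i = 0 then min (a + 1 - 2) R.time else R.time) else 0) v := by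
  unfold RNN.hidNext
  split_ifs with h1 h2 h3 h3 h4
  · obtain ⟨j, hj⟩ : ∃ j, a - 2 = j := ⟨_, rfl⟩
    have hvars := h.feed_hid_eval hv
    rw [RNN.step_of_ne _ _ _ (ne_inp_of_mem_hid hv), TransFn.eval_congr _ hvars,
      ← RNN.step_of_ne _ _ _ (ne_inp_of_mem_hid hv), ← RNN.config_succ]
    congr 1
    simp only [h2, h3, if_true]; omega
  · exact absurd h1.1.2 h3
  · exact absurd h1.1.1 h2
  · rw [h.hid v hv]; congr 1; simp only [h3, h4, if_true]; omega
  · rw [h.hid v hv]; congr 1; simp [*]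
  · rw [h.hid v hv]; congr 1; simp [*]

/-- This holds in the extra pass too, since storage is not advanced before step `2`; hence every
reset of the copy finds the hidden values of `s`. -/
lemma config_hid_zero (h : SimInv R I G hN k s y W i 0 H C) (hi : i = 0) {v : R.V}
    (hv : v ∈ R.hid) : H v = R.restart G s v := by
  have := h.hid v hv
  subst hi
  simp only [Nat.zero_sub, if_true, Nat.zero_min, ite_self] at this
  rw [this, RNN.config_zero _ _ _ _ _ (ne_inp_of_mem_hid hv), RNN.restart_nil, RNN.restart,
    if_pos hv]

lemma copyNext_eq (h : SimInv R I G hN k s y W i a H C) (hx : 2 ≤ a → x = W / N ^ i % N) {v : R.V}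
    (hv : v ≠ R.inp) :
    R.copyNext G H C x (2 ≤ a ∧ a ≤ R.time + 1) (i = 0 ∧ a = 0) v =
      R.config G s (digits hN i W) (digit hN (W / N ^ i)) (min (a + 1 - 2) R.time) v := by
  unfold RNN.copyNext
  rw [if_neg hv]
  by_cases h0 : i = 0 ∧ a = 0
  · obtain ⟨rfl, rfl⟩ := h0
    simp only [and_self, if_true]
    rw [show min (0 + 1 - 2) R.time = 0 by omega, RNN.config_zero _ _ _ _ _ hv, digits_zero]
    by_cases hh : v ∈ R.hid
    · rw [if_pos hh, h.config_hid_zero rfl hh]; rfl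
    · rw [if_neg hh, RNN.runFrom, List.foldl_nil, RNN.restart, if_neg hh]
  · rw [if_neg h0]
    have hc := h.copy h0
    split_ifs with h1
    · have hc := R.feed_eq_config G s _ _ hc
      have hxd : ((digit hN (W / N ^ i)).val : ℝ) = x := by rw [hx h1.1]; rfl
      rw [hxd] at hc
      rw [hc, ← RNN.config_succ]
      congr 1; omega
    · rw [hc v hv]; congr 1; omega

lemma fixedPoint_copyNext (hR : R.HasBitSize N b I G) (h : SimInv R I G hN k s y W i a H C)
    (hx : 2 ≤ a → x = W / N ^ i % N) (v : R.V) :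
    FixedPoint I G (R.copyNext G H C x (2 ≤ a ∧ a ≤ R.time + 1) (i = 0 ∧ a = 0) v) := by
  by_cases hv : v = R.inp
  · simp only [RNN.copyNext, hv, if_true]; exact fixedPoint_zero
  · rw [h.copyNext_eq hx hv]; exact fixedPoint_config hR _ _ _ (min_le_right _ _) v

/-- Within the time of a token. -/
lemma next_step (hR : R.HasBitSize N b I G) (h : SimInv R I G hN k s y W i a H C)
    (hx : 2 ≤ a → x = W / N ^ i % N) :
    SimInv R I G hN k s y W i (a + 1)
      (R.hidNext G H y ((W = N ^ k ∧ i = 0) ∧ 2 ≤ a ∧ a ≤ R.time + 1))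
      (R.copyNext G H C x (2 ≤ a ∧ a ≤ R.time + 1) (i = 0 ∧ a = 0)) where
  hid _ hv := h.hidNext_eq hv
  fixed := h.fixedPoint_copyNext hR hx
  copy _ _ hv := h.copyNext_eq hx hv

/-- From one token to the next. -/
lemma next_token (hR : R.HasBitSize N b I G) (h : SimInv R I G hN k s y W i a H C)
    (hx : 2 ≤ a → x = W / N ^ i % N) (ha : R.time + 1 < a) :
    SimInv R I G hN k s y W (i + 1) 0
      (R.hidNext G H y ((W = N ^ k ∧ i = 0) ∧ 2 ≤ a ∧ a ≤ R.time + 1))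
      (R.copyNext G H C x (2 ≤ a ∧ a ≤ R.time + 1) (i = 0 ∧ a = 0)) where
  hid v hv := by
    rw [h.hidNext_eq hv]
    congr 1
    simp [show min (a - 1) R.time = R.time by omega]
  fixed := h.fixedPoint_copyNext hR hx
  copy _ v hv := by
    rw [h.copyNext_eq hx hv, show min (a + 1 - 2) R.time = R.time by omega, RNN.config_time,
      ← digits_succ, Nat.zero_sub, Nat.zero_min, RNN.config_zero _ _ _ _ _ hv]

/-- From one window to the next. -/
lemma next_window (hR : R.HasBitSize N b I G) (h : SimInv R I G hN k s y W i a H C)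
    (hx : 2 ≤ a → x = W / N ^ i % N) (hW : W < N ^ k) :
    SimInv R I G hN k s y (W + 1) 0 0
      (R.hidNext G H y ((W = N ^ k ∧ i = 0) ∧ 2 ≤ a ∧ a ≤ R.time + 1))
      (R.copyNext G H C x (2 ≤ a ∧ a ≤ R.time + 1) (i = 0 ∧ a = 0)) where
  hid v hv := by
    rw [h.hidNext_eq hv]
    congr 1
    simp [hW.ne]
  fixed := h.fixedPoint_copyNext hR hx
  copy h0 := absurd ⟨rfl, rfl⟩ h0

/-- From one input token to the next. -/
lemma next_input (hR : R.HasBitSize N b I G) (h : SimInv R I G hN k s y W i a H C)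
    (hx : 2 ≤ a → x = W / N ^ i % N) (hW : W = N ^ k) (ha : R.time + 1 < a) (y' : Fin N) :
    SimInv R I G hN k (s ++ [y]) y' 0 0 0
      (R.hidNext G H y ((W = N ^ k ∧ i = 0) ∧ 2 ≤ a ∧ a ≤ R.time + 1))
      (R.copyNext G H C x (2 ≤ a ∧ a ≤ R.time + 1) (i = 0 ∧ a = 0)) where
  hid v hv := by
    rw [h.hidNext_eq hv]
    simp only [show min (a + 1 - 2) R.time = R.time by omega, Nat.zero_sub, if_true, Nat.zero_min, hW,
      ite_self, RNN.config_time]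
    rw [RNN.config_zero _ _ _ _ _ (ne_inp_of_mem_hid hv)]
  fixed := h.fixedPoint_copyNext hR hx
  copy h0 := absurd ⟨rfl, rfl⟩ h0

/-- The output of the simulated network at the end of the time of a token. -/
lemma output_eq (hS : R.HiddenSuffices N G) (h : SimInv R I G hN k s y W i a H C)
    (hx : x = W / N ^ i % N) (ha : R.time + 1 < a) :
    R.feed x C R.out = R.output G (s ++ digits hN (i + 1) W) := by
  have hc := R.feed_eq_config G s _ _ (h.copy (by omega))
  have hxd : ((digit hN (W / N ^ i)).val : ℝ) = x := by rw [hx]; rfl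
  rw [hxd] at hc
  -- The copy gives the output of the resumed run; sufficiency of the hidden nodes turns it into the
  -- output of the ordinary run.
  rw [hc, show min (a - 2) R.time = R.time by omega, RNN.config_time, ← digits_succ, hS]
  simp [digits_succ]

end SimInv

end Boost

namespace Boost

/-! ### The invariant of the boosted network -/

section control

variable (B : Boost)

/-- The number of tokens left in the block after `t` tokens. -/
def ctlJ : ℕ → ℕ
  | 0 => B.J0
  | t + 1 => if ctlJ t = 1 then B.k else ctlJ t - 1

/-- The number of tokens left in the text after `t` tokens. -/
def ctlR : ℕ → ℕ
  | 0 => B.R0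
  | t + 1 => ctlR t - B.dec

/-- Whether the block after `t` tokens is boosted. -/
def ctlg : ℕ → ℕ
  | 0 => B.g0
  | t + 1 => if B.ctlJ t = 1 then 1 else ctlg t

end control

lemma clip_nonneg (x : ℝ) : 0 ≤ clip x := le_max_left _ _

lemma clip_le_one (x : ℝ) : clip x ≤ 1 := by
  unfold clip
  refine max_le zero_le_one ?_
  rcases le_total 0 x with h | h
  · rw [max_eq_right h]; linarith [le_max_right 0 (x - 1)]
  · rw [max_eq_left h]; linarith [le_max_left 0 (x - 1)]

variable {B : Boost}

section semantics

variable (hN : 0 < B.N) (s : List (Fin B.N))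

/-- The factor in the weight of the window `W` after its token `i`. -/
noncomputable def fac (W i : ℕ) : ℝ :=
  1 - B.κ * (if B.ctlg s.length = 1 ∧
      i + 1 = B.ctlJ s.length - (B.ctlJ s.length - B.ctlR s.length) then
    clip (B.D.output B.G (s ++ digits hN (i + 1) W)) else 0)

/-- The weight of the first `i` tokens of the window `W`. -/
noncomputable def weight (W : ℕ) : ℕ → ℝ
  | 0 => 1
  | i + 1 => quantize B.F (weight W i *
      (B.Q.output B.F (s ++ digits hN (i + 1) W) * fac hN s W i))

/-- The total weight of the windows before `W` whose first token satisfies `p`. -/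
noncomputable def accum (p : ℕ → Prop) [DecidablePred p] (W : ℕ) : ℝ :=
  ∑ w ∈ Finset.range W, if p (w % B.N) then weight hN s w B.k else 0

/-- The rounded share of the windows whose first token satisfies `p`. -/
noncomputable def share (p : ℕ → Prop) [DecidablePred p] : ℝ :=
  quantize B.F (accum hN s p (B.N ^ B.k) * (1 / (accum hN s (fun _ => True) (B.N ^ B.k) +
    max 0 (1 - 2 ^ B.F * accum hN s (fun _ => True) (B.N ^ B.k)))))

/-- The output of the boosted network. -/
noncomputable def outval (y : ℕ) : ℝ :=
  max 0 (share hN s (fun c => c ≤ y) - share hN s (fun c => c + 1 ≤ y))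

end semantics

/-- The assumptions on the parameters and the simulated networks. -/
structure Valid (B : Boost) (I bQ IQ bD ID : ℝ) : Prop where
  hN : 0 < B.N
  hk : 0 < B.k
  hε : 0 < B.ε
  hεF : B.ε ≤ 1 / 2 ^ B.F
  κ_nonneg : 0 ≤ B.κ
  κ_le : B.κ ≤ 1
  sizeQ : B.Q.HasBitSize B.N bQ IQ B.F
  sizeD : B.D.HasBitSize B.N bD ID B.G
  suffQ : B.Q.HiddenSuffices B.N B.F
  suffD : B.D.HiddenSuffices B.N B.G
  gapQ : ∀ S : B.Q.V → ℝ, (∀ v, FixedPoint IQ B.F (S v)) → ∀ v,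
    0 ≤ (B.Q.f v).eval S ∨ (B.Q.f v).eval S ≤ -(B.ε * 2 ^ 0)
  gapD : ∀ S : B.D.V → ℝ, (∀ v, FixedPoint ID B.G (S v)) → ∀ v,
    0 ≤ (B.D.f v).eval S ∨ (B.D.f v).eval S ≤ -(B.ε * 2 ^ B.s)
  hIQ : IQ ≤ I
  hID : ID ≤ I
  prob : ∀ (s : List (Fin B.N)) (y : Fin B.N), 0 ≤ B.Q.output B.F (s ++ [y]) ∧
    B.Q.output B.F (s ++ [y]) ≤ 1
  -- Sums of weights can reach `N ^ k` and are stored as they are. The next three bounds concern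
  -- counters in units of `2 ^ (-F)`, hence their extra factor.
  pow_le : ((B.N ^ B.k : ℕ) : ℝ) ≤ 2 ^ I
  tau_le : (B.tau : ℝ) ≤ 2 ^ I * 2 ^ B.F
  k_le : (B.k : ℝ) ≤ 2 ^ I * 2 ^ B.F
  R0_le : (B.R0 : ℝ) ≤ 2 ^ I * 2 ^ B.F
  J0_le : B.J0 ≤ B.k
  g0_le : B.g0 ≤ 1

lemma ctlJ_le (h : B.J0 ≤ B.k) (t : ℕ) : B.ctlJ t ≤ B.k := by
  induction t with
  | zero => exact h
  | succ t ih => unfold ctlJ; split_ifs <;> omega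

lemma ctlR_le (t : ℕ) : B.ctlR t ≤ B.R0 := by
  induction t with
  | zero => exact le_rfl
  | succ t ih => unfold ctlR; omega

lemma ctlg_le (h : B.g0 ≤ 1) (t : ℕ) : B.ctlg t ≤ 1 := by
  induction t with
  | zero => exact h
  | succ t ih => unfold ctlg; split_ifs <;> omega

lemma fixedPoint_mono {I I' : ℝ} {F : ℕ} {x : ℝ} (hI : I ≤ I') (h : FixedPoint I F x) :
    FixedPoint I' F x :=
  ⟨h.1.trans (Real.rpow_le_rpow_of_exponent_le one_le_two hI), h.2⟩

lemma fixedPoint_div_two_pow {I : ℝ} {F s : ℕ} {x : ℝ} (h : FixedPoint I F x) :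
    FixedPoint I (F + s) (x / 2 ^ s) := by
  refine ⟨le_trans ?_ h.1, h.onGrid.div_two_pow s⟩
  rw [abs_div, abs_of_pos (by positivity : (0 : ℝ) < 2 ^ s)]
  exact_mod_cast Int.floor_le_floor (div_le_self (abs_nonneg x) (one_le_pow₀ one_le_two))

lemma fixedPoint_coded {I : ℝ} {F n : ℕ} (h : (n : ℝ) ≤ 2 ^ I * 2 ^ F) :
    FixedPoint I F (n / 2 ^ F) := by
  refine fixedPoint_of_abs_le ?_ (onGrid_natCast_div _ _)
  rw [abs_of_nonneg (by positivity)]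
  exact (div_le_iff₀ (by positivity)).2 h

lemma fixedPoint_of_mem {I : ℝ} {F : ℕ} {x c : ℝ} (h : 0 ≤ x) (hx : x ≤ c) (hc : c ≤ 2 ^ I)
    (hg : OnGrid F x) : FixedPoint I F x :=
  fixedPoint_of_abs_le (by rw [abs_of_nonneg h]; exact hx.trans hc) hg

section weights

variable {I bQ IQ bD ID : ℝ} (hB : B.Valid I bQ IQ bD ID) (s : List (Fin B.N))

include hB

lemma fac_mem (W i : ℕ) : 0 ≤ fac hB.hN s W i ∧ fac hB.hN s W i ≤ 1 := by
  have h1 := hB.κ_nonneg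
  have h2 := hB.κ_le
  unfold fac
  split_ifs
  · have h3 := clip_nonneg (B.D.output B.G (s ++ digits hB.hN (i + 1) W))
    have h4 := clip_le_one (B.D.output B.G (s ++ digits hB.hN (i + 1) W))
    constructor <;> nlinarith
  · simp

lemma weight_mem (W i : ℕ) : 0 ≤ weight hB.hN s W i ∧ weight hB.hN s W i ≤ 1 := by
  induction i with
  | zero => simp [weight]
  | succ i ih =>
    have h1 := hB.prob (s ++ digits hB.hN i W) (digit hB.hN (W / B.N ^ i))
    rw [List.append_assoc, ← digits_succ] at h1
    have h2 := fac_mem hB s W i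
    unfold weight
    refine ⟨quantize_nonneg _ (mul_nonneg ih.1 (mul_nonneg h1.1 h2.1)), (quantize_le _ _).trans ?_⟩
    exact mul_le_one₀ ih.2 (mul_nonneg h1.1 h2.1) (mul_le_one₀ h1.2 h2.1 h2.2)

lemma onGrid_weight (W i : ℕ) : OnGrid B.F (weight hB.hN s W i) := by
  cases i with
  | zero => exact onGrid_one _
  | succ i => exact onGrid_quantize _ _

lemma accum_succ (p : ℕ → Prop) [DecidablePred p] (W : ℕ) : accum hB.hN s p (W + 1) =
    accum hB.hN s p W + if p (W % B.N) then weight hB.hN s W B.k else 0 :=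
  Finset.sum_range_succ _ _

lemma accum_mono {p p' : ℕ → Prop} [DecidablePred p] [DecidablePred p'] (h : ∀ c, p c → p' c)
    (W : ℕ) : accum hB.hN s p W ≤ accum hB.hN s p' W := by
  refine Finset.sum_le_sum fun w _ => ?_
  have := (weight_mem hB s w B.k).1
  by_cases h1 : p (w % B.N)
  · simp [h1, h _ h1]
  · simp only [h1, if_false]; split_ifs <;> simp [this]

lemma accum_le (p : ℕ → Prop) [DecidablePred p] (W : ℕ) : accum hB.hN s p W ≤ W := by
  refine (Finset.sum_le_card_nsmul _ _ 1 fun w _ => ?_).trans (by simp)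
  split_ifs
  exacts [(weight_mem hB s w B.k).2, zero_le_one]

lemma onGrid_accum (p : ℕ → Prop) [DecidablePred p] (W : ℕ) : OnGrid B.F (accum hB.hN s p W) := by
  induction W with
  | zero => simpa [accum] using onGrid_zero _
  | succ W ih =>
    rw [accum_succ hB]
    refine ih.add ?_
    split_ifs
    exacts [onGrid_weight hB s _ _, onGrid_zero _]

end weights

/-- Bounds on the registers. -/
structure Bounds (r : B.Regs) : Prop where
  -- These bounds hold at all times, also while a register is stale, because the bit size must never
  -- be exceeded.
  V_le : r.V ≤ B.N ^ B.k
  tok_le : r.tok ≤ B.N ^ B.k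
  fd_le : r.fd ≤ B.N ^ B.k
  P_grid : OnGrid B.F r.P
  P_nonneg : 0 ≤ r.P
  P_le : r.P ≤ 1
  Sa_grid : OnGrid B.F r.Sa
  Sle_grid : OnGrid B.F r.Sle
  Slt_grid : OnGrid B.F r.Slt
  Slt_nonneg : 0 ≤ r.Slt
  Slt_le : r.Slt ≤ r.Sle
  Sle_le : r.Sle ≤ r.Sa
  Sa_le : r.Sa ≤ (B.N ^ B.k : ℕ)
  hi_grid : OnGrid B.F r.hi
  lo_grid : OnGrid B.F r.lo
  out_grid : OnGrid B.F r.out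
  hi_nonneg : 0 ≤ r.hi
  lo_nonneg : 0 ≤ r.lo
  out_nonneg : 0 ≤ r.out
  hi_le : r.hi ≤ 1
  lo_le : r.lo ≤ 1
  out_le : r.out ≤ 1

/-- The registers when the clock is at step `a` of the token `i` of the window `W`, the prefix `s`
has been read before, and `y` is the input token. -/
structure Inv (hN : 0 < B.N) (IQ ID : ℝ) (s : List (Fin B.N)) (y : Fin B.N) (W i a : ℕ)
    (r : B.Regs) : Prop extends Bounds r where
  ra : r.a = a
  ri : r.i = i
  rW : r.W = W
  W_le : W ≤ B.N ^ B.k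
  i_lt : i < B.k
  a_lt : a < B.tau
  U : r.U = W / B.N ^ i
  -- Decoding is a pipeline: `V`, `tok` and `fd` become correct one, two and three steps after `U`.
  V : 1 ≤ a → r.V = r.U / B.N
  tok : 2 ≤ a → r.tok = W / B.N ^ i % B.N
  fd : 1 ≤ i ∨ 3 ≤ a → r.fd = W % B.N
  J : r.J = B.ctlJ s.length
  R : r.R = B.ctlR s.length
  g : r.g = B.ctlg s.length
  simQ : SimInv B.Q IQ B.F hN B.k s y W i a r.HQ r.CQ
  simD : SimInv B.D ID B.G hN B.k s y W i a r.HD r.CD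
  P : ¬ (i = 0 ∧ a = 0) → r.P = weight hN s W (if a ≤ B.T + 2 then i else i + 1)
  S : ¬ (W = 0 ∧ i = 0 ∧ a = 0) → r.Sa = accum hN s (fun _ => True) W ∧
    r.Sle = accum hN s (fun c => c ≤ y) W ∧ r.Slt = accum hN s (fun c => c + 1 ≤ y) W
  -- The sums are final when the extra pass begins, and the quotients follow one step later.
  share : W = B.N ^ B.k → 1 ≤ i ∨ 1 ≤ a →
    r.hi = share hN s (fun c => c ≤ y) ∧ r.lo = share hN s (fun c => c + 1 ≤ y)

namespace Inv

variable {I bQ IQ bD ID : ℝ} (hB : B.Valid I bQ IQ bD ID) {s : List (Fin B.N)} {y : Fin B.N}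
  {W i a : ℕ} {r : B.Regs}

include hB

lemma ok (h : Inv hB.hN IQ ID s y W i a r) : r.Ok y where
  hε := hB.hε
  hεF := hB.hεF
  P := ⟨h.P_grid, h.P_nonneg⟩
  Sa := ⟨h.Sa_grid, h.Slt_nonneg.trans (h.Slt_le.trans h.Sle_le)⟩
  Sle := ⟨h.Sle_grid, h.Slt_nonneg.trans h.Slt_le⟩
  Slt := ⟨h.Slt_grid, h.Slt_nonneg⟩
  hi := h.hi_grid
  lo := h.lo_grid
  simQ := by
    rw [h.ra, h.ri, h.rW]
    exact h.simQ.simOk hB.sizeQ hB.gapQ h.tok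
  simD := by
    rw [h.ra, h.ri, h.rW]
    exact h.simD.simOk hB.sizeD hB.gapD h.tok

/-- All nodes can be stored. -/
lemma fixedPoint (h : Inv hB.hN IQ ID s y W i a r) (v : B.Node) :
    FixedPoint I B.F (r.state y v) := by
  have hpow : ((B.N ^ B.k : ℕ) : ℝ) ≤ 2 ^ I * 2 ^ B.F :=
    hB.pow_le.trans (le_mul_of_one_le_right (by positivity) (one_le_pow₀ one_le_two))
  have h1N : (1 : ℝ) ≤ (B.N ^ B.k : ℕ) := by exact_mod_cast Nat.pow_pos hB.hN
  have h1 : (1 : ℝ) ≤ 2 ^ I := h1N.trans hB.pow_le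
  have hcast {m n : ℕ} {c : ℝ} (hmn : m ≤ n) (hn : (n : ℝ) ≤ c) : (m : ℝ) ≤ c :=
    le_trans (by exact_mod_cast hmn) hn
  rcases v with (v | v | v | v) | (v | v | v | v)
  · cases v
    case a => exact fixedPoint_coded (hcast (h.ra ▸ h.a_lt.le) hB.tau_le)
    case i => exact fixedPoint_coded (hcast (h.ri ▸ h.i_lt.le) hB.k_le)
    case W => exact fixedPoint_coded (hcast (h.rW ▸ h.W_le) hpow)
    case U => exact fixedPoint_coded
                (hcast (h.U ▸ (Nat.div_le_self _ _).trans h.W_le) hpow)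
    case V => exact fixedPoint_coded (hcast h.V_le hpow)
    case tok => exact fixedPoint_of_mem (Nat.cast_nonneg _) (Nat.cast_le.2 h.tok_le) hB.pow_le
                  (onGrid_natCast _ _)
    case fd => exact fixedPoint_of_mem (Nat.cast_nonneg _) (Nat.cast_le.2 h.fd_le) hB.pow_le
                  (onGrid_natCast _ _)
    case J => exact fixedPoint_coded (hcast (h.J ▸ ctlJ_le hB.J0_le _) hB.k_le)
    case R => exact fixedPoint_coded (hcast (h.R ▸ ctlR_le _) hB.R0_le)
    case g => exact fixedPoint_of_mem (Nat.cast_nonneg _)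
                (hcast (h.g ▸ ctlg_le hB.g0_le _) (by simp)) h1 (onGrid_natCast _ _)
  · exact SimInv.fixedPoint_zero
  · exact fixedPoint_mono hB.hIQ (h.simQ.fixedPoint_hid hB.sizeQ v v.2)
  · exact fixedPoint_mono hB.hID
      (fixedPoint_div_two_pow (h.simD.fixedPoint_hid hB.sizeD v v.2))
  · have hy : y.val ≤ B.N ^ B.k := y.2.le.trans (Nat.le_self_pow hB.hk.ne' _)
    have hSle := h.Sle_le.trans h.Sa_le
    have hSlt := h.Slt_le.trans hSle
    cases v
    case inp => exact fixedPoint_of_mem (Nat.cast_nonneg _) (Nat.cast_le.2 hy) hB.pow_le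
                  (onGrid_natCast _ _)
    case P => exact fixedPoint_of_mem h.P_nonneg h.P_le h1 h.P_grid
    case Sa => exact fixedPoint_of_mem (h.Slt_nonneg.trans (h.Slt_le.trans h.Sle_le)) h.Sa_le
                hB.pow_le h.Sa_grid
    case Sle => exact fixedPoint_of_mem (h.Slt_nonneg.trans h.Slt_le) hSle hB.pow_le h.Sle_grid
    case Slt => exact fixedPoint_of_mem h.Slt_nonneg hSlt hB.pow_le h.Slt_grid
    case hi => exact fixedPoint_of_mem h.hi_nonneg h.hi_le h1 h.hi_grid
    case lo => exact fixedPoint_of_mem h.lo_nonneg h.lo_le h1 h.lo_grid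
    case out => exact fixedPoint_of_mem h.out_nonneg h.out_le h1 h.out_grid
  · exact SimInv.fixedPoint_zero
  · exact fixedPoint_mono hB.hIQ (h.simQ.fixed v)
  · exact fixedPoint_mono hB.hID (fixedPoint_div_two_pow (h.simD.fixed v))

end Inv

end Boost

/-! ### Preservation of the invariant by the time steps -/

namespace Boost

variable {B : Boost}

lemma share_aux {x S : ℝ} (hx : 0 ≤ x) (hxS : x ≤ S) :
    0 ≤ quantize B.F (x * (1 / (S + max 0 (1 - 2 ^ B.F * S)))) ∧
      quantize B.F (x * (1 / (S + max 0 (1 - 2 ^ B.F * S)))) ≤ 1 := by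
  have h0 := le_max_left 0 (1 - 2 ^ B.F * S)
  have hS := hx.trans hxS
  refine ⟨quantize_nonneg _ (by positivity), (quantize_le _ _).trans ?_⟩
  rw [mul_one_div]
  exact div_le_one_of_le₀ (by linarith) (by linarith)

lemma mod_eq_sub (m n : ℕ) : m - n * (m / n) = m % n := by
  have := Nat.mod_add_div m n; omega

lemma tau_eq (B : Boost) : B.tau = B.T + 4 := rfl

namespace Inv

variable {I bQ IQ bD ID : ℝ} (hB : B.Valid I bQ IQ bD ID) {s : List (Fin B.N)} {y : Fin B.N}
  {W i a : ℕ} {r : B.Regs}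

include hB

lemma lt_time_add (h : Inv hB.hN IQ ID s y W i a r) (ha : a = B.T + 2 ∨ a + 1 = B.tau) :
    B.Q.time + 1 < a ∧ B.D.time + 1 < a := by
  have h1 : B.Q.time ≤ B.T := le_max_left _ _
  have h2 : B.D.time ≤ B.T := le_max_right _ _
  have := h.a_lt
  have := B.tau_eq
  omega

lemma factor_eq (h : Inv hB.hN IQ ID s y W i a r) (ha : a = B.T + 2) :
    r.factor = fac hB.hN s W i := by
  have h1 := (fac_mem hB s W i).1
  have h2 := h.simD.output_eq hB.suffD (h.tok (by omega)) (h.lt_time_add hB (Or.inl ha)).2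
  unfold fac at h1 ⊢
  rw [Regs.factor, h.g, h.J, h.R, h.ri, h2]
  exact max_eq_right h1

lemma next_P_eq (h : Inv hB.hN IQ ID s y W i a r) : (r.next y).P =
    if i = 0 ∧ a = 0 then 1 else weight hB.hN s W (if a + 1 ≤ B.T + 2 then i else i + 1) := by
  simp only [Regs.next, h.ra, h.ri]
  split_ifs with h1 h2 h3 h3
  · rfl
  · omega
  · have hQ := h.simQ.output_eq hB.suffQ (h.tok (by omega)) (h.lt_time_add hB (Or.inl h2)).1
    have hp := (hB.prob (s ++ digits hB.hN i W) (digit hB.hN (W / B.N ^ i))).1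
    rw [List.append_assoc, ← digits_succ] at hp
    rw [h.factor_eq hB h2, hQ, max_eq_right hp, h.P h1, if_pos (by omega)]
    rfl
  · rw [h.P h1, if_pos (by omega)]
  · rw [h.P h1, if_neg (by omega)]

/-- The bounds are kept. -/
lemma bounds_next (h : Inv hB.hN IQ ID s y W i a r) : Bounds (r.next y) := by
  have hU : r.U ≤ B.N ^ B.k := h.U ▸ (Nat.div_le_self _ _).trans h.W_le
  have hPw := h.next_P_eq hB
  have hP1 : OnGrid B.F (r.next y).P := by
    rw [hPw]; split_ifs
    exacts [onGrid_one _, onGrid_weight hB s _ _, onGrid_weight hB s _ _]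
  have hP2 : 0 ≤ (r.next y).P := by
    rw [hPw]; split_ifs
    exacts [zero_le_one, (weight_mem hB s _ _).1, (weight_mem hB s _ _).1]
  have hP3 : (r.next y).P ≤ 1 := by
    rw [hPw]; split_ifs
    exacts [le_rfl, (weight_mem hB s _ _).2, (weight_mem hB s _ _).2]
  have grid {S : ℝ} (hS : OnGrid B.F S) {p : Prop} [Decidable p] :
      OnGrid B.F (if r.W = 0 ∧ r.i = 0 ∧ r.a = 0 then 0 else S + if p then r.P else 0) := by
    split_ifs
    exacts [onGrid_zero _, hS.add h.P_grid, hS.add (onGrid_zero _)]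
  have hP0 := h.P_nonneg
  have hSlt := h.Slt_nonneg
  have hSlt' := h.Slt_le
  have hSle' := h.Sle_le
  have hsh1 := share_aux (B := B) (hSlt.trans hSlt') hSle'
  have hsh2 := share_aux (B := B) hSlt (hSlt'.trans hSle')
  -- The bound by `N ^ k` alone is not inductive. A summand is added only if `W < N ^ k`, and then
  -- the sum so far is at most `W`.
  have hSa : (r.next y).Sa ≤ (B.N ^ B.k : ℕ) := by
    simp only [Regs.next]
    split_ifs with h1 h2
    · positivity
    · have h3 : ¬ (W = 0 ∧ i = 0 ∧ a = 0) := by rwa [h.rW, h.ri, h.ra] at h1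
      have h4 : W + 1 ≤ B.N ^ B.k := by
        have := h.W_le; have := h.rW ▸ h2.2; omega
      have h5 := accum_le hB s (fun _ => True) W
      have h6 : ((W + 1 : ℕ) : ℝ) ≤ (B.N ^ B.k : ℕ) := Nat.cast_le.2 h4
      have h7 := h.P_le
      rw [(h.S h3).1]
      push_cast at h6 ⊢
      linarith
    · simpa using h.Sa_le
  constructor
  · exact (Nat.div_le_self _ _).trans hU
  · exact (Nat.sub_le _ _).trans hU
  · simp only [Regs.next]; split_ifs
    exacts [h.tok_le, h.fd_le]
  · exact hP1
  · exact hP2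
  · exact hP3
  · exact grid h.Sa_grid
  · exact grid h.Sle_grid
  · exact grid h.Slt_grid
  · simp only [Regs.next]; split_ifs <;> linarith
  · simp only [Regs.next]
    by_cases h1 : r.W = 0 ∧ r.i = 0 ∧ r.a = 0
    · simp [h1]
    · simp only [h1, if_false]
      by_cases h2 : ((r.a = B.tau - 1 ∧ r.i = B.k - 1) ∧ ¬ r.W = B.N ^ B.k) ∧ r.fd + 1 ≤ y
      · rw [if_pos h2, if_pos ⟨h2.1, by omega⟩]; linarith
      · rw [if_neg h2]; split_ifs <;> linarith
  · simp only [Regs.next]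
    by_cases h1 : r.W = 0 ∧ r.i = 0 ∧ r.a = 0
    · simp [h1]
    · simp only [h1, if_false]
      by_cases h2 : (r.a = B.tau - 1 ∧ r.i = B.k - 1) ∧ ¬ r.W = B.N ^ B.k
      · rw [if_pos h2]; split_ifs <;> linarith
      · rw [if_neg h2, if_neg fun h => h2 h.1]; linarith
  · exact hSa
  · exact onGrid_quantize _ _
  · exact onGrid_quantize _ _
  · exact (h.hi_grid.sub h.lo_grid).max_zero
  · exact hsh1.1
  · exact hsh2.1
  · exact le_max_left _ _
  · exact hsh1.2
  · exact hsh2.2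
  · have := h.hi_le; have := h.lo_nonneg
    exact max_le zero_le_one (by linarith)

lemma share_next (h : Inv hB.hN IQ ID s y W i a r) (hW : W = B.N ^ B.k) :
    (r.next y).hi = Boost.share hB.hN s (fun c => c ≤ y) ∧
      (r.next y).lo = Boost.share hB.hN s (fun c => c + 1 ≤ y) := by
  have hpos : 0 < B.N ^ B.k := Nat.pow_pos hB.hN
  obtain ⟨h1, h2, h3⟩ := h.S (by omega)
  subst hW
  exact ⟨by simp only [Regs.next, h1, h2, Boost.share], by simp only [Regs.next, h1, h3, Boost.share]⟩

lemma out_next (h : Inv hB.hN IQ ID s y W i a r) (hW : W = B.N ^ B.k) (hia : 1 ≤ i ∨ 1 ≤ a) :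
    (r.next y).out = outval hB.hN s y := by
  obtain ⟨h1, h2⟩ := h.share hW hia
  simp only [Regs.next, h1, h2, outval]

lemma S_next_of_not_end (h : Inv hB.hN IQ ID s y W i a r)
    (hend : ¬ (a = B.tau - 1 ∧ i = B.k - 1)) :
    (r.next y).Sa = accum hB.hN s (fun _ => True) W ∧
    (r.next y).Sle = accum hB.hN s (fun c => c ≤ y) W ∧
    (r.next y).Slt = accum hB.hN s (fun c => c + 1 ≤ y) W := by
  simp only [Regs.next, h.ra, h.ri, h.rW, hend, false_and, if_false, add_zero]
  by_cases h0 : W = 0 ∧ i = 0 ∧ a = 0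
  · simp only [h0, and_self, if_true, accum, Finset.range_zero, Finset.sum_empty]
  · simp only [h0, if_false]; exact h.S h0

lemma ctl_next_of_not_end (h : Inv hB.hN IQ ID s y W i a r)
    (hend : ¬ ((a = B.tau - 1 ∧ i = B.k - 1) ∧ W = B.N ^ B.k)) :
    (r.next y).J = B.ctlJ s.length ∧ (r.next y).R = B.ctlR s.length ∧
    (r.next y).g = B.ctlg s.length := by
  simp only [Regs.next, h.ra, h.ri, h.rW, hend, if_false]
  exact ⟨h.J, h.R, h.g⟩

/-- A step within the time of a token of a window. -/
lemma next_step (h : Inv hB.hN IQ ID s y W i a r) (ha : a + 1 < B.tau) :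
    Inv hB.hN IQ ID s y W i (a + 1) (r.next y) := by
  obtain ⟨rfl, rfl, rfl⟩ : r.a = a ∧ r.i = i ∧ r.W = W := ⟨h.ra, h.ri, h.rW⟩
  have ht := B.tau_eq
  have hN : 0 < B.N ^ B.k := Nat.pow_pos hB.hN
  exact {
    toBounds := h.bounds_next hB
    ra := by simp only [Regs.next]; rw [if_neg (by omega)]
    ri := by simp only [Regs.next]; rw [if_neg (by omega)]
    rW := by simp only [Regs.next]; rw [if_neg (by omega)]
    W_le := h.W_le
    i_lt := h.i_lt
    a_lt := ha
    U := by simp only [Regs.next]; rw [if_neg (by omega), h.U]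
    V _ := by simp only [Regs.next]; rw [if_neg (by omega)]
    tok h2 := by
      simp only [Regs.next]; rw [h.V (by omega), mod_eq_sub, h.U]
    fd h3 := by
      simp only [Regs.next]
      split_ifs with hi
      · rw [h.tok (by omega), hi, pow_zero, Nat.div_one]
      · exact h.fd (by omega)
    J := (h.ctl_next_of_not_end hB (by omega)).1
    R := (h.ctl_next_of_not_end hB (by omega)).2.1
    g := (h.ctl_next_of_not_end hB (by omega)).2.2
    simQ := h.simQ.next_step hB.sizeQ h.tok
    simD := h.simD.next_step hB.sizeD h.tok
    P _ := by
      rw [h.next_P_eq hB]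
      split_ifs <;> first | rfl | (simp only [*]; rfl) | omega
    S _ := h.S_next_of_not_end hB (by omega)
    share hW _ := h.share_next hB hW }

/-- The last step of a token, but not of a window. -/
lemma next_token (h : Inv hB.hN IQ ID s y W i a r) (ha : a + 1 = B.tau) (hi : i + 1 < B.k) :
    Inv hB.hN IQ ID s y W (i + 1) 0 (r.next y) := by
  obtain ⟨rfl, rfl, rfl⟩ : r.a = a ∧ r.i = i ∧ r.W = W := ⟨h.ra, h.ri, h.rW⟩
  have ht := B.tau_eq
  have hN : 0 < B.N ^ B.k := Nat.pow_pos hB.hN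
  exact {
    toBounds := h.bounds_next hB
    ra := by simp only [Regs.next]; rw [if_pos (by omega)]
    ri := by simp only [Regs.next]; rw [if_pos (by omega), if_neg (by omega)]
    rW := by simp only [Regs.next]; rw [if_neg (by omega)]
    W_le := h.W_le
    i_lt := hi
    a_lt := by omega
    U := by
      simp only [Regs.next]
      rw [if_pos (by omega), if_neg (by omega), h.V (by omega), h.U, Nat.div_div_eq_div_mul, pow_succ]
    V h1 := by omega
    tok h1 := by omega
    fd _ := by
      simp only [Regs.next]
      split_ifs with hi
      · rw [h.tok (by omega), hi, pow_zero, Nat.div_one]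
      · exact h.fd (by omega)
    J := (h.ctl_next_of_not_end hB (by omega)).1
    R := (h.ctl_next_of_not_end hB (by omega)).2.1
    g := (h.ctl_next_of_not_end hB (by omega)).2.2
    simQ := h.simQ.next_token hB.sizeQ h.tok (h.lt_time_add hB (Or.inr ha)).1
    simD := h.simD.next_token hB.sizeD h.tok (h.lt_time_add hB (Or.inr ha)).2
    P _ := by
      rw [h.next_P_eq hB, if_neg (by omega), if_neg (by omega), if_pos (by omega)]
    S _ := h.S_next_of_not_end hB (by omega)
    share hW _ := h.share_next hB hW }

/-- The last step of a window. -/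
lemma next_window (h : Inv hB.hN IQ ID s y W i a r) (ha : a + 1 = B.tau) (hi : i + 1 = B.k)
    (hW : W < B.N ^ B.k) : Inv hB.hN IQ ID s y (W + 1) 0 0 (r.next y) := by
  obtain ⟨rfl, rfl, rfl⟩ : r.a = a ∧ r.i = i ∧ r.W = W := ⟨h.ra, h.ri, h.rW⟩
  have ht := B.tau_eq
  have hN : 0 < B.N ^ B.k := Nat.pow_pos hB.hN
  exact {
    toBounds := h.bounds_next hB
    ra := by simp only [Regs.next]; rw [if_pos (by omega)]
    ri := by simp only [Regs.next]; rw [if_pos (by omega), if_pos (by omega)]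
    rW := by simp only [Regs.next]; rw [if_pos (by omega), if_neg (by omega)]
    W_le := hW
    i_lt := hB.hk
    a_lt := by omega
    U := by
      simp only [Regs.next]
      rw [if_pos (by omega), if_pos (by omega), if_neg (by omega), pow_zero, Nat.div_one]
    V h1 := by omega
    tok h1 := by omega
    fd h1 := by omega
    J := (h.ctl_next_of_not_end hB (by omega)).1
    R := (h.ctl_next_of_not_end hB (by omega)).2.1
    g := (h.ctl_next_of_not_end hB (by omega)).2.2
    simQ := h.simQ.next_window hB.sizeQ h.tok hW
    simD := h.simD.next_window hB.sizeD h.tok hW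
    P h0 := absurd ⟨rfl, rfl⟩ h0
    S _ := by
      obtain ⟨h1, h2, h3⟩ := h.S (by omega)
      have hP := h.P (by omega)
      rw [if_neg (by omega), hi] at hP
      have hend : (r.a = B.tau - 1 ∧ r.i = B.k - 1) ∧ ¬ r.W = B.N ^ B.k := by omega
      have hfirst : ¬ (r.W = 0 ∧ r.i = 0 ∧ r.a = 0) := by omega
      simp only [Regs.next, if_neg hfirst, if_pos hend, h1, h2, h3, hP, accum_succ hB, if_true,
        h.fd (by omega), and_iff_right hend, and_self]
    share hW' := by omega }

/-- The last step. -/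
lemma next_input (h : Inv hB.hN IQ ID s y W i a r) (ha : a + 1 = B.tau) (hi : i + 1 = B.k)
    (hW : W = B.N ^ B.k) (y' : Fin B.N) : Inv hB.hN IQ ID (s ++ [y]) y' 0 0 0 (r.next y) := by
  obtain ⟨rfl, rfl, rfl⟩ : r.a = a ∧ r.i = i ∧ r.W = W := ⟨h.ra, h.ri, h.rW⟩
  have ht := B.tau_eq
  have hN : 0 < B.N ^ B.k := Nat.pow_pos hB.hN
  exact {
    toBounds := h.bounds_next hB
    ra := by simp only [Regs.next]; rw [if_pos (by omega)]
    ri := by simp only [Regs.next]; rw [if_pos (by omega), if_pos (by omega)]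
    rW := by simp only [Regs.next]; rw [if_pos (by omega), if_pos (by omega)]
    W_le := Nat.zero_le _
    i_lt := hB.hk
    a_lt := by omega
    U := by
      simp only [Regs.next]
      rw [if_pos (by omega), if_pos (by omega), if_pos (by omega), pow_zero, Nat.zero_div]
    V h1 := by omega
    tok h1 := by omega
    fd h1 := by omega
    J := by
      simp only [Regs.next, h.J]
      rw [if_pos (by omega), List.length_append, List.length_singleton, ctlJ]
    R := by
      simp only [Regs.next, h.R]
      rw [if_pos (by omega), List.length_append, List.length_singleton, ctlR]
    g := by
      simp only [Regs.next, h.J, h.g]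
      rw [if_pos (by omega), List.length_append, List.length_singleton, ctlg]
    simQ := h.simQ.next_input hB.sizeQ h.tok hW (h.lt_time_add hB (Or.inr ha)).1 y'
    simD := h.simD.next_input hB.sizeD h.tok hW (h.lt_time_add hB (Or.inr ha)).2 y'
    P h0 := absurd ⟨rfl, rfl⟩ h0
    S h0 := absurd ⟨rfl, rfl, rfl⟩ h0
    share hW' := by omega }

end Inv

end Boost

namespace Boost

variable {B : Boost}

/-! ### Runs of the boosted network -/

section runs

variable {I bQ IQ bD ID : ℝ} (hB : B.Valid I bQ IQ bD ID) {s : List (Fin B.N)} {y : Fin B.N}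
  {r : B.Regs}

include hB

/-- The invariant holds at all times. -/
lemma exists_inv (h : Inv hB.hN IQ ID s y 0 0 0 r) (t : ℕ)
    (ht : t < (B.N ^ B.k + 1) * B.k * B.tau) :
    ∃ W i a, t = (W * B.k + i) * B.tau + a ∧
      Inv hB.hN IQ ID s y W i a ((fun r : B.Regs => r.next y)^[t] r) := by
  induction t with
  | zero => exact ⟨0, 0, 0, by simp, h⟩
  | succ t ih =>
    obtain ⟨W, i, a, hta, hI⟩ := ih (by omega)
    rw [Function.iterate_succ_apply']
    have h1 := hI.a_lt
    have h2 := hI.i_lt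
    have h3 := hI.W_le
    by_cases ha : a + 1 < B.tau
    · exact ⟨W, i, a + 1, by omega, hI.next_step hB ha⟩
    have ha : a + 1 = B.tau := by omega
    by_cases hi : i + 1 < B.k
    · exact ⟨W, i + 1, 0, by rw [hta, ← add_assoc, add_mul _ 1]; omega, hI.next_token hB ha hi⟩
    have hi : i + 1 = B.k := by omega
    have ht' : t + 1 = (W + 1) * B.k * B.tau := by
      rw [hta, add_assoc _ a, ha, ← Nat.succ_mul, Nat.succ_eq_add_one, add_assoc, hi, ← Nat.succ_mul]
    have hW : W < B.N ^ B.k := by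
      refine lt_of_le_of_ne h3 fun hW => ?_
      subst hW; omega
    exact ⟨W + 1, 0, 0, by rw [ht']; ring, hI.next_window hB ha hi hW⟩

/-- The state after a token has been read. -/
lemma inv_final (h : Inv hB.hN IQ ID s y 0 0 0 r) :
    (∀ y', Inv hB.hN IQ ID (s ++ [y]) y' 0 0 0
      ((fun r : B.Regs => r.next y)^[(B.N ^ B.k + 1) * B.k * B.tau] r)) ∧
    ((fun r : B.Regs => r.next y)^[(B.N ^ B.k + 1) * B.k * B.tau] r).out = outval hB.hN s y := by
  have hk := hB.hk
  have hpos : 0 < (B.N ^ B.k + 1) * B.k * B.tau := by positivity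
  obtain ⟨t, ht⟩ : ∃ t, (B.N ^ B.k + 1) * B.k * B.tau = t + 1 :=
    Nat.exists_eq_add_of_le' hpos
  obtain ⟨W, i, a, hta, hI⟩ := exists_inv hB h t (by omega)
  rw [ht, Function.iterate_succ_apply']
  have h1 := hI.a_lt
  have h2 := hI.i_lt
  have h3 := hI.W_le
  -- The step is the last one of the token, which forces each of the three clock digits `a`, `i`,
  -- `W` to be maximal.
  have hmul : (W * B.k + i + 1) * B.tau ≤ (B.N ^ B.k + 1) * B.k * B.tau := by
    refine Nat.mul_le_mul_right _ ?_
    have := Nat.mul_le_mul_right B.k h3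
    rw [Nat.succ_mul]; omega
  have ha : a + 1 = B.tau := by
    rw [Nat.succ_mul] at hmul; omega
  have heq : W * B.k + i + 1 = (B.N ^ B.k + 1) * B.k := by
    have : 0 < B.tau := by omega
    refine Nat.eq_of_mul_eq_mul_right this ?_
    rw [ht, hta, Nat.succ_mul]; omega
  have hW : W = B.N ^ B.k := by
    refine le_antisymm h3 (not_lt.1 fun hlt => ?_)
    have := Nat.mul_le_mul_right B.k (Nat.succ_le_of_lt hlt)
    rw [Nat.succ_mul] at this heq
    omega
  have hi : i + 1 = B.k := by
    rw [hW, Nat.succ_mul] at heq; omega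
  exact ⟨hI.next_input hB ha hi hW, hI.out_next hB hW (by have := B.tau_eq; omega)⟩

lemma iterate_step (h : Inv hB.hN IQ ID s y 0 0 0 r) (t : ℕ)
    (ht : t ≤ (B.N ^ B.k + 1) * B.k * B.tau) :
    ((B.net hB.hN hB.hk).step B.F)^[t] (r.state y) =
      ((fun r : B.Regs => r.next y)^[t] r).state y := by
  induction t with
  | zero => rfl
  | succ t ih =>
    obtain ⟨W, i, a, -, hI⟩ := exists_inv hB h t (by omega)
    have hs := (Regs.step_state hB.hN hB.hk (hI.ok hB)).1
    refine (Function.iterate_succ_apply' _ _ _).trans ?_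
    rw [ih (by omega), Function.iterate_succ_apply']
    exact hs

/-- The state of the network after the string `s` has been read. -/
def Ready (s : List (Fin B.N)) (S : B.Node → ℝ) : Prop :=
  -- The same registers serve every next token `y`, since nothing has been read from the input node
  -- yet.
  ∃ (r : B.Regs) (x : ℝ), S = r.state x ∧ ∀ y, Inv hB.hN IQ ID s y 0 0 0 r

lemma ready_process {S : B.Node → ℝ} (h : Ready hB s S) (y : Fin B.N) :
    Ready hB (s ++ [y]) ((B.net hB.hN hB.hk).process B.F S y) ∧
      (B.net hB.hN hB.hk).process B.F S y (B.net hB.hN hB.hk).out = outval hB.hN s y := by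
  obtain ⟨r, x, rfl, hr⟩ := h
  have h1 := iterate_step hB (hr y) _ le_rfl
  have h2 := inv_final hB (hr y)
  have h3 : (B.net hB.hN hB.hk).process B.F (r.state x) y =
      ((fun r : B.Regs => r.next y)^[(B.N ^ B.k + 1) * B.k * B.tau] r).state y :=
    (congrArg _ (Regs.feed_state hB.hN hB.hk r x y)).trans h1
  exact ⟨⟨_, _, h3, h2.1⟩, (congrFun h3 _).trans h2.2⟩

lemma ready_runFrom {S : B.Node → ℝ} (h : Ready hB s S) (u : List (Fin B.N)) :
    Ready hB (s ++ u) ((B.net hB.hN hB.hk).runFrom B.F S u) := by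
  induction u using List.reverseRecOn with
  | nil => rw [List.append_nil]; exact h
  | append_singleton u y ih =>
    have := (ready_process hB ih y).1
    rw [List.append_assoc] at this
    exact (RNN.runFrom_append (B.net hB.hN hB.hk) B.F S u y).symm ▸ this

lemma copyInit_fixedPoint {R : RNN} {b I : ℝ} {G : ℕ} (hR : R.HasBitSize B.N b I G) (v : R.V) :
    FixedPoint I G (if v = R.inp then 0 else R.init v) := by
  split_ifs with h
  exacts [SimInv.fixedPoint_zero, SimInv.fixedPoint_init hR hB.hN h]

/-- Resetting the registers that are not hidden. -/
lemma inv_reset (h : Inv hB.hN IQ ID s y 0 0 0 r) : Inv hB.hN IQ ID s y 0 0 0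
    { r with
      P := 0, Sa := 0, Sle := 0, Slt := 0, hi := 0, lo := 0, out := 0
      CQ := fun v => if v = B.Q.inp then 0 else B.Q.init v
      CD := fun v => if v = B.D.inp then 0 else B.D.init v } :=
  { h with
    P_grid := onGrid_zero _, Sa_grid := onGrid_zero _, Sle_grid := onGrid_zero _
    Slt_grid := onGrid_zero _, hi_grid := onGrid_zero _, lo_grid := onGrid_zero _
    out_grid := onGrid_zero _, P_nonneg := le_rfl, Slt_nonneg := le_rfl, Slt_le := le_rfl
    Sle_le := le_rfl, Sa_le := Nat.cast_nonneg _, hi_nonneg := le_rfl, lo_nonneg := le_rfl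
    out_nonneg := le_rfl, P_le := zero_le_one, hi_le := zero_le_one, lo_le := zero_le_one
    out_le := zero_le_one
    simQ := ⟨h.simQ.hid, copyInit_fixedPoint hB hB.sizeQ, fun h0 => absurd ⟨rfl, rfl⟩ h0⟩
    simD := ⟨h.simD.hid, copyInit_fixedPoint hB hB.sizeD, fun h0 => absurd ⟨rfl, rfl⟩ h0⟩
    P := fun h0 => absurd ⟨rfl, rfl⟩ h0
    S := fun h0 => absurd ⟨rfl, rfl, rfl⟩ h0
    share := fun _ h0 => absurd h0 (by simp) }

lemma ready_init : Ready hB [] (B.net hB.hN hB.hk).init := by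
  refine ⟨B.regs0, 0, rfl, fun y => ?_⟩
  have hid {R : RNN} {b I : ℝ} {G : ℕ} (hR : R.HasBitSize B.N b I G) :
      SimInv R I G hB.hN B.k [] y 0 0 0 R.init (fun v => if v = R.inp then 0 else R.init v) := by
    refine ⟨fun v hv => ?_, copyInit_fixedPoint hB hR, fun h0 => absurd ⟨rfl, rfl⟩ h0⟩
    simp only [Nat.zero_sub, if_true, Nat.zero_min, ite_self]
    rw [RNN.config_zero _ _ _ _ _ (SimInv.ne_inp_of_mem_hid hv), RNN.restart_nil]; rfl
  exact {
    V_le := Nat.zero_le _, tok_le := Nat.zero_le _, fd_le := Nat.zero_le _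
    P_grid := onGrid_zero _, Sa_grid := onGrid_zero _, Sle_grid := onGrid_zero _
    Slt_grid := onGrid_zero _, hi_grid := onGrid_zero _, lo_grid := onGrid_zero _
    out_grid := onGrid_zero _, P_nonneg := le_rfl, Slt_nonneg := le_rfl, Slt_le := le_rfl
    Sle_le := le_rfl, Sa_le := Nat.cast_nonneg _, hi_nonneg := le_rfl, lo_nonneg := le_rfl
    out_nonneg := le_rfl, P_le := zero_le_one, hi_le := zero_le_one, lo_le := zero_le_one
    out_le := zero_le_one
    ra := rfl, ri := rfl, rW := rfl, W_le := Nat.zero_le _, i_lt := hB.hk, a_lt := Nat.succ_pos _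
    U := (Nat.zero_div _).symm, V := fun h => by omega, tok := fun h => by omega
    fd := fun h => by omega, J := rfl, R := rfl, g := rfl
    simQ := hid hB.sizeQ
    simD := hid hB.sizeD
    P := fun h0 => absurd ⟨rfl, rfl⟩ h0
    S := fun h0 => absurd ⟨rfl, rfl, rfl⟩ h0
    share := fun _ h0 => absurd h0 (by simp) }

/-- At clock zero the invariant asks only for bounds on the registers outside the hidden nodes, so
resetting them is harmless. Both the sufficiency of the hidden nodes and the bit size of resumed
runs rest on this. -/
lemma ready_restart (s : List (Fin B.N)) :
    Ready hB s ((B.net hB.hN hB.hk).restart B.F s) := by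
  obtain ⟨r, x, hS, hr⟩ := ready_runFrom hB (ready_init hB) s
  refine ⟨_, 0, ?_, fun y => inv_reset hB (hr y)⟩
  ext v
  change B.Node at v
  by_cases hv : v ∈ (B.net hB.hN hB.hk).hid
  · refine (if_pos hv).trans ((congrFun hS v).trans ?_)
    obtain ⟨v, -, rfl⟩ := Finset.mem_map.1 hv
    rcases v with v | v | v | v <;> rfl
  · refine (if_neg hv).trans ?_
    rcases v with v | v | v | v | v
    · exact absurd (Finset.mem_map_of_mem _ (Finset.mem_univ v)) hv
    · cases v <;> rfl
    all_goals rfl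

/-- The output of the boosted network. -/
lemma output_net (s : List (Fin B.N)) (y : Fin B.N) :
    (B.net hB.hN hB.hk).output B.F (s ++ [y]) = outval hB.hN s y := by
  have := (ready_process hB (ready_runFrom hB (ready_init hB) s) y).2
  rw [RNN.output, RNN.runFrom_append]; exact this

lemma hiddenSuffices_net : (B.net hB.hN hB.hk).HiddenSuffices B.N B.F := by
  intro s u hu
  obtain ⟨u, y, rfl⟩ := (List.eq_nil_or_concat' u).resolve_left hu
  rw [← List.append_assoc, output_net hB, RNN.runFrom_append]
  exact (ready_process hB (ready_runFrom hB (ready_restart hB s) u) y).2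

lemma hasBitSize_net : (B.net hB.hN hB.hk).HasBitSize B.N (1 + I + B.F) I B.F := by
  refine ⟨by simp, fun s u x => ?_⟩
  obtain ⟨r, x', hS, hr⟩ := ready_runFrom hB (ready_restart hB s) u
  have hc (j : ℕ) (hj : j ≤ (B.N ^ B.k + 1) * B.k * B.tau) :
      (B.net hB.hN hB.hk).config B.F s u x j =
        ((fun r : B.Regs => r.next x)^[j] r).state x := by
    refine Eq.trans ?_ (iterate_step hB (hr x) j hj)
    refine congrArg ((B.net hB.hN hB.hk).step B.F)^[j] ?_
    rw [hS]; exact Regs.feed_state hB.hN hB.hk r x' x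
  constructor
  · intro j hj v
    rw [hc j hj]
    rcases (show j ≤ (B.N ^ B.k + 1) * B.k * B.tau from hj).lt_or_eq with hj | rfl
    · obtain ⟨W, i, a, -, hI⟩ := exists_inv hB (hr x) j hj
      exact hI.fixedPoint hB v
    · have h := (inv_final hB (hr x)).1 x
      exact h.fixedPoint hB v
  · intro j hj v hv
    rw [hc j (le_of_lt hj)]
    obtain ⟨W, i, a, -, hI⟩ := exists_inv hB (hr x) j hj
    exact (Regs.step_state hB.hN hB.hk (hI.ok hB)).2 v hv

end runs

end Boost

/-! ### Expected values of the continuation -/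

namespace LangModel

variable {N : ℕ} (q : LangModel N)

/-- The expected value of `φ` at the string that extends `s` by `m` tokens drawn from `q`. -/
def look : ℕ → (List (Fin N) → ℝ) → List (Fin N) → ℝ
  | 0, φ, s => φ s
  | m + 1, φ, s => ∑ y, q.prob s y * look m φ (s ++ [y])

lemma look_congr {m : ℕ} {φ ψ : List (Fin N) → ℝ} {s : List (Fin N)}
    (h : ∀ u : List (Fin N), u.length = m → φ (s ++ u) = ψ (s ++ u)) :
    q.look m φ s = q.look m ψ s := by
  induction m generalizing s with
  | zero => simpa [look] using h [] rfl
  | succ m ih =>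
    refine Finset.sum_congr rfl fun y _ => ?_
    rw [ih fun u hu => ?_]
    simpa using h (y :: u) (by simp [hu])

lemma look_const (m : ℕ) (c : ℝ) (s : List (Fin N)) : q.look m (fun _ => c) s = c := by
  induction m generalizing s with
  | zero => rfl
  | succ m ih => simp only [look, ih, ← Finset.sum_mul, q.sum_one, one_mul]

lemma look_mono {m : ℕ} {φ ψ : List (Fin N) → ℝ} (h : ∀ x, φ x ≤ ψ x) (s : List (Fin N)) :
    q.look m φ s ≤ q.look m ψ s := by
  induction m generalizing s with
  | zero => exact h s
  | succ m ih =>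
    exact Finset.sum_le_sum fun y _ => mul_le_mul_of_nonneg_left (ih _) (q.nonneg _ _)

lemma look_one_sub_mul (m : ℕ) (κ : ℝ) (φ : List (Fin N) → ℝ) (s : List (Fin N)) :
    q.look m (fun x => 1 - κ * φ x) s = 1 - κ * q.look m φ s := by
  induction m generalizing s with
  | zero => rfl
  | succ m ih =>
    simp only [look, ih, mul_sub, Finset.sum_sub_distrib, mul_one, q.sum_one, Finset.mul_sum]
    congr 1
    exact Finset.sum_congr rfl fun y _ => by ring

/-- The tokens after the first `L` integrate out, since next-token probabilities sum to one. -/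
lemma look_take {L m : ℕ} (h : L ≤ m) (φ : List (Fin N) → ℝ) (s : List (Fin N)) :
    q.look m (fun x => φ (x.take (s.length + L))) s = q.look L φ s := by
  induction L generalizing m s with
  | zero =>
    rw [q.look_congr (ψ := fun _ => φ s) fun u _ => by simp, look_const]; rfl
  | succ L ih =>
    obtain ⟨m, rfl⟩ := Nat.exists_eq_add_of_le' h
    refine Finset.sum_congr rfl fun y _ => ?_
    rw [← ih (by omega : L ≤ m + L)]
    simp [add_comm, add_left_comm]

lemma look_mem {m : ℕ} {φ : List (Fin N) → ℝ} {a b : ℝ} (h : ∀ x, a ≤ φ x ∧ φ x ≤ b)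
    (s : List (Fin N)) : a ≤ q.look m φ s ∧ q.look m φ s ≤ b :=
  ⟨by simpa [look_const] using q.look_mono (m := m) (fun x => (h x).1) s,
    by simpa [look_const] using q.look_mono (m := m) (fun x => (h x).2) s⟩

end LangModel

/-! ### Prefixes and conditional expectations -/

section prefixes

variable {n N : ℕ}

lemma length_textPrefix (x : Fin n → Fin N) (m : ℕ) : (textPrefix x m).length = min m n := by
  simp [textPrefix]

lemma textPrefix_succ (x : Fin n → Fin N) (i : Fin n) :
    textPrefix x (i + 1) = textPrefix x i ++ [x i] := by
  unfold textPrefix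
  rw [List.take_add_one]
  simp

lemma textPrefix_congr {x y : Fin n → Fin N} {m : ℕ} (h : ∀ j : Fin n, j.val < m → x j = y j) :
    textPrefix x m = textPrefix y m := by
  refine List.ext_getElem (by simp [length_textPrefix]) fun i h1 h2 => ?_
  rw [length_textPrefix] at h1
  simpa [textPrefix] using h ⟨i, by omega⟩ (by simp; omega)

lemma textPrefix_of_le (x : Fin n → Fin N) {m : ℕ} (h : n ≤ m) : textPrefix x m = List.ofFn x := by
  rw [textPrefix, List.take_of_length_le (by simpa using h)]

variable (q : LangModel N)

/-- The probability of the first `i` tokens of a text. -/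
noncomputable def LangModel.prefixProb (i : ℕ) (y : Fin n → Fin N) : ℝ :=
  ∏ j : Fin n, if j.val < i then q.prob (textPrefix y j) (y j) else 1

lemma prefixProb_update {i : Fin n} (y : Fin n → Fin N) (c : Fin N) :
    q.prefixProb (i + 1) (Function.update y i c) =
      q.prefixProb i y * q.prob (textPrefix y i) c := by
  have hpre (j : Fin n) (hj : j.val ≤ i) :
      textPrefix (Function.update y i c) j = textPrefix y j :=
    textPrefix_congr fun a ha => Function.update_of_ne (by intro h; subst h; omega) _ _
  unfold LangModel.prefixProb
  rw [← Finset.mul_prod_erase _ _ (Finset.mem_univ i),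
    ← Finset.mul_prod_erase (a := i) _ (fun j : Fin n => if j.val < i then _ else (1 : ℝ))
      (Finset.mem_univ i)]
  rw [if_pos (by omega), if_neg (by omega), one_mul, hpre i le_rfl, Function.update_self, mul_comm]
  congr 1
  refine Finset.prod_congr rfl fun j hj => ?_
  have hj : j ≠ i := (Finset.mem_erase.1 hj).1
  have hj' : j.val ≠ i.val := fun h => hj (Fin.ext h)
  by_cases h : j.val < i
  · rw [if_pos (by omega), if_pos h, hpre j (by omega), Function.update_of_ne hj]
  · rw [if_neg (by omega), if_neg h]

/-- Summing over the texts with a given prefix. -/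
lemma sum_prefix (G : List (Fin N) → ℝ) (m i : ℕ) (h : i + m = n) (y : Fin n → Fin N) :
    (∑ x with ∀ j : Fin n, j.val < i → x j = y j, q.textProb x * G (List.ofFn x)) =
      q.prefixProb i y * q.look m G (textPrefix y i) := by
  induction m generalizing i y with
  | zero =>
    have : Finset.univ.filter (fun x : Fin n → Fin N => ∀ j : Fin n, j.val < i → x j = y j) =
        {y} := by
      ext x
      simp only [Finset.mem_filter, Finset.mem_univ, true_and, Finset.mem_singleton]
      exact ⟨fun h' => funext fun j => h' j (by omega), fun h' j _ => h' ▸ rfl⟩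
    rw [this, Finset.sum_singleton, LangModel.look, textPrefix_of_le y (by omega)]
    congr 1
    refine Finset.prod_congr rfl fun j _ => ?_
    rw [if_pos (by omega)]
  | succ m ih =>
    set i' : Fin n := ⟨i, by omega⟩ with hi'
    rw [← Finset.sum_fiberwise _ (fun x => x i'), LangModel.look, Finset.mul_sum]
    refine Finset.sum_congr rfl fun c _ => ?_
    have h1 := ih (i + 1) (by omega) (Function.update y i' c)
    have hpre : textPrefix (Function.update y i' c) i' = textPrefix y i' :=
      textPrefix_congr fun a ha =>
        Function.update_of_ne (by rintro rfl; exact absurd ha (lt_irrefl _)) _ _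
    have h2 := textPrefix_succ (Function.update y i' c) i'
    rw [Function.update_self, hpre] at h2
    have h3 := prefixProb_update q (i := i') y c
    simp only [hi'] at h2 h3
    rw [h2, h3, mul_assoc] at h1
    rw [← h1]
    refine Finset.sum_congr ?_ fun _ _ => rfl
    ext x
    simp only [Finset.mem_filter, Finset.mem_univ, true_and]
    constructor
    · rintro ⟨h1, h2⟩ j hj
      by_cases hji : j = i'
      · subst hji; simpa using h2
      · rw [Function.update_of_ne hji]
        exact h1 j (lt_of_le_of_ne (by omega) fun h => hji (Fin.ext h))
    · intro h1
      refine ⟨fun j hj => ?_, by simpa using h1 i' (by simp [hi'])⟩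
      rw [h1 j (by omega), Function.update_of_ne (by intro h; subst h; simp [hi'] at hj)]

lemma prefixProb_pos (hq : ∀ s y, 0 < q.prob s y) (i : ℕ) (y : Fin n → Fin N) :
    0 < q.prefixProb i y :=
  Finset.prod_pos fun j _ => by split_ifs; exacts [hq _ _, one_pos]

/-- The conditional expectation of a function of the first `i + k` tokens. -/
lemma condExp_eq_look (hq : ∀ s y, 0 < q.prob s y) {g : (Fin n → Fin N) → ℝ}
    {φ : List (Fin N) → ℝ} {i k : ℕ} (hi : i ≤ n) (hg : ∀ x, g x = φ (textPrefix x (i + k)))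
    (y : Fin n → Fin N) :
    q.condExp g i y = q.look (min k (n - i)) φ (textPrefix y i) := by
  have h1 := sum_prefix q (fun x => φ (x.take (i + k))) (n - i) i (by omega) y
  have h2 := sum_prefix q (fun _ => 1) (n - i) i (by omega) y
  simp only [mul_one, LangModel.look_const] at h2
  unfold LangModel.condExp
  rw [h2]
  have h3 : (∑ x with ∀ j : Fin n, j.val < i → x j = y j, q.textProb x * g x) =
      q.prefixProb i y * q.look (n - i) (fun x => φ (x.take (i + k))) (textPrefix y i) := by
    rw [← h1]
    exact Finset.sum_congr rfl fun x _ => by rw [hg]; rfl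
  rw [h3, mul_div_cancel_left₀ _ (prefixProb_pos q hq i y).ne']
  have hlen : (textPrefix y i).length = i := by rw [length_textPrefix]; omega
  rw [← q.look_take (min_le_right k (n - i)) φ, hlen]
  refine q.look_congr fun u hu => ?_
  have : (textPrefix y i ++ u).length = n := by simp [hlen, hu]; omega
  congr 1
  rcases le_total k (n - i) with h | h
  · rw [min_eq_left h]
  · rw [min_eq_right h, List.take_of_length_le (by omega), List.take_of_length_le (by omega)]

end prefixes

namespace Boost

/-! ### Sums over the windows -/

section windows

variable {N : ℕ} (hN : 0 < N)

/-- Splits off the lowest digit, which is the first token of a window. -/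
lemma sum_range_mul_eq (M : ℕ) (f : ℕ → ℝ) :
    ∑ W ∈ Finset.range (N * M), f W = ∑ c : Fin N, ∑ W ∈ Finset.range M, f (c + N * W) := by
  induction M with
  | zero => simp
  | succ M ih =>
    rw [Nat.mul_succ, Finset.sum_range_add, ih, Finset.sum_range (fun x => f (N * M + x)),
      ← Finset.sum_add_distrib]
    exact Finset.sum_congr rfl fun c _ => by rw [Finset.sum_range_succ, add_comm (N * M)]

lemma digit_add_mul (c : Fin N) (W : ℕ) : digit hN (c + N * W) = c :=
  Fin.ext (by simp [digit, Nat.mod_eq_of_lt c.2])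

lemma add_mul_div_pow_succ (c : Fin N) (W j : ℕ) :
    (c + N * W) / N ^ (j + 1) = W / N ^ j := by
  rw [pow_succ', ← Nat.div_div_eq_div_mul, Nat.add_mul_div_left _ _ c.pos,
    Nat.div_eq_of_lt c.2, zero_add]

lemma digits_add_mul (c : Fin N) (W j : ℕ) :
    digits hN (j + 1) (c + N * W) = c :: digits hN j W := by
  induction j with
  | zero => rw [digits_succ, digits_zero, pow_zero, Nat.div_one, digit_add_mul, digits_zero]; rfl
  | succ j ih => rw [digits_succ, ih, add_mul_div_pow_succ, digits_succ]; rfl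

lemma digits_take {i j : ℕ} (h : i ≤ j) (W : ℕ) : (digits hN j W).take i = digits hN i W := by
  rw [digits, ← List.map_take, List.take_range, min_eq_left h]; rfl

/-- The probability of the first `m` tokens of the window `W`. -/
noncomputable def windowProb (q : LangModel N) (s : List (Fin N)) (W m : ℕ) : ℝ :=
  ∏ j ∈ Finset.range m, q.prob (s ++ digits hN j W) (digit hN (W / N ^ j))

lemma windowProb_add_mul (q : LangModel N) (s : List (Fin N)) (c : Fin N) (W m : ℕ) :
    windowProb hN q s (c + N * W) (m + 1) = q.prob s c * windowProb hN q (s ++ [c]) W m := by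
  rw [windowProb, Finset.prod_range_succ', mul_comm, digits_zero, List.append_nil, pow_zero,
    Nat.div_one, digit_add_mul]
  congr 1
  exact Finset.prod_congr rfl fun j _ => by
    rw [digits_add_mul, add_mul_div_pow_succ, List.append_assoc]; rfl

/-- The numbers below `N ^ m` run once through all strings of length `m`, so the enumeration by the
clock computes an expectation under `q`. -/
lemma sum_windowProb (q : LangModel N) (φ : List (Fin N) → ℝ) (m : ℕ) (s : List (Fin N)) :
    ∑ W ∈ Finset.range (N ^ m), windowProb hN q s W m * φ (s ++ digits hN m W) =
      q.look m φ s := by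
  induction m generalizing s with
  | zero => simp [windowProb, digits_zero, LangModel.look]
  | succ m ih =>
    rw [pow_succ', sum_range_mul_eq]
    refine Finset.sum_congr rfl fun c _ => ?_
    rw [← ih, Finset.mul_sum]
    refine Finset.sum_congr rfl fun W _ => ?_
    rw [windowProb_add_mul, digits_add_mul, mul_assoc, List.append_assoc]; rfl

lemma sum_windowProb_first (q : LangModel N) (φ : List (Fin N) → ℝ) (m : ℕ) (s : List (Fin N))
    (y : Fin N) :
    (∑ W ∈ Finset.range (N ^ (m + 1)), if W % N = y then
      windowProb hN q s W (m + 1) * φ (s ++ digits hN (m + 1) W) else 0) =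
      q.prob s y * q.look m φ (s ++ [y]) := by
  rw [pow_succ', sum_range_mul_eq, Finset.sum_eq_single y]
  · rw [← sum_windowProb hN, Finset.mul_sum]
    refine Finset.sum_congr rfl fun W _ => ?_
    rw [windowProb_add_mul, digits_add_mul, mul_assoc, List.append_assoc,
      if_pos (by simp [Nat.mod_eq_of_lt y.2])]; rfl
  · intro c _ hc
    refine Finset.sum_eq_zero fun W _ => if_neg ?_
    simpa [Nat.mod_eq_of_lt c.2] using fun h => hc (Fin.ext h)
  · simp

end windows

variable {B : Boost}

/-- The length of the window that is reweighted after `t` tokens (`0` if there is none). -/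
def len (B : Boost) (t : ℕ) : ℕ :=
  if B.ctlg t = 1 then B.ctlJ t - (B.ctlJ t - B.ctlR t) else 0

/-- The verdict of the distinguisher network on a string. -/
noncomputable def verdict (B : Boost) (x : List (Fin B.N)) : ℝ := clip (B.D.output B.G x)

/-- The factor by which the weight of the string `x` after `s` is multiplied. -/
noncomputable def tilt (B : Boost) (s x : List (Fin B.N)) : ℝ :=
  1 - B.κ * if 1 ≤ B.len s.length then B.verdict (x.take (s.length + B.len s.length)) else 0

/-- The next-token probabilities of the boosted network without rounding errors. -/
noncomputable def ideal (B : Boost) (q : LangModel B.N) (s : List (Fin B.N)) (y : Fin B.N) : ℝ :=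
  q.prob s y * q.look (B.k - 1) (B.tilt s) (s ++ [y]) / q.look B.k (B.tilt s) s

lemma len_le (h : B.J0 ≤ B.k) (t : ℕ) : B.len t ≤ B.k := by
  unfold len
  split_ifs
  exacts [(Nat.sub_le _ _).trans (ctlJ_le h t), Nat.zero_le _]

/-! ### Rounding errors of weights, shares and output probabilities -/

section approximation

variable {I bQ IQ bD ID : ℝ} (hB : B.Valid I bQ IQ bD ID) (s : List (Fin B.N))

include hB

/-- At most one factor of a window differs from `1`, the one at the token where the verdict is due.
It depends only on the tokens up to there, so it can be read off the whole window. -/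
lemma fac_eq (W i : ℕ) (hi : i < B.k) : fac hB.hN s W i =
    if i + 1 = B.len s.length then B.tilt s (s ++ digits hB.hN B.k W) else 1 := by
  unfold fac tilt len verdict
  by_cases hg : B.ctlg s.length = 1
  · simp only [hg, true_and, if_true]
    split_ifs with h1 h2
    · rw [← h1, List.take_length_add_append, digits_take _ (by omega)]
    · omega
    · simp
  · simp [hg]

lemma prod_fac (W : ℕ) : ∏ i ∈ Finset.range B.k, fac hB.hN s W i =
    B.tilt s (s ++ digits hB.hN B.k W) := by
  rw [Finset.prod_congr rfl fun i hi => fac_eq hB s W i (Finset.mem_range.1 hi)]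
  by_cases hL : 1 ≤ B.len s.length
  · obtain ⟨l, hl⟩ := Nat.exists_eq_add_of_le' hL
    have := len_le hB.J0_le s.length
    simp only [hl, add_left_inj]
    rw [Finset.prod_ite_eq' , if_pos (Finset.mem_range.2 (by omega))]
  · rw [Finset.prod_eq_one fun i _ => if_neg (by omega), tilt, if_neg hL, mul_zero, sub_zero]

lemma tilt_mem (x : List (Fin B.N)) : 1 - B.κ ≤ B.tilt s x ∧ B.tilt s x ≤ 1 := by
  have h1 := hB.κ_nonneg
  unfold tilt verdict
  split_ifs
  · have h3 := clip_nonneg (B.D.output B.G (x.take (s.length + B.len s.length)))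
    have h4 := clip_le_one (B.D.output B.G (x.take (s.length + B.len s.length)))
    constructor <;> nlinarith
  · simp [h1]

variable {q : LangModel B.N} (hQ : B.Q.ImplementsLM B.F q)

include hQ

lemma prod_step_eq (W i : ℕ) : ∏ j ∈ Finset.range i,
    (B.Q.output B.F (s ++ digits hB.hN (j + 1) W) * fac hB.hN s W j) =
    windowProb hB.hN q s W i * ∏ j ∈ Finset.range i, fac hB.hN s W j := by
  rw [Finset.prod_mul_distrib, windowProb]
  congr 1
  exact Finset.prod_congr rfl fun j _ => by
    rw [digits_succ, ← List.append_assoc, hQ]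

-- All factors lie in `[0, 1]`, so earlier losses are not amplified and every rounding adds a loss
-- of at most `2 ^ (-F)`.
omit hQ in
lemma weight_bounds (W i : ℕ) :
    (∏ j ∈ Finset.range i, (B.Q.output B.F (s ++ digits hB.hN (j + 1) W) * fac hB.hN s W j)) -
      i * (1 / 2 ^ B.F) ≤ weight hB.hN s W i ∧
    weight hB.hN s W i ≤
      ∏ j ∈ Finset.range i, (B.Q.output B.F (s ++ digits hB.hN (j + 1) W) * fac hB.hN s W j) := by
  induction i with
  | zero => simp [weight]
  | succ i ih =>
    have h1 := hB.prob (s ++ digits hB.hN i W) (digit hB.hN (W / B.N ^ i))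
    rw [List.append_assoc, ← digits_succ] at h1
    have h2 := fac_mem hB s W i
    rw [Finset.prod_range_succ, weight]
    set c := B.Q.output B.F (s ++ digits hB.hN (i + 1) W) * fac hB.hN s W i
    have hc0 : 0 ≤ c := mul_nonneg h1.1 h2.1
    have hc1 : c ≤ 1 := mul_le_one₀ h1.2 h2.1 h2.2
    have he : (0 : ℝ) ≤ 1 / 2 ^ B.F := by positivity
    constructor
    · refine le_trans ?_ (sub_lt_quantize _ _).le
      have h3 := mul_le_mul_of_nonneg_right ih.1 hc0
      have h4 : (i * (1 / 2 ^ B.F) : ℝ) * c ≤ i * (1 / 2 ^ B.F) :=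
        mul_le_of_le_one_right (by positivity) hc1
      push_cast
      nlinarith
    · exact (quantize_le _ _).trans (mul_le_mul_of_nonneg_right ih.2 hc0)

variable {ℓ δ : ℝ} (hℓ : 0 < ℓ) (hprob : ∀ s y, ℓ ≤ q.prob s y) (hκ : B.κ ≤ 1 / 2)
  (hδ : 4 * B.k * (1 / 2 ^ B.F) ≤ δ * ℓ ^ B.k) (hδ1 : δ ≤ 1)

include hℓ hprob hκ hδ

omit hQ hδ in
lemma pow_le_window (W : ℕ) :
    ℓ ^ B.k / 2 ≤ windowProb hB.hN q s W B.k * B.tilt s (s ++ digits hB.hN B.k W) := by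
  have h1 : ℓ ^ B.k ≤ windowProb hB.hN q s W B.k := by
    unfold windowProb
    calc ℓ ^ B.k = ∏ j ∈ Finset.range B.k, ℓ := by simp
      _ ≤ _ := Finset.prod_le_prod (fun _ _ => hℓ.le) fun _ _ => hprob _ _
  have h2 := (tilt_mem hB s (s ++ digits hB.hN B.k W)).1
  have h3 : (0 : ℝ) < ℓ ^ B.k := by positivity
  nlinarith [mul_le_mul h1 (by linarith : (1 / 2 : ℝ) ≤ B.tilt s (s ++ digits hB.hN B.k W))
    (by norm_num) (h3.le.trans h1)]

omit hQ hℓ hδ in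
lemma half_le_mul_look (y : Fin B.N) :
    ℓ / 2 ≤ q.prob s y * q.look (B.k - 1) (B.tilt s) (s ++ [y]) := by
  have hφ := q.look_mem (m := B.k - 1) (tilt_mem hB s) (s ++ [y])
  have := mul_le_mul (hprob s y) (by linarith [hφ.1] :
    1 / 2 ≤ q.look (B.k - 1) (B.tilt s) (s ++ [y])) (by norm_num) (q.nonneg s y)
  linarith

omit hQ hδ in
lemma half_le_ideal (y : Fin B.N) : ℓ / 2 ≤ B.ideal q s y := by
  have hφ := q.look_mem (m := B.k) (tilt_mem hB s) s
  have hn := half_le_mul_look hB s hprob hκ y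
  refine hn.trans ?_
  rw [ideal, le_div_iff₀ (by linarith)]
  exact mul_le_of_le_one_right (by linarith) hφ.2

/-- The `k` roundings lose at most `k 2^(-F) ≤ (δ/2)(ℓ^k/2)`, and `ℓ^k/2` is a lower bound for the
exact weight. This is one half of the relative error `δ`. -/
lemma weight_ge (W : ℕ) :
    (1 - δ / 2) * (windowProb hB.hN q s W B.k * B.tilt s (s ++ digits hB.hN B.k W)) ≤
      weight hB.hN s W B.k := by
  have h1 := (weight_bounds hB s W B.k).1
  rw [prod_step_eq hB s hQ, prod_fac hB s] at h1
  have h2 := pow_le_window hB s hℓ hprob hκ W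
  have h3 : 0 ≤ δ := by
    by_contra h
    have : δ * ℓ ^ B.k < 0 := mul_neg_of_neg_of_pos (not_le.1 h) (by positivity)
    have h4 : (0 : ℝ) ≤ 4 * B.k * (1 / 2 ^ B.F) := by positivity
    linarith
  nlinarith [mul_le_mul_of_nonneg_left h2 h3]

include hδ1

lemma accum_total_pos : 0 < accum hB.hN s (fun _ => True) (B.N ^ B.k) := by
  refine Finset.sum_pos (fun W _ => ?_) ⟨0, Finset.mem_range.2 (Nat.pow_pos hB.hN)⟩
  rw [if_pos trivial]
  refine lt_of_lt_of_le (mul_pos (by linarith) ?_)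
    (weight_ge hB s hQ hℓ hprob hκ hδ W)
  exact lt_of_lt_of_le (by positivity) (pow_le_window hB s hℓ hprob hκ W)

/-- The total weight is a positive multiple of `2 ^ (-F)`, so the correction in the denominator
vanishes. -/
lemma share_eq (p : ℕ → Prop) [DecidablePred p] : share hB.hN s p =
    quantize B.F (accum hB.hN s p (B.N ^ B.k) /
      accum hB.hN s (fun _ => True) (B.N ^ B.k)) := by
  have hA := accum_total_pos hB s hQ hℓ hprob hκ hδ hδ1
  have h1 := (onGrid_accum hB s (fun _ => True) (B.N ^ B.k)).le_of_pos hA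
  rw [div_le_iff₀ (by positivity)] at h1
  rw [share, max_eq_left (by linarith), add_zero, mul_one_div]

lemma share_mono {p p' : ℕ → Prop} [DecidablePred p] [DecidablePred p'] (h : ∀ c, p c → p' c) :
    share hB.hN s p ≤ share hB.hN s p' := by
  rw [share_eq hB s hQ hℓ hprob hκ hδ hδ1, share_eq hB s hQ hℓ hprob hκ hδ hδ1]
  exact quantize_mono _ (div_le_div_of_nonneg_right (accum_mono hB s h _)
    (accum_total_pos hB s hQ hℓ hprob hκ hδ hδ1).le)

lemma outval_eq (y : ℕ) : outval hB.hN s y =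
    share hB.hN s (fun c => c + 1 ≤ y + 1) - share hB.hN s (fun c => c + 1 ≤ y) := by
  have h := share_mono hB s hQ hℓ hprob hκ hδ hδ1 (p := fun c => c + 1 ≤ y)
    (p' := fun c => c ≤ y) fun c hc => by omega
  rw [outval, max_eq_right (by linarith)]
  simp only [Nat.add_le_add_iff_right]

/-- The differences of cumulative shares telescope to the shares of all windows and of none. These
are `1` and `0`, which rounding leaves unchanged. -/
lemma sum_outval : ∑ y : Fin B.N, outval hB.hN s y = 1 := by
  have hA := accum_total_pos hB s hQ hℓ hprob hκ hδ hδ1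
  simp only [outval_eq hB s hQ hℓ hprob hκ hδ hδ1]
  rw [← Finset.sum_range (fun y => share hB.hN s (fun c => c + 1 ≤ y + 1) -
    share hB.hN s (fun c => c + 1 ≤ y)),
    Finset.sum_range_sub (fun y => share hB.hN s (fun c => c + 1 ≤ y)),
    share_eq hB s hQ hℓ hprob hκ hδ hδ1, share_eq hB s hQ hℓ hprob hκ hδ hδ1]
  have h1 : accum hB.hN s (fun c => c + 1 ≤ B.N) (B.N ^ B.k) =
      accum hB.hN s (fun _ => True) (B.N ^ B.k) :=
    Finset.sum_congr rfl fun W _ =>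
      (if_pos (Nat.mod_lt _ hB.hN)).trans (if_pos trivial).symm
  have h2 : accum hB.hN s (fun c => c + 1 ≤ 0) (B.N ^ B.k) = 0 :=
    Finset.sum_eq_zero fun W _ => if_neg (by omega)
  rw [h1, h2, div_self hA.ne', zero_div, quantize_of_onGrid (onGrid_one _),
    quantize_of_onGrid (onGrid_zero _), sub_zero]

/-- The boosted network outputs the ideal probabilities up to a factor. -/
lemma ideal_le_outval (y : Fin B.N) : (1 - δ) * B.ideal q s y ≤ outval hB.hN s y := by
  have hA := accum_total_pos hB s hQ hℓ hprob hκ hδ hδ1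
  have hk := hB.hk
  set A := accum hB.hN s (fun _ => True) (B.N ^ B.k) with hAdef
  -- Weights are only rounded down, so the computed normalizer is at most the exact one and errs in
  -- the favorable direction.
  have hAle : A ≤ q.look B.k (B.tilt s) s := by
    rw [← sum_windowProb hB.hN]
    refine Finset.sum_le_sum fun W _ => ?_
    rw [if_pos trivial, ← prod_fac hB s, ← prod_step_eq hB s hQ]
    exact (weight_bounds hB s W B.k).2
  have hnum : (1 - δ / 2) * (q.prob s y * q.look (B.k - 1) (B.tilt s) (s ++ [y])) ≤
      accum hB.hN s (fun c => c + 1 ≤ y.val + 1) (B.N ^ B.k) -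
        accum hB.hN s (fun c => c + 1 ≤ y.val) (B.N ^ B.k) := by
    rw [← sum_windowProb_first hB.hN, Nat.sub_add_cancel hk, accum, accum,
      ← Finset.sum_sub_distrib, Finset.mul_sum]
    refine Finset.sum_le_sum fun W _ => ?_
    rcases lt_trichotomy (W % B.N) y with h | h | h
    · rw [if_neg h.ne, if_pos (by omega), if_pos (by omega)]; simp
    · rw [if_pos h, if_pos (by omega), if_neg (by omega), sub_zero]
      exact weight_ge hB s hQ hℓ hprob hκ hδ W
    · rw [if_neg h.ne', if_neg (by omega), if_neg (by omega)]; simp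
  have hZ : 0 < q.look B.k (B.tilt s) s := hA.trans_le hAle
  have hn := half_le_mul_look hB s hprob hκ y
  have hideal := half_le_ideal hB s hℓ hprob hκ y
  have h1 : (1 - δ / 2) * B.ideal q s y ≤
      (accum hB.hN s (fun c => c + 1 ≤ y.val + 1) (B.N ^ B.k) -
        accum hB.hN s (fun c => c + 1 ≤ y.val) (B.N ^ B.k)) / A := by
    rw [ideal, ← mul_div_assoc]
    have h0 : 0 ≤ (1 - δ / 2) * (q.prob s y * q.look (B.k - 1) (B.tilt s) (s ++ [y])) :=
      mul_nonneg (by linarith) (by linarith)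
    exact div_le_div₀ (h0.trans hnum) hnum hA hAle
  have hℓ1 : ℓ ≤ 1 := by
    refine (hprob s y).trans ?_
    rw [← q.sum_one s]
    exact Finset.single_le_sum (fun i _ => q.nonneg s i) (Finset.mem_univ y)
  -- The other half of `δ`: rounding lowers the larger share by less than `2 ^ (-F)`, and lowering
  -- the smaller one only helps.
  have he : 1 / 2 ^ B.F ≤ δ / 2 * B.ideal q s y := by
    have hk1 : (1 : ℝ) ≤ B.k := by exact_mod_cast hk
    have he0 : (0 : ℝ) < 1 / 2 ^ B.F := by positivity
    have h2 : 4 * (1 / 2 ^ B.F : ℝ) ≤ 4 * B.k * (1 / 2 ^ B.F) := by nlinarith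
    have hpow : ℓ ^ B.k ≤ ℓ := by
      simpa using pow_le_pow_of_le_one hℓ.le hℓ1 (Nat.one_le_iff_ne_zero.2 hk.ne')
    have hδ0 : 0 ≤ δ := by
      by_contra h
      have : δ * ℓ ^ B.k < 0 := mul_neg_of_neg_of_pos (not_le.1 h) (by positivity)
      linarith
    have h3 := mul_le_mul_of_nonneg_left hpow hδ0
    have h4 := mul_le_mul_of_nonneg_left hideal hδ0
    linarith
  rw [outval_eq hB s hQ hℓ hprob hκ hδ hδ1, share_eq hB s hQ hℓ hprob hκ hδ hδ1,
    share_eq hB s hQ hℓ hprob hκ hδ hδ1]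
  have h5 := sub_lt_quantize B.F
    (accum hB.hN s (fun c => c + 1 ≤ y.val + 1) (B.N ^ B.k) / A)
  have h6 := quantize_le B.F (accum hB.hN s (fun c => c + 1 ≤ y.val) (B.N ^ B.k) / A)
  rw [sub_div] at h1
  linarith

lemma outval_ge (hδ2 : δ ≤ 1 / 2) (y : Fin B.N) : ℓ / 4 ≤ outval hB.hN s y := by
  refine le_trans ?_ (ideal_le_outval hB s hQ hℓ hprob hκ hδ hδ1 y)
  have hideal := half_le_ideal hB s hℓ hprob hκ y
  nlinarith

end approximation

end Boost

/-! ### The gain in likelihood -/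

section gain

variable {n N : ℕ} (q : LangModel N) (V : List (Fin N) → ℝ) (κ : ℝ) (k o R d : ℕ)

/-- The length of the window that is reweighted after `t` tokens, when the blocks of length `k`
start at the positions `t` with `k ∣ t + o`. -/
def schedLen (t : ℕ) : ℕ := if o = 0 ∨ k ≤ t + o then min (k - (t + o) % k) (R - t * d) else 0

/-- The expected factor. -/
noncomputable def tiltMean (m : ℕ) (s : List (Fin N)) : ℝ := 1 - κ * q.look m V s

/-- The gain in log-likelihood at a token of a text. -/
noncomputable def tokenGain (x : Fin n → Fin N) (t : ℕ) : ℝ :=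
  if 1 ≤ schedLen k o R d t then
    Real.log (tiltMean q V κ (schedLen k o R d t - 1) (textPrefix x (t + 1))) -
      Real.log (tiltMean q V κ (schedLen k o R d t) (textPrefix x t))
  else 0

/-- The gain in log-likelihood from a block. -/
noncomputable def blockGain (x : Fin n → Fin N) (b : ℕ) : ℝ :=
  Real.log (tiltMean q V κ 0 (textPrefix x (b + k))) -
    Real.log (tiltMean q V κ (min k (n - b)) (textPrefix x b))

variable {q V κ k o R d}

/-- Inside a block the reweighted window shrinks by one per token, so the numerator at one token is
the normalizer at the next and the logarithms telescope. -/
lemma blockGain_sum (x : Fin n → Fin N) {b r : ℕ} (hb : (b + o) % k = 0)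
    (hb' : o = 0 ∨ k ≤ b + o) (hr : r ≤ k) (hrn : b + r ≤ n)
    (hR : R = n ∧ d = 1 ∨ R = k ∧ d = 0) :
    ∑ j ∈ Finset.range r, tokenGain q V κ k o R d x (b + j) =
      Real.log (tiltMean q V κ (min k (R - b * d) - r) (textPrefix x (b + r))) -
      Real.log (tiltMean q V κ (min k (R - b * d)) (textPrefix x b)) := by
  have h := Finset.sum_range_sub (fun j => Real.log (tiltMean q V κ
    (min k (R - b * d) - j) (textPrefix x (b + j)))) r
  simp only [Nat.sub_zero, add_zero] at h
  rw [← h]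
  refine Finset.sum_congr rfl fun j hj => ?_
  have hj := Finset.mem_range.1 hj
  have hmod : (b + j + o) % k = j := by
    rw [add_right_comm, Nat.add_mod, hb, zero_add, Nat.mod_mod, Nat.mod_eq_of_lt (by omega)]
  have hL : schedLen k o R d (b + j) = min k (R - b * d) - j := by
    unfold schedLen
    rw [if_pos (by omega), hmod]
    rcases hR with ⟨rfl, rfl⟩ | ⟨rfl, rfl⟩ <;> simp only [mul_one, mul_zero] <;> omega
  have hpos : j + 1 ≤ min k (R - b * d) := by
    rcases hR with ⟨rfl, rfl⟩ | ⟨rfl, rfl⟩ <;> simp only [mul_one, mul_zero] <;> omega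
  rw [tokenGain, hL, if_pos (by omega), Nat.sub_sub, add_assoc]

variable (hV : ∀ x, 0 ≤ V x ∧ V x ≤ 1) (hκ0 : 0 ≤ κ) (hκ : κ ≤ 1 / 2)

include hV hκ0 in
lemma tiltMean_mem (m : ℕ) (s : List (Fin N)) :
    1 - κ ≤ tiltMean q V κ m s ∧ tiltMean q V κ m s ≤ 1 := by
  have := q.look_mem (m := m) hV s
  unfold tiltMean
  constructor <;> nlinarith

-- The expected factor is at least `1/2`, and `log u ≥ 1 - 1/u`. The lower bound prices a last block
-- whose end is not counted.
include hV hκ0 hκ in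
lemma log_tiltMean_mem (m : ℕ) (s : List (Fin N)) :
    -1 ≤ Real.log (tiltMean q V κ m s) ∧ Real.log (tiltMean q V κ m s) ≤ 0 := by
  have := tiltMean_mem (q := q) hV hκ0 m s
  refine ⟨?_, Real.log_nonpos (by linarith) this.2⟩
  have h1 := Real.one_sub_inv_le_log_of_pos (by linarith : 0 < tiltMean q V κ m s)
  have h2 : (tiltMean q V κ m s)⁻¹ ≤ 2 := by
    rw [inv_le_comm₀ (by linarith) (by norm_num)]; linarith
  linarith

-- Induction from block to block. Only the last block can be cut off by the end of the text: if the
-- text is counted, its verdict is taken there and nothing is lost; otherwise four logarithms in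
-- `[-1, 0]` differ from what is wanted by at most `2`.
include hV hκ0 hκ in
lemma sum_tokenGain_from (hk : 0 < k) {c : ℝ}
    (hR : (R = n ∧ d = 1) ∧ 0 ≤ c ∨ (R = k ∧ d = 0) ∧ 2 ≤ c) (x : Fin n → Fin N) (m : ℕ) :
    ∀ b, n - b ≤ m → (b + o) % k = 0 → (o = 0 ∨ k ≤ b + o) →
      ∑ b' ∈ (Finset.Ico b n).filter (fun b' => (b' + o) % k = 0), blockGain q V κ k x b' - c ≤
        ∑ t ∈ Finset.Ico b n, tokenGain q V κ k o R d x t := by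
  have hc : 0 ≤ c := by rcases hR with h | h <;> linarith [h.2]
  have hfilter {b e : ℕ} (hb : (b + o) % k = 0) (hbe : b < e) (he : e ≤ b + k) :
      (Finset.Ico b e).filter (fun b' => (b' + o) % k = 0) = {b} := by
    ext b'
    simp only [Finset.mem_filter, Finset.mem_Ico, Finset.mem_singleton]
    constructor
    · rintro ⟨⟨h1, h2⟩, h3⟩
      obtain ⟨j, rfl⟩ := Nat.exists_eq_add_of_le h1
      rw [add_right_comm, Nat.add_mod, hb, zero_add, Nat.mod_mod,
        Nat.mod_eq_of_lt (by omega)] at h3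
      omega
    · rintro rfl; exact ⟨⟨le_rfl, hbe⟩, hb⟩
  induction m with
  | zero =>
    intro b hm _ _
    rw [Finset.Ico_eq_empty (by omega)]; simpa using hc
  | succ m ih =>
    intro b hm hb hb'
    rcases Nat.lt_or_ge b n with hbn | hbn
    swap
    · rw [Finset.Ico_eq_empty (by omega)]; simpa using hc
    have hsum (r : ℕ) (hr : b + r ≤ n) : ∑ t ∈ Finset.Ico b (b + r), tokenGain q V κ k o R d x t =
        ∑ j ∈ Finset.range r, tokenGain q V κ k o R d x (b + j) := by
      rw [Finset.sum_Ico_eq_sum_range, Nat.add_sub_cancel_left]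
    rcases Nat.lt_or_ge n (b + k) with h | h
    · obtain ⟨r, rfl⟩ := Nat.exists_eq_add_of_le hbn.le
      rw [hfilter hb hbn h.le, Finset.sum_singleton, hsum r le_rfl,
        blockGain_sum x hb hb' (by omega) le_rfl (hR.imp And.left And.left), blockGain]
      rcases hR with ⟨⟨rfl, rfl⟩, hc⟩ | ⟨⟨rfl, rfl⟩, hc⟩
      · rw [mul_one, Nat.add_sub_cancel_left, min_eq_right (by omega), Nat.sub_self,
          textPrefix_of_le x h.le, textPrefix_of_le x le_rfl]
        linarith
      · have h1 := log_tiltMean_mem (q := q) hV hκ0 hκ 0 (textPrefix x (b + R))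
        have h2 := log_tiltMean_mem (q := q) hV hκ0 hκ (min R (b + r - b)) (textPrefix x b)
        have h3 := log_tiltMean_mem (q := q) hV hκ0 hκ (min R (R - b * 0) - r)
          (textPrefix x (b + r))
        have h4 := log_tiltMean_mem (q := q) hV hκ0 hκ (min R (R - b * 0)) (textPrefix x b)
        linarith [h1.1, h1.2, h2.1, h2.2, h3.1, h3.2, h4.1, h4.2]
    · have := ih (b + k) (by omega) (by rw [add_right_comm, Nat.add_mod_right, hb])
        (Or.inr (by omega))
      rw [← Finset.Ico_union_Ico_eq_Ico (Nat.le_add_right b k) h, Finset.filter_union,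
        Finset.sum_union (Finset.disjoint_filter_filter
          (Finset.Ico_disjoint_Ico_consecutive b (b + k) n)),
        Finset.sum_union (Finset.Ico_disjoint_Ico_consecutive b (b + k) n),
        hfilter hb (by omega) le_rfl, Finset.sum_singleton, hsum k h,
        blockGain_sum x hb hb' le_rfl h (hR.imp And.left And.left), blockGain]
      have hmin : min k (R - b * d) = k := by
        rcases hR with ⟨⟨rfl, rfl⟩, hc⟩ | ⟨⟨rfl, rfl⟩, hc⟩ <;>
          simp only [mul_one, mul_zero] <;> omega
      rw [hmin, Nat.sub_self, min_eq_left (by omega)]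
      linarith

include hV hκ0 hκ in
/-- The gain in log-likelihood is at least the gain from the blocks. -/
lemma sum_blockGain_le (hk : 0 < k) (ho : o < k) {c : ℝ}
    (hR : (R = n ∧ d = 1) ∧ 0 ≤ c ∨ (R = k ∧ d = 0) ∧ 2 ≤ c) (x : Fin n → Fin N) :
    ∑ b ∈ (Finset.range n).filter (fun b => (b + o) % k = 0), blockGain q V κ k x b - c ≤
      ∑ t ∈ Finset.range n, tokenGain q V κ k o R d x t := by
  rcases Nat.eq_zero_or_pos o with rfl | ho'
  · simpa using sum_tokenGain_from (o := 0) hV hκ0 hκ hk hR x n 0 (by simp) (by simp) (by simp)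
  have h := sum_tokenGain_from (q := q) (o := o) hV hκ0 hκ hk hR x n (k - o) (by omega)
    (by rw [Nat.sub_add_cancel ho.le, Nat.mod_self]) (by omega)
  have h1 : (Finset.range n).filter (fun b => (b + o) % k = 0) =
      (Finset.Ico (k - o) n).filter (fun b => (b + o) % k = 0) := by
    ext b
    simp only [Finset.mem_filter, Finset.mem_range, Finset.mem_Ico, and_congr_left_iff]
    intro hb
    have : k ≤ b + o := Nat.le_of_dvd (by omega) (Nat.dvd_of_mod_eq_zero hb)
    omega
  have h2 : ∑ t ∈ Finset.range n, tokenGain q V κ k o R d x t =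
      ∑ t ∈ Finset.Ico (k - o) n, tokenGain q V κ k o R d x t := by
    refine (Finset.sum_subset (fun t ht => ?_) fun t ht ht' => ?_).symm
    · exact Finset.mem_range.2 (Finset.mem_Ico.1 ht).2
    · rw [Finset.mem_range] at ht
      rw [Finset.mem_Ico] at ht'
      have : schedLen k o R d t = 0 := if_neg (by omega)
      rw [tokenGain, this, if_neg (by omega)]
  rw [h1, h2]
  exact h

/-- Each position starts a block for exactly one offset. -/
lemma sum_offsets (hk : 0 < k) (f : ℕ → ℝ) :
    ∑ o ∈ Finset.range k, ∑ b ∈ (Finset.range n).filter (fun b => (b + o) % k = 0), f b =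
      ∑ b ∈ Finset.range n, f b := by
  simp only [Finset.sum_filter]
  rw [Finset.sum_comm]
  refine Finset.sum_congr rfl fun b _ => ?_
  -- The only offset in question is `-b` modulo `k`.
  rw [Finset.sum_eq_single ((k - b % k) % k)]
  · refine if_pos ?_
    have hb := Nat.mod_lt b hk
    rw [Nat.add_mod_mod, Nat.add_mod, Nat.add_mod]
    have : b % k % k + (k - b % k) % k % k ≡ 0 [MOD k] := by
      rw [Nat.mod_mod, Nat.mod_mod]
      calc b % k + (k - b % k) % k ≡ b % k + (k - b % k) [MOD k] :=
            Nat.ModEq.add_left _ (Nat.mod_modEq _ _)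
        _ = k := by omega
        _ ≡ 0 [MOD k] := by simp [Nat.ModEq]
    simpa [Nat.ModEq] using this
  · intro o ho hne
    refine if_neg fun h => hne ?_
    have ho := Finset.mem_range.1 ho
    have hb := Nat.mod_lt b hk
    rw [Nat.add_mod, Nat.mod_eq_of_lt ho] at h
    rcases Nat.lt_or_ge (b % k + o) k with h1 | h1
    · rw [Nat.mod_eq_of_lt h1] at h
      have : b % k = 0 := by omega
      rw [this]; simp; omega
    · rw [Nat.mod_eq_sub_mod h1, Nat.mod_eq_of_lt (by omega)] at h
      rw [Nat.mod_eq_of_lt] <;> omega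
  · intro h; exact absurd (Finset.mem_range.2 (Nat.mod_lt _ hk)) h

end gain

/-! ### The expected gain and the choice of the offset -/

section expectedGain

variable {n N k : ℕ} {q : LangModel N} {V : List (Fin N) → ℝ} {κ : ℝ}

/-- For `u ≤ 1/2`, the terms of order two to four of the Taylor series together with the remainder
`2 u^5` are at most `u²`. -/
lemma neg_sub_sq_le_log_one_sub {u : ℝ} (h0 : 0 ≤ u) (h : u ≤ 1 / 2) :
    -u - u ^ 2 ≤ Real.log (1 - u) := by
  have h1 := Real.abs_log_sub_add_sum_range_le (x := u) (by rw [abs_of_nonneg h0]; linarith) 4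
  rw [abs_of_nonneg h0] at h1
  have h2 := (abs_le.1 h1).1
  simp only [Finset.sum_range_succ, Finset.sum_range_zero] at h2
  norm_num at h2
  have h3 : u ^ 5 / (1 - u) ≤ 2 * u ^ 5 := by
    rw [div_le_iff₀ (by linarith)]
    nlinarith [pow_nonneg h0 5]
  have h4 : u ^ 3 ≤ u ^ 2 / 2 := by nlinarith [pow_nonneg h0 2]
  have h5 : u ^ 4 ≤ u ^ 2 / 4 := by nlinarith [pow_nonneg h0 3]
  have h6 : u ^ 5 ≤ u ^ 2 / 8 := by nlinarith [pow_nonneg h0 4]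
  nlinarith [sq_nonneg u]

variable (hV : ∀ x, 0 ≤ V x ∧ V x ≤ 1) (hκ0 : 0 ≤ κ) (hκ : κ ≤ 1 / 2)

-- The verdict term uses `log (1 - u) ≥ -u - u²`, the expectation only `log u ≤ u - 1`; so the error
-- is `κ²`, and the first-order term is the summand of the advantage.
include hV hκ0 hκ in
lemma blockGain_ge (x : Fin n → Fin N) (b : ℕ) :
    κ * (q.look (min k (n - b)) V (textPrefix x b) - V (textPrefix x (b + k))) - κ ^ 2 ≤
      blockGain q V κ k x b := by
  have hv := hV (textPrefix x (b + k))
  have hm := tiltMean_mem (q := q) hV hκ0 (min k (n - b)) (textPrefix x b)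
  have h1 := neg_sub_sq_le_log_one_sub (u := κ * V (textPrefix x (b + k)))
    (mul_nonneg hκ0 hv.1) (by nlinarith)
  have h2 := Real.log_le_sub_one_of_pos
    (by linarith : 0 < tiltMean q V κ (min k (n - b)) (textPrefix x b))
  have h3 : (κ * V (textPrefix x (b + k))) ^ 2 ≤ κ ^ 2 := by
    refine pow_le_pow_left₀ (mul_nonneg hκ0 hv.1) (by nlinarith) 2
  unfold blockGain
  rw [show tiltMean q V κ 0 (textPrefix x (b + k)) = 1 - κ * V (textPrefix x (b + k)) from rfl]
  have h4 : tiltMean q V κ (min k (n - b)) (textPrefix x b) - 1 =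
    -(κ * q.look (min k (n - b)) V (textPrefix x b)) := by unfold tiltMean; ring
  linarith

variable (hq : ∀ s y, 0 < q.prob s y) (p : TextDist n N) (d : Distinguisher n N k)
  (hd : ∀ (i : Fin n) x, d.d i x = V (textPrefix x (i + k)))

include hV hκ0 hκ hq hd in
lemma expected_blockGain_ge (hn : 0 < n) : n * (κ * advantage d p q - κ ^ 2) ≤
    ∑ x, p.prob x * ∑ b ∈ Finset.range n, blockGain q V κ k x b := by
  have hn' : (n : ℝ) ≠ 0 := by positivity
  have h1 : n * (κ * advantage d p q - κ ^ 2) =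
      ∑ x, p.prob x * ∑ i : Fin n, (κ * (q.condExp (d.d i) i x - d.d i x) - κ ^ 2) := by
    simp only [Finset.sum_sub_distrib, ← Finset.mul_sum, mul_sub, Finset.sum_const,
      Finset.card_univ, Fintype.card_fin, nsmul_eq_mul, ← Finset.sum_mul, p.sum_one, one_mul]
    simp only [advantage, Finset.mul_sum, Finset.sum_sub_distrib, mul_sub]
    congr 1
    congr 1 <;> refine Finset.sum_congr rfl fun x _ => Finset.sum_congr rfl fun i _ => ?_ <;>
      field_simp
  rw [h1]
  refine Finset.sum_le_sum fun x _ => mul_le_mul_of_nonneg_left ?_ (p.nonneg x)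
  rw [Finset.sum_range]
  refine Finset.sum_le_sum fun i _ => ?_
  rw [condExp_eq_look q hq i.2.le (hd i), hd]
  exact blockGain_ge hV hκ0 hκ x i

-- The gains for the `k` offsets add up to the gain over all positions, so one of them reaches the
-- average.
include hV hκ0 hκ hq hd in
lemma exists_offset (hk : 0 < k) (hn : 0 < n) : ∃ o < k,
    n * (κ * advantage d p q - κ ^ 2) / k ≤ ∑ x, p.prob x *
      ∑ b ∈ (Finset.range n).filter (fun b => (b + o) % k = 0), blockGain q V κ k x b := by
  have h := expected_blockGain_ge hV hκ0 hκ hq p d hd hn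
  have hk' : (k : ℝ) ≠ 0 := by positivity
  obtain ⟨o, ho, h'⟩ := Finset.exists_le_of_sum_le (s := Finset.range k)
    (f := fun _ => n * (κ * advantage d p q - κ ^ 2) / k) (g := fun o => ∑ x, p.prob x *
      ∑ b ∈ (Finset.range n).filter (fun b => (b + o) % k = 0), blockGain q V κ k x b)
    ⟨0, Finset.mem_range.2 hk⟩ (by
      rw [Finset.sum_comm]
      simp only [← Finset.mul_sum, sum_offsets hk]
      rw [Finset.sum_const, Finset.card_range, nsmul_eq_mul, mul_div_cancel₀ _ hk']
      exact h)
  exact ⟨o, Finset.mem_range.1 ho, h'⟩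

end expectedGain

/-! ### From the control registers to the loss of the boosted model -/

namespace Boost

variable {B : Boost}

lemma ctlJ_eq {o : ℕ} (ho : o < B.k) (hJ : B.J0 = B.k - o) (t : ℕ) :
    B.ctlJ t = B.k - (t + o) % B.k := by
  induction t with
  | zero => rw [ctlJ, hJ, zero_add, Nat.mod_eq_of_lt ho]
  | succ t ih =>
    have hlt := Nat.mod_lt (t + o) (by omega : B.k > 0)
    rw [ctlJ, ih, add_right_comm, ← Nat.mod_add_mod (t + o)]
    split_ifs with h
    · rw [show (t + o) % B.k + 1 = B.k by omega, Nat.mod_self]; rfl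
    · rw [Nat.mod_eq_of_lt (by omega : (t + o) % B.k + 1 < B.k)]; omega

lemma ctlg_eq {o : ℕ} (ho : o < B.k) (hJ : B.J0 = B.k - o) (hg : B.g0 = if o = 0 then 1 else 0)
    (t : ℕ) : B.ctlg t = if o = 0 ∨ B.k ≤ t + o then 1 else 0 := by
  induction t with
  | zero => rw [ctlg, hg]; split_ifs <;> omega
  | succ t ih =>
    have hlt := Nat.mod_lt (t + o) (by omega : B.k > 0)
    rw [ctlg, ih, ctlJ_eq ho hJ]
    by_cases h : t + o + 1 < B.k
    · rw [Nat.mod_eq_of_lt (by omega)]; split_ifs <;> omega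
    · rw [if_pos (by omega : o = 0 ∨ B.k ≤ t + 1 + o)]
      split_ifs with h1 h2
      · rfl
      · rfl
      · rw [show t + o = B.k - 1 by omega, Nat.mod_eq_of_lt (by omega)] at h1
        omega

lemma ctlR_eq (t : ℕ) : B.ctlR t = B.R0 - t * B.dec := by
  induction t with
  | zero => simp [ctlR]
  | succ t ih => rw [ctlR, ih, Nat.sub_sub, Nat.succ_mul]

lemma len_eq_schedLen {o : ℕ} (ho : o < B.k) (hJ : B.J0 = B.k - o)
    (hg : B.g0 = if o = 0 then 1 else 0) (t : ℕ) :
    B.len t = schedLen B.k o B.R0 B.dec t := by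
  rw [len, ctlg_eq ho hJ hg, ctlJ_eq ho hJ, ctlR_eq, schedLen]
  by_cases h : o = 0 ∨ B.k ≤ t + o
  · simp only [h, if_true]; omega
  · simp [h]

lemma verdict_mem (x : List (Fin B.N)) : 0 ≤ B.verdict x ∧ B.verdict x ≤ 1 :=
  ⟨clip_nonneg _, clip_le_one _⟩

/-- Used with `u` empty for the normalizer and with one token for the numerator of `ideal`. Tokens
of the window beyond the due verdict integrate out. -/
lemma look_tilt (q : LangModel B.N) (s u : List (Fin B.N)) (m : ℕ)
    (hm : s.length + B.len s.length ≤ (s ++ u).length + m)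
    (hu : 1 ≤ B.len s.length → u.length ≤ B.len s.length) : q.look m (B.tilt s) (s ++ u) =
      if 1 ≤ B.len s.length then
        tiltMean q B.verdict B.κ (B.len s.length - u.length) (s ++ u) else 1 := by
  unfold tilt
  split_ifs with h
  · have hu := hu h
    rw [LangModel.look_one_sub_mul, tiltMean, ← q.look_take (m := m) (L := B.len s.length - u.length)
      (by simp at hm; omega)]
    rw [show (s ++ u).length + (B.len s.length - u.length) = s.length + B.len s.length by
      simp; omega]
  · simp [LangModel.look_const]

section loss

variable {I bQ IQ bD ID : ℝ} (hB : B.Valid I bQ IQ bD ID) {n : ℕ} {q : LangModel B.N} {ℓ δ : ℝ}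
  {o : ℕ} (hℓ : 0 < ℓ) (hprob : ∀ s y, ℓ ≤ q.prob s y) (hκ : B.κ ≤ 1 / 2)
  (hlen : ∀ t, B.len t = schedLen B.k o B.R0 B.dec t)

include hB hℓ hprob hκ hlen

lemma log_ideal (x : Fin n → Fin B.N) (t : Fin n) :
    Real.log (B.ideal q (textPrefix x t) (x t)) =
      Real.log (q.prob (textPrefix x t) (x t)) +
        tokenGain q B.verdict B.κ B.k o B.R0 B.dec x t := by
  have hs : (textPrefix x t).length = t := by rw [length_textPrefix]; omega
  have hL := len_le hB.J0_le t.val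
  have hk := hB.hk
  have h1 := look_tilt q (textPrefix x t) [x t] (B.k - 1)
    (by rw [List.length_append, List.length_singleton, hs]; omega)
    (by rw [hs, List.length_singleton]; exact id)
  have h2 := look_tilt q (textPrefix x t) [] B.k
    (by rw [List.append_nil, hs]; omega) (by simp)
  rw [List.append_nil] at h2
  have hpos (m : ℕ) (s : List (Fin B.N)) : tiltMean q B.verdict B.κ m s ≠ 0 :=
    ne_of_gt (by linarith [(tiltMean_mem (q := q) verdict_mem hB.κ_nonneg m s).1])
  have hq : q.prob (textPrefix x t) (x t) ≠ 0 := (hℓ.trans_le (hprob _ _)).ne'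
  rw [ideal, h1, h2, tokenGain, textPrefix_succ, hs, hlen, List.length_singleton, List.length_nil,
    Nat.sub_zero]
  split_ifs
  · rw [Real.log_div (mul_ne_zero hq (hpos _ _)) (hpos _ _), Real.log_mul hq (hpos _ _)]
    ring
  · simp

variable (hQ : B.Q.ImplementsLM B.F q) (hδ : 4 * B.k * (1 / 2 ^ B.F) ≤ δ * ℓ ^ B.k)
  (hδ2 : δ ≤ 1 / 2)

include hQ hδ hδ2

lemma log_outval_ge (x : Fin n → Fin B.N) (t : Fin n) :
    Real.log (q.prob (textPrefix x t) (x t)) +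
      tokenGain q B.verdict B.κ B.k o B.R0 B.dec x t - 2 * δ ≤
        Real.log (outval hB.hN (textPrefix x t) (x t)) := by
  rw [← log_ideal hB hℓ hprob hκ hlen]
  have h1 := ideal_le_outval hB (textPrefix x t) hQ hℓ hprob hκ hδ (by linarith) (x t)
  have h2 : 0 < B.ideal q (textPrefix x t) (x t) :=
    lt_of_lt_of_le (by linarith) (half_le_ideal hB (textPrefix x t) hℓ hprob hκ (x t))
  have h3 := Real.log_le_log (mul_pos (by linarith) h2) h1
  rw [Real.log_mul (by linarith) h2.ne'] at h3
  -- Yields `log (1 - δ) ≥ -2δ`, where `δ ≤ 1/2` is used.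
  have h4 := Real.one_sub_inv_le_log_of_pos (by linarith : 0 < 1 - δ)
  have h5 : (1 - δ)⁻¹ ≤ 1 + 2 * δ := by
    have hδ0 : 0 ≤ δ := by
      by_contra h
      have : δ * ℓ ^ B.k < 0 := mul_neg_of_neg_of_pos (not_le.1 h) (by positivity)
      have h4 : (0 : ℝ) ≤ 4 * B.k * (1 / 2 ^ B.F) := by positivity
      linarith
    rw [inv_le_iff_one_le_mul₀ (by linarith)]
    nlinarith
  linarith

lemma loss_le (hn : 0 < n) (ho : o < B.k) {c : ℝ}
    (hR : (B.R0 = n ∧ B.dec = 1) ∧ 0 ≤ c ∨ (B.R0 = B.k ∧ B.dec = 0) ∧ 2 ≤ c)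
    (p : TextDist n B.N) (q' : LangModel B.N) (hq' : ∀ s y, q'.prob s y = outval hB.hN s y) :
    nextTokenLoss p q' - nextTokenLoss p q ≤
      -((∑ x, p.prob x * ∑ b ∈ (Finset.range n).filter (fun b => (b + o) % B.k = 0),
        blockGain q B.verdict B.κ B.k x b) - c) / n + 2 * δ := by
  have hn' : (0 : ℝ) < n := by exact_mod_cast hn
  have key (x : Fin n → Fin B.N) :
      ∑ i : Fin n, Real.log (q.prob (textPrefix x i) (x i)) +
        ((∑ b ∈ (Finset.range n).filter (fun b => (b + o) % B.k = 0),
          blockGain q B.verdict B.κ B.k x b) - c - n * (2 * δ)) ≤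
      ∑ i : Fin n, Real.log (q'.prob (textPrefix x i) (x i)) := by
    have h1 := sum_blockGain_le (q := q) verdict_mem hB.κ_nonneg hκ hB.hk ho hR x
    have h2 := Finset.sum_le_sum fun t (_ : t ∈ Finset.univ) =>
      log_outval_ge hB hℓ hprob hκ hlen hQ hδ hδ2 x t
    rw [Finset.sum_sub_distrib, Finset.sum_add_distrib, Finset.sum_const, Finset.card_univ,
      Fintype.card_fin, nsmul_eq_mul, ← Finset.sum_range
        (fun t => tokenGain q B.verdict B.κ B.k o B.R0 B.dec x t)] at h2
    simp only [hq']
    linarith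
  have h3 := Finset.sum_le_sum fun x (_ : x ∈ Finset.univ) =>
    mul_le_mul_of_nonneg_left (key x) (p.nonneg x)
  simp only [mul_add, mul_sub, Finset.sum_add_distrib, Finset.sum_sub_distrib, ← Finset.sum_mul,
    p.sum_one, one_mul] at h3
  have hloss (r : LangModel B.N) : nextTokenLoss p r =
      -(∑ x, p.prob x * ∑ i : Fin n, Real.log (r.prob (textPrefix x i) (x i))) / n := by
    rw [nextTokenLoss, neg_div, Finset.sum_div]
    congr 1
    exact Finset.sum_congr rfl fun x _ => by ring
  rw [hloss, hloss, ← sub_div, div_add' _ _ _ hn'.ne']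
  refine div_le_div_of_nonneg_right ?_ hn'.le
  linarith

end loss

end Boost

/-! ### The gap below zero -/

lemma finite_fixedPoint (I : ℝ) (F : ℕ) : {r : ℝ | FixedPoint I F r}.Finite := by
  refine (Set.toFinite ((fun z : ℤ => (z : ℝ) / 2 ^ F) ''
    Set.Icc (-⌈((2 : ℝ) ^ I + 1) * 2 ^ F⌉) ⌈((2 : ℝ) ^ I + 1) * 2 ^ F⌉)).subset ?_
  rintro r ⟨h1, z, rfl⟩
  have h2 : |(z : ℝ)| ≤ (2 ^ I + 1) * 2 ^ F := by
    have h3 := (Int.lt_floor_add_one |(z : ℝ) / 2 ^ F|).le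
    rw [abs_div, abs_of_pos (by positivity : (0 : ℝ) < 2 ^ F)] at h1 h3
    rw [← div_le_iff₀ (by positivity)]
    linarith
  have h3 := abs_le.1 (h2.trans (Int.le_ceil _))
  exact ⟨z, ⟨by exact_mod_cast h3.1, by exact_mod_cast h3.2⟩, rfl⟩

lemma exists_gap {A : Set ℝ} (hA : A.Finite) : ∃ ε > 0, ∀ a ∈ A, 0 ≤ a ∨ a ≤ -ε := by
  induction A, hA using Set.Finite.induction_on with
  | empty => exact ⟨1, one_pos, by simp⟩
  | @insert a A _ _ ih =>
    obtain ⟨ε, hε, h⟩ := ih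
    rcases le_or_gt 0 a with ha | ha
    · exact ⟨ε, hε, by rintro b (rfl | hb); exacts [Or.inl ha, h b hb]⟩
    · refine ⟨min ε (-a), lt_min hε (by linarith), ?_⟩
      rintro b (rfl | hb)
      · exact Or.inr (by linarith [min_le_right ε (-b)])
      · exact (h b hb).imp_right fun h => by linarith [min_le_left ε (-a)]

/-- Bounded bit size leaves finitely many states, hence finitely many values before rounding, and
the negative ones stay away from zero. -/
lemma RNN.exists_gap (R : RNN) (I : ℝ) (F : ℕ) : ∃ ε > 0, ∀ S : R.V → ℝ,
    (∀ v, FixedPoint I F (S v)) → ∀ v, 0 ≤ (R.f v).eval S ∨ (R.f v).eval S ≤ -ε := by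
  have h1 : {S : R.V → ℝ | ∀ v, FixedPoint I F (S v)}.Finite := by
    simpa [Set.pi] using Set.Finite.pi' fun _ : R.V => finite_fixedPoint I F
  obtain ⟨ε, hε, h⟩ := _root_.exists_gap (Set.finite_iUnion fun v : R.V =>
    h1.image fun S => (R.f v).eval S)
  exact ⟨ε, hε, fun S hS v => h _ (Set.mem_iUnion.2 ⟨v, S, hS, rfl⟩)⟩

lemma Boost.clip_of_binary {x : ℝ} (h : x = 0 ∨ x = 1) : Boost.clip x = x := by
  rcases h with rfl | rfl <;> norm_num [Boost.clip]

/-! ### The numerical constants -/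

lemma two_rpow_bounds {N k T IQ ID : ℕ} (hN : 0 < N) (hk : 0 < k) (hT : 0 < T)
    (h : (ID : ℝ) + k * Real.logb 2 N + Real.logb 2 (k * T) + 1 ≤ IQ) :
    (ID : ℝ) ≤ IQ ∧ ((N ^ k : ℕ) : ℝ) ≤ 2 ^ IQ ∧ (k * T * 2 : ℝ) ≤ 2 ^ IQ := by
  have hN' : (1 : ℝ) ≤ N := by exact_mod_cast hN
  have hkT : (1 : ℝ) ≤ k * T := by exact_mod_cast Nat.mul_pos hk hT
  have h1 : 0 ≤ k * Real.logb 2 N := mul_nonneg (by positivity) (Real.logb_nonneg one_lt_two hN')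
  have h2 : 0 ≤ Real.logb 2 (k * T) := Real.logb_nonneg one_lt_two hkT
  have h3 : (0 : ℝ) ≤ ID := by positivity
  refine ⟨by linarith, ?_, ?_⟩
  · have := (Real.logb_le_iff_le_rpow one_lt_two (x := (N : ℝ) ^ k) (y := IQ) (by positivity)).1
      (by rw [Real.logb_pow]; linarith)
    simpa using this
  · have := (Real.logb_le_iff_le_rpow one_lt_two (x := (k * T * 2 : ℝ)) (y := IQ) (by positivity)).1
      (by rw [Real.logb_mul (by positivity) two_ne_zero, Real.logb_self_eq_one one_lt_two]
          linarith)
    simpa using this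

/-- Shows that the step counter fits, with `x`, `y` the two RNN-times, `P = 2 ^ bI` and `E = 2 ^
bF`: the factor `x` of `P * x` is the extra `log₂` of the time of `Q` in the integer bits. -/
lemma max_add_four_le {x y P E : ℝ} (hx : 1 ≤ x) (hy : 1 ≤ y) (hP : y ≤ P) (hE : 1088 ≤ E) :
    max x y + 4 ≤ P * x * E := by
  have h1 : max x y ≤ x * y := max_le (by nlinarith) (by nlinarith)
  have h2 : x * y ≤ P * x := by rw [mul_comm]; gcongr
  have h3 : 1 ≤ x * y := by nlinarith
  have h4 : P * x * 1088 ≤ P * x * E := mul_le_mul_of_nonneg_left hE (by linarith)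
  linarith

/-- In units of `X = α²/(8k)`: the gain per token is at least `2X`, an uncounted end of the text
costs at most `X/68`, and rounding costs at most `X/17`. -/
lemma loss_arith {α k δ c n S : ℝ} (hk : 0 < k) (hn : 0 < n)
    (hδ : δ ≤ α ^ 2 / (272 * k)) (hc : c * (544 * k) ≤ n * α ^ 2)
    (hS : n * (α / 2 * α - (α / 2) ^ 2) / k ≤ S) :
    -(S - c) / n + 2 * δ ≤ -(α ^ 2 / (8 * k)) := by
  have h1 : n * (α / 2 * α - (α / 2) ^ 2) / k = n * (2 * (α ^ 2 / (8 * k))) := by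
    field_simp; ring
  rw [h1] at hS
  have h2 : c / n ≤ α ^ 2 / (544 * k) := by
    rw [div_le_div_iff₀ hn (by positivity)]; linarith
  have h3 := div_le_div_of_nonneg_right hS hn.le
  rw [mul_div_cancel_left₀ _ hn.ne'] at h3
  have h5 : α ^ 2 / (544 * k) = α ^ 2 / (8 * k) / 68 := by field_simp; ring
  have h6 : α ^ 2 / (272 * k) = α ^ 2 / (8 * k) / 34 := by field_simp; ring
  have h7 : 0 ≤ α ^ 2 / (8 * k) := by positivity
  rw [h5] at h2
  rw [h6] at hδ
  rw [neg_div, sub_div]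
  linarith

/-- The length of the text is counted if it can be stored. -/
lemma exists_counter {n k : ℕ} {α A E : ℝ} (hA : 1 ≤ A) (hkA : (k : ℝ) ≤ A) (hE : 1 ≤ E)
    (hk : 1 ≤ k) (h : 1088 * k ^ 2 ≤ α ^ 2 * E) : ∃ (R dec : ℕ) (c : ℝ),
      ((R = n ∧ dec = 1) ∧ 0 ≤ c ∨ (R = k ∧ dec = 0) ∧ 2 ≤ c) ∧
      (R : ℝ) ≤ A * E ∧ c * (544 * k) ≤ n * α ^ 2 := by
  rcases le_or_gt (n : ℝ) E with hnE | hnE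
  · exact ⟨n, 1, 0, Or.inl ⟨⟨rfl, rfl⟩, le_rfl⟩,
      hnE.trans (le_mul_of_one_le_left (by linarith) hA), by rw [zero_mul]; positivity⟩
  -- A counter that stays at `k` never shortens a block. The cost `2` is spread over `n > E` tokens,
  -- and `2 * 544 k ≤ 1088 k² ≤ α² E`.
  · refine ⟨k, 0, 2, Or.inr ⟨⟨rfl, rfl⟩, le_rfl⟩,
      hkA.trans (le_mul_of_one_le_right (by linarith) hE), ?_⟩
    have h3 : α ^ 2 * E ≤ α ^ 2 * n := by gcongr
    have hk1 : (1 : ℝ) ≤ k := by exact_mod_cast hk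
    nlinarith

/-! ### Choice of the parameters and conclusion -/

theorem mainTheorem8 :
    ∃ C : ℕ → ℕ, ∀ (m n N k b bI bF bD bDI bDF : ℕ) (α ℓ : ℝ)
      (p : TextDist n N) (q : LangModel N) (Q : RNN) (d : Distinguisher n N k) (D : RNN),
      1 ≤ k → 0 < α → α ≤ 1 → 0 < ℓ → ℓ ≤ 1 →
      (bDI : ℝ) + k * Real.logb 2 N + Real.logb 2 (k * D.time) + 1 ≤ bI →
      bDF ≤ bF →
      1 / (2 : ℝ) ^ bF ≤ α ^ 2 * ℓ ^ (k + 1) / (1088 * k ^ 2) →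
      Q.OpsLE m → Q.HiddenSuffices N bF → Q.HasBitSize N b bI bF → Q.ImplementsLM bF q →
      (∀ s y, ℓ ≤ q.prob s y) →
      D.OpsLE m → D.HiddenSuffices N bDF → D.HasBitSize N bD bDI bDF →
      D.ImplementsDistinguisher bDF d →
      advantage d p q = α →
      ∃ (q' : LangModel N) (Q' : RNN),
        Q'.OpsLE (C m) ∧
        Q'.HiddenSuffices N bF ∧
        Q'.HasBitSize N (b + Real.logb 2 Q.time) (bI + Real.logb 2 Q.time) bF ∧
        Q'.ImplementsLM bF q' ∧
        Q'.size = Q.size + Q.hid.card + D.size + D.hid.card + 7 * k + 25 ∧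
        Q'.hid.card = Q.hid.card + D.hid.card + 6 * k + 17 ∧
        Q'.time = (N ^ k + 1) * k * (max Q.time D.time + 4) ∧
        (∀ s y, ℓ / 4 ≤ q'.prob s y) ∧
        nextTokenLoss p q' - nextTokenLoss p q ≤ -(α ^ 2 / (8 * k)) := by
  refine ⟨fun m => 2026 + 4 * ((6 + 3 * 100) * 3 ^ m), ?_⟩
  intro m n N k b bI bF bD bDI bDF α ℓ p q Q d D hk hα hα1 hℓ hℓ1 hbI hbF hF hopsQ hsuffQ hsizeQ
    hQ hprob hopsD hsuffD hsizeD hD hadv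
  obtain ⟨s, rfl⟩ := Nat.exists_eq_add_of_le hbF
  have hN : 0 < N := by
    rcases Nat.eq_zero_or_pos N with rfl | h
    · simpa using q.sum_one []
    · exact h
  have hn : 0 < n := by
    rcases Nat.eq_zero_or_pos n with rfl | h
    · simp [advantage] at hadv; linarith
    · exact h
  obtain ⟨hIQ, hNk, hkT⟩ := two_rpow_bounds hN hk D.time_pos hbI
  have hk1 : (1 : ℝ) ≤ k := by exact_mod_cast hk
  have hn' : (0 : ℝ) < n := by exact_mod_cast hn
  have hQt : (1 : ℝ) ≤ Q.time := by exact_mod_cast Q.time_pos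
  have hDt : (1 : ℝ) ≤ D.time := by exact_mod_cast D.time_pos
  have hlog : 0 ≤ Real.logb 2 Q.time := Real.logb_nonneg one_lt_two hQt
  set I : ℝ := bI + Real.logb 2 Q.time with hI
  have h2I : (2 : ℝ) ^ I = 2 ^ bI * Q.time := by
    rw [hI, Real.rpow_add two_pos, Real.rpow_logb two_pos (by norm_num) (by linarith),
      Real.rpow_natCast]
  have h2bI : (2 : ℝ) ^ bI ≤ 2 ^ I := by
    rw [h2I]; exact le_mul_of_one_le_right (by positivity) hQt
  have hα2 : α ^ 2 ≤ 1 := pow_le_one₀ hα.le hα1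
  have hF1 : 1088 * k ^ 2 ≤ α ^ 2 * (2 : ℝ) ^ (bDF + s) := by
    have h1 : ℓ ^ (k + 1) ≤ 1 := pow_le_one₀ hℓ.le hℓ1
    rw [div_le_div_iff₀ (by positivity) (by positivity)] at hF
    have h2 : α ^ 2 * ℓ ^ (k + 1) * 2 ^ (bDF + s) ≤ α ^ 2 * 1 * (2 : ℝ) ^ (bDF + s) := by gcongr
    linarith
  have hF2 : 1088 ≤ (2 : ℝ) ^ (bDF + s) := by
    have h1 : α ^ 2 * (2 : ℝ) ^ (bDF + s) ≤ 1 * 2 ^ (bDF + s) := by gcongr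
    nlinarith
  obtain ⟨εQ, hεQ, hgapQ⟩ := Q.exists_gap bI (bDF + s)
  obtain ⟨εD, hεD, hgapD⟩ := D.exists_gap bDI bDF
  -- On prefixes of texts that end at a verdict the clipping changes nothing; on other strings the
  -- output of `D` need not be `0` or `1`.
  set V : List (Fin N) → ℝ := fun x => Boost.clip (D.output bDF x) with hVdef
  have hV (x : List (Fin N)) : 0 ≤ V x ∧ V x ≤ 1 := ⟨Boost.clip_nonneg _, Boost.clip_le_one _⟩
  have hd (i : Fin n) (x : Fin n → Fin N) : d.d i x = V (textPrefix x (i + k)) := by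
    rw [hVdef]
    simp only [hD i x, Boost.clip_of_binary (d.binary i x)]
  have hq (s : List (Fin N)) (y : Fin N) : 0 < q.prob s y := hℓ.trans_le (hprob s y)
  obtain ⟨o, ho, hgain⟩ := exists_offset (κ := α / 2) hV (by linarith) (by linarith) hq p d hd hk hn
  rw [hadv] at hgain
  have h2k : (k : ℝ) ≤ 2 ^ bI := le_trans (by nlinarith) hkT
  have h2D : (D.time : ℝ) ≤ 2 ^ bI := le_trans (by nlinarith) hkT
  obtain ⟨R, dec, c, hR, hRle, hc⟩ := exists_counter (n := n)
    ((one_le_pow₀ one_le_two).trans h2bI) (h2k.trans h2bI)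
    (one_le_pow₀ one_le_two : (1 : ℝ) ≤ 2 ^ (bDF + s)) hk hF1
  let B : Boost :=
    -- `α / 2` maximizes `κα - κ²`.
    { Q := Q, D := D, N := N, k := k, G := bDF, s := s, κ := α / 2
      -- One gap for both networks: the values of `D` are scaled by `2 ^ (-s)`, and the last bound
      -- keeps grid points out of the gap.
      ε := min (min εQ (εD / 2 ^ s)) (1 / 2 ^ (bDF + s))
      -- For `o > 0` the first `k - o` tokens precede the first block, and the flag stays off until
      -- they have been read.
      J0 := k - o, R0 := R, g0 := if o = 0 then 1 else 0, dec := dec }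
  have hB : B.Valid I b bI bD bDI :=
    { hN := hN
      hk := hk
      hε := lt_min (lt_min hεQ (by positivity)) (by positivity)
      hεF := min_le_right _ _
      κ_nonneg := by change 0 ≤ α / 2; linarith
      κ_le := by change α / 2 ≤ 1; linarith
      sizeQ := hsizeQ
      sizeD := hsizeD
      suffQ := hsuffQ
      suffD := hsuffD
      gapQ := fun S hS v => (hgapQ S hS v).imp_right fun h => h.trans <| by
        rw [pow_zero, mul_one]
        exact neg_le_neg ((min_le_left _ _).trans (min_le_left _ _))
      gapD := fun S hS v => (hgapD S hS v).imp_right fun h => h.trans <| by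
        refine neg_le_neg ?_
        rw [← le_div_iff₀ (by positivity)]
        exact (min_le_left _ _).trans (min_le_right _ _)
      hIQ := by linarith
      hID := by linarith
      prob := fun t y => by
        change 0 ≤ Q.output (bDF + s) (t ++ [y]) ∧ Q.output (bDF + s) (t ++ [y]) ≤ 1
        rw [hQ]
        exact ⟨q.nonneg _ _, (Finset.single_le_sum (fun i _ => q.nonneg t i)
          (Finset.mem_univ y)).trans_eq (q.sum_one t)⟩
      pow_le := hNk.trans h2bI
      tau_le := by
        change ((max Q.time D.time + 4 : ℕ) : ℝ) ≤ 2 ^ I * 2 ^ (bDF + s)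
        rw [h2I]
        push_cast
        exact max_add_four_le hQt hDt h2D hF2
      k_le := (h2k.trans h2bI).trans (le_mul_of_one_le_right (by positivity)
        (one_le_pow₀ one_le_two))
      R0_le := hRle
      J0_le := Nat.sub_le _ _
      g0_le := by change (if o = 0 then 1 else 0) ≤ 1; split_ifs <;> simp }
  -- Chosen so that `4k` times the assumed bound on `2 ^ (-bF)` is exactly `δ ℓ^k`, as `1088 = 4 *
  -- 272`.
  set δ : ℝ := α ^ 2 * ℓ / (272 * k) with hδdef
  have hδ : 4 * B.k * (1 / 2 ^ B.F) ≤ δ * ℓ ^ B.k := by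
    change 4 * (k : ℝ) * (1 / 2 ^ (bDF + s)) ≤ δ * ℓ ^ k
    refine (mul_le_mul_of_nonneg_left hF (by positivity)).trans_eq ?_
    rw [hδdef]; field_simp; ring
  have hδle : δ ≤ α ^ 2 / (272 * k) := by
    rw [hδdef]; gcongr; exact mul_le_of_le_one_right (by positivity) hℓ1
  have hδ2 : δ ≤ 1 / 2 := by
    refine hδle.trans ?_
    rw [div_le_div_iff₀ (by positivity) (by norm_num)]
    nlinarith
  have hκ : B.κ ≤ 1 / 2 := by change α / 2 ≤ 1 / 2; linarith
  have hge := fun t => Boost.outval_ge hB t hQ hℓ hprob hκ hδ (by linarith) hδ2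
  let q' : LangModel N :=
    { prob := fun t y => Boost.outval hB.hN t y
      nonneg := fun t y => le_trans (by positivity) (hge t y)
      sum_one := fun t => Boost.sum_outval hB t hQ hℓ hprob hκ hδ (by linarith) }
  refine ⟨q', B.net hB.hN hB.hk, Boost.opsLE_net hB.hN hB.hk hopsQ hopsD,
    Boost.hiddenSuffices_net hB, ?_, Boost.output_net hB, Boost.size_net hB.hN hB.hk,
    Boost.card_hid_net hB.hN hB.hk, rfl, hge, ?_⟩
  · have h := Boost.hasBitSize_net hB
    have hb : (b : ℝ) + Real.logb 2 Q.time = 1 + I + B.F := by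
      rw [hsizeQ.1, hI]; ring
    rw [hb]; exact h
  · have h := Boost.loss_le hB hℓ hprob hκ (Boost.len_eq_schedLen ho rfl rfl) hQ hδ hδ2 hn ho hR p
      q' fun _ _ => rfl
    exact h.trans (loss_arith (by positivity) hn' hδle hc hgain)
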